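/- Let $G$ be a locally compact second countable (Hausdorff) group with Haar measure $\mu$ and let $\Lambda<G$ be a lattice. For a Borel fundamental domain $D\subset G$ of the right action of $\Lambda$ and $g\in G$, $x\in D$, let $\alpha(g,x)\in\Lambda$ be the unique element with $g^{-1}\cdot x:=g^{-1}x\,\alpha(g,x)\in D$. For $q>0$, $\Lambda$ is $L^q$-integrable in $G$ if it is finitely generated and there is a Borel fundamental domain $D$ such that $\int_D|\alpha(g,x)|^q\,d\mu(x)<\infty$ for every $g\in G$, where $|\cdot|$ is a word length on $\Lambda$. Given an isometric linear representation $\rho$ of $\Lambda$ on a real or complex Banach space $V$, a Borel fundamental domain $D$ and $1\le p<\infty$, the induced representation $I^p(\rho)$ of $G$ is the isometric representation on the Bochner space $L^p(D,V)$ given by $(I^p(\rho)(g)F)(x)=\rho(\alpha(g,x))F(g^{-1}\cdot x)$. For $f,h:\mathbb N\to[0,\infty]$ write $f\lesssim h$ if there is an integer $C>0$ with $f(n)\le C\,h(Cn+C)+Cn+C$ for all $n>0$, and $f\sim h$ if $f\lesssim h$ and $h\lesssim f$. A function $f$ is polynomial if $f\sim t^r$ for some real $r>0$, and $\deg f:=\inf\{r\ge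 1: f\lesssim t^r\}$. For a simplicial complex $X$ and $i\ge 2$, let $$\mathrm{cFV}^i_X(t)=\sup\Big\{\min\{\|b\|_1 : b\in C_i(X,\mathbb Z),\ \partial b=c\}\ :\ c\in C_{i-1}(X,\mathbb Z),\ \partial c=0,\ \|c\|_1\le t\Big\}.$$ Let $d\in\mathbb N$ and suppose that $\Lambda$ is of type $F_{d+1}$; let $X$ be any contractible simplicial complex on which $\Lambda$ acts simplicially and properly (with finite simplex stabilizers) with finitely many orbits of simplices in the $(d+1)$-skeleton, so that for $2\le i\le d$ the filling function $\mathrm{cFV}^i_\Lambda$ is, up to $\sim$, the function $\mathrm{cFV}^i_X$. Suppose that $\mathrm{cFV}^i_X$ is polynomial for $2\le i\le d$. Let $0\le k\le d$ and $N_k=\prod_{i=2}^k\deg\mathrm{cFV}^i_X$ (so $N_0=N_1=1$), let $1\le p<\infty$, and suppose that $\Lambda$ is $L^{pN_k}$-integrable in $G$. Let $(\rho,V)$ be an isometric representation of $\Lambda$ on a separable Banach space $V$, and form $I^p(\rho)$ with any Borel fundamental domain. Then there exist continuous surjective linear maps $$H^k_{\mathrm{ct}}(G,I^p(\rho))\twoheadrightarrow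 H^k(\Lambda,\rho),\qquad \overline H^k_{\mathrm{ct}}(G,I^p(\rho))\twoheadrightarrow \overline H^k(\Lambda,\rho).$$ Here, for a locally compact second countable group $H$ (in particular for $H=G$ and for the discrete group $H=\Lambda$) and an isometric representation of $H$ on a Banach space $E$, $H^k_{\mathrm{ct}}(H,E)=Z^k/B^k$ and $\overline H^k_{\mathrm{ct}}(H,E)=Z^k/\overline{B^k}$ with their quotient topologies, where $Z^k$ and $B^k$ are the cocycles and coboundaries of the complex of continuous equivariant maps $H^{k+1}\to E$ with the homogeneous coboundary and the topology of uniform convergence on compact sets ($B^0=0$). -/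

import Mathlib

open MeasureTheory Topology
open scoped ENNReal Nat

noncomputable section

namespace LatticeInduction

section Cohomology

variable {𝕜 G V : Type*} [RCLike 𝕜] [Group G] [TopologicalSpace G]
  [NormedAddCommGroup V] [NormedSpace 𝕜 V]

variable (𝕜 G V) in
/-- The coboundary `d : C^k(G, V) → C^{k+1}(G, V)`,
`(dc)(g₀, …, g_{k+1}) = ∑ᵢ (-1)ⁱ c(g₀, …, ĝᵢ, …, g_{k+1})`, on continuous cochains. The space
`C(G^{k+1}, V)` carries the compact-open topology, that is, the topology of uniform convergence on
compact subsets. -/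
def coboundary (k : ℕ) : C(Fin (k + 1) → G, V) →ₗ[𝕜] C(Fin (k + 2) → G, V) where
  toFun c :=
    { toFun := fun g => ∑ i : Fin (k + 2), (-1 : 𝕜) ^ (i : ℕ) • c (fun j => g (i.succAbove j))
      continuous_toFun := by fun_prop }
  map_add' a b := by
    ext g
    simp [smul_add, Finset.sum_add_distrib]
  map_smul' r a := by
    ext g
    simp [Finset.smul_sum, smul_comm r]

/-- The continuous `G`-equivariant cochains `C^k(G, V)^G` with respect to an isometric linear
representation `ρ` of `G` on `V`. (As `G` is a group, each `ρ g` is automatically invertible.) -/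
def equivariantCochains (ρ : G →* (V →ₗᵢ[𝕜] V)) (k : ℕ) :
    Submodule 𝕜 C(Fin (k + 1) → G, V) where
  carrier := {c | ∀ (g : G) (x : Fin (k + 1) → G), c (fun i => g * x i) = ρ g (c x)}
  add_mem' ha hb g x := by simp [ha g x, hb g x]
  zero_mem' g x := by simp
  smul_mem' r a ha g x := by simp [ha g x]

/-- The equivariant cocycles `Z^k(G, V)`. -/
def cocycles (ρ : G →* (V →ₗᵢ[𝕜] V)) (k : ℕ) : Submodule 𝕜 C(Fin (k + 1) → G, V) :=
  equivariantCochains ρ k ⊓ LinearMap.ker (coboundary 𝕜 G V k)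

/-- The coboundaries `B^k(G, V) = d(C^{k-1}(G, V)^G)`, with `B^0 = 0`. -/
def coboundaries (ρ : G →* (V →ₗᵢ[𝕜] V)) : (k : ℕ) → Submodule 𝕜 C(Fin (k + 1) → G, V)
  | 0 => ⊥
  | k + 1 => (equivariantCochains ρ k).map (coboundary 𝕜 G V k)

/-- The continuous cohomology `H^k_ct(G, V) = Z^k(G, V) / B^k(G, V)`, a (possibly non-Hausdorff)
topological vector space for the quotient topology. For a discrete group it is the usual group
cohomology. -/
abbrev ContCohomology (ρ : G →* (V →ₗᵢ[𝕜] V)) (k : ℕ) : Type _ :=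
  ↥(cocycles ρ k) ⧸ (coboundaries ρ k).submoduleOf (cocycles ρ k)

/-- The reduced continuous cohomology, `Z^k(G, V)` modulo the closure of `B^k(G, V)`. -/
abbrev ReducedContCohomology (ρ : G →* (V →ₗᵢ[𝕜] V)) (k : ℕ) : Type _ :=
  ↥(cocycles ρ k) ⧸ ((coboundaries ρ k).submoduleOf (cocycles ρ k)).topologicalClosure

end Cohomology

section Filling

variable {W : Type*}

/-- The points of the geometric realization of a simplicial complex, in barycentric coordinates. -/
def Realization (X : AbstractSimplicialComplex W) : Type _ :=
  {f : W → ℝ // ∃ s ∈ X.faces, ∃ t ∈ stdSimplex ℝ s, f = Function.extend Subtype.val t 0}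

/-- The inclusion of the closed simplex spanned by the face `s`. -/
def Realization.incl (X : AbstractSimplicialComplex W) (s : X.faces) (t : stdSimplex ℝ s.1) :
    Realization X :=
  ⟨Function.extend Subtype.val t.1 0, s.1, s.2, t.1, t.2, rfl⟩

/-- The weak topology: a set is closed iff its intersection with every closed simplex is closed. -/
instance (X : AbstractSimplicialComplex W) : TopologicalSpace (Realization X) :=
  ⨆ s : X.faces, TopologicalSpace.coinduced (Realization.incl X s) inferInstance

/-- The integral oriented simplicial chains of dimension `m - 1`: a chain is a finitely supported
alternating function on the ordered `m`-tuples of distinct vertices that span a face; its value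
at `(v₁, …, v_m)` is the coefficient of the oriented simplex `[v₁, …, v_m]`. -/
def chains (X : AbstractSimplicialComplex W) (m : ℕ) : AddSubgroup ((Fin m → W) →₀ ℤ) where
  carrier := {c | (∀ v, c v ≠ 0 → Function.Injective v ∧ ∃ s ∈ X.faces, (s : Set W) = Set.range v) ∧
    ∀ (σ : Equiv.Perm (Fin m)) (v : Fin m → W), c (v ∘ σ) = (Equiv.Perm.sign σ : ℤ) * c v}
  zero_mem' := by simp
  add_mem' {a b} ha hb := by
    refine ⟨fun v hv => ?_, fun σ v => ?_⟩
    · by_cases h : a v = 0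
      · exact hb.1 v (by simpa [h] using hv)
      · exact ha.1 v h
    · simp [ha.2 σ v, hb.2 σ v, mul_add]
  neg_mem' {a} ha := by
    refine ⟨fun v hv => ha.1 v (by simpa using hv), fun σ v => ?_⟩
    simp [ha.2 σ v]

/-- The simplicial boundary. Since `∂[w, v₁, …, v_m]` contains `[v₁, …, v_m]` with
coefficient `1`, it is given by `(∂b)(v₁, …, v_m) = ∑_w b(w, v₁, …, v_m)`. -/
def boundary {m : ℕ} (b : (Fin (m + 1) → W) →₀ ℤ) : (Fin m → W) →₀ ℤ :=
  b.mapDomain Fin.tail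

/-- The `ℓ¹`-norm of a chain: the sum over the simplices of the absolute values of the coefficients.
Each simplex with `m` vertices is the support of `m!` tuples. -/
def l1Norm {m : ℕ} (c : (Fin m → W) →₀ ℤ) : ℝ≥0∞ :=
  (∑ v ∈ c.support, ((c v).natAbs : ℝ≥0∞)) / (m ! : ℝ≥0∞)

/-- The filling volume of an `(m - 1)`-chain `c`: the least `ℓ¹`-norm of an `m`-chain with
boundary `c`. -/
def fillingVolume (X : AbstractSimplicialComplex W) {m : ℕ} (c : (Fin m → W) →₀ ℤ) : ℝ≥0∞ :=
  ⨅ b ∈ {b : (Fin (m + 1) → W) →₀ ℤ | b ∈ chains X (m + 1) ∧ boundary b = c}, l1Norm b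

/-- The combinatorial filling function `cFV^k_X(t)`, `k ≥ 2`: the supremum of the filling volumes of
the integral `(k - 1)`-cycles of `ℓ¹`-norm at most `t`. -/
def fillingFunction (X : AbstractSimplicialComplex W) : ℕ → ℕ → ℝ≥0∞
  | 0, _ => 0
  | j + 1, t =>
    ⨆ c ∈ {c : (Fin (j + 1) → W) →₀ ℤ | c ∈ chains X (j + 1) ∧ boundary c = 0 ∧ l1Norm c ≤ t},
      fillingVolume X c

/-- The relation `f ≲ g`: for some `C > 0`, `f(n) ≤ C g(Cn + C) + Cn + C` for all `n > 0`. -/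
def AsympLE (f g : ℕ → ℝ≥0∞) : Prop :=
  ∃ C : ℕ, 0 < C ∧ ∀ n : ℕ, 0 < n → f n ≤ C * g (C * n + C) + C * n + C

/-- The function `n ↦ n ^ r`. -/
def powerFun (r : ℝ) (n : ℕ) : ℝ≥0∞ := (n : ℝ≥0∞) ^ r

/-- `f` is polynomial: `f ∼ t^r` for some real `r > 0`. -/
def IsPolynomial (f : ℕ → ℝ≥0∞) : Prop :=
  ∃ r : ℝ, 0 < r ∧ AsympLE f (powerFun r) ∧ AsympLE (powerFun r) f

/-- The degree `inf {r ≥ 1 | f ≲ t^r}` of a polynomially bounded function. The relation `≲` does not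
see the difference between exponents below `1`, so only the exponents `r ≥ 1` count. -/
def degree (f : ℕ → ℝ≥0∞) : ℝ := sInf {r : ℝ | 1 ≤ r ∧ AsympLE f (powerFun r)}

/-- `N_k = ∏_{i=2}^k deg cFV^i_X` (so that `N_0 = N_1 = 1`). -/
def fillingExponent (X : AbstractSimplicialComplex W) (k : ℕ) : ℝ :=
  ∏ i ∈ Finset.Icc 2 k, degree (fillingFunction X i)

/-- The image `γ • s` of a finite set of vertices. -/
def translate {Γ : Type*} [Group Γ] [MulAction Γ W] (γ : Γ) (s : Finset W) : Finset W :=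
  s.map (MulAction.toPerm γ).toEmbedding

/-- `X` is a contractible simplicial complex on which `Γ` acts simplicially and properly (with finite
stabilizers of simplices) with finitely many orbits of simplices in the `n`-skeleton. The group
`Γ` is of type `F_n` if it has such a complex. -/
structure IsFinitenessModel (Γ : Type*) [Group Γ] [MulAction Γ W]
    (X : AbstractSimplicialComplex W) (n : ℕ) : Prop where
  contractible : ContractibleSpace (Realization X)
  simplicial : ∀ (γ : Γ), ∀ s ∈ X.faces, translate γ s ∈ X.faces
  proper : ∀ s ∈ X.faces, {γ : Γ | translate γ s = s}.Finite
  cofinite : ∃ T : Set (Finset W), T.Finite ∧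
    ∀ s ∈ X.faces, s.card ≤ n + 1 → ∃ t ∈ T, ∃ γ : Γ, translate γ t = s

end Filling

section Lattice

variable {G : Type*} [Group G]

/-- The word length of `γ` with respect to a generating set `S`. -/
def wordLength {Γ : Type*} [Group Γ] (S : Set Γ) (γ : Γ) : ℕ :=
  sInf {n | ∃ l : List Γ, l.length = n ∧ (∀ s ∈ l, s ∈ S ∨ s⁻¹ ∈ S) ∧ l.prod = γ}

/-- A lattice: a discrete subgroup `Λ` such that `G ⧸ Λ` carries a nonzero finite `G`-invariant Borel
measure. -/
structure IsLattice [TopologicalSpace G] [MeasurableSpace G] (Λ : Subgroup G) : Prop where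
  discrete : DiscreteTopology Λ
  finite_covolume : ∃ m : Measure (G ⧸ Λ), m ≠ 0 ∧ IsFiniteMeasure m ∧
    SMulInvariantMeasure G (G ⧸ Λ) m

/-- A Borel fundamental domain for the right action of `Λ` on `G`. -/
structure IsBorelFundamentalDomain [MeasurableSpace G] (Λ : Subgroup G) (D : Set G) : Prop where
  measurableSet : MeasurableSet D
  existsUnique : ∀ x : G, ∃! l : Λ, x * l ∈ D

variable [MeasurableSpace G] {Λ : Subgroup G} {D : Set G}

/-- The unique element of `Λ` that translates `x` into `D`. -/
def toDomain (hD : IsBorelFundamentalDomain Λ D) (x : G) : Λ := (hD.existsUnique x).choose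

/-- The lattice cocycle: `α(g, x)` is the unique element of `Λ` with `g⁻¹ x α(g, x) ∈ D`. -/
def cocycle (hD : IsBorelFundamentalDomain Λ D) (g x : G) : Λ := toDomain hD (g⁻¹ * x)

/-- The induced action on the fundamental domain: `g⁻¹ · x = g⁻¹ x α(g, x)`. -/
def domainAction (hD : IsBorelFundamentalDomain Λ D) (g x : G) : G :=
  g⁻¹ * x * (cocycle hD g x : G)

/-- `Λ` is `L^q`-integrable in `G`: it is finitely generated and, for a word length on it and some
Borel fundamental domain `D`, `∫_D |α(g, x)|^q dx < ∞` for all `g ∈ G`. -/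
def IsLpIntegrable (Λ : Subgroup G) (μ : Measure G) (q : ℝ) : Prop :=
  ∃ S : Finset Λ, Subgroup.closure (S : Set Λ) = ⊤ ∧
    ∃ (D : Set G) (hD : IsBorelFundamentalDomain Λ D), ∀ g : G,
      ∫⁻ x in D, (wordLength (S : Set Λ) (cocycle hD g x) : ℝ≥0∞) ^ q ∂μ < ⊤

lemma toDomain_mem (hD : IsBorelFundamentalDomain Λ D) (x : G) : x * (toDomain hD x : G) ∈ D :=
  (hD.existsUnique x).choose_spec.1

lemma toDomain_eq (hD : IsBorelFundamentalDomain Λ D) {x : G} {l : Λ} (h : x * (l : G) ∈ D) :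
    toDomain hD x = l :=
  ((hD.existsUnique x).choose_spec.2 l h).symm

lemma toDomain_mul (hD : IsBorelFundamentalDomain Λ D) (x : G) (l : Λ) :
    toDomain hD (x * l) = l⁻¹ * toDomain hD x := by
  apply toDomain_eq
  have := toDomain_mem hD x
  simpa [mul_assoc] using this

lemma toDomain_of_mem (hD : IsBorelFundamentalDomain Λ D) {x : G} (h : x ∈ D) :
    toDomain hD x = 1 := toDomain_eq hD (by simpa using h)

lemma cocycle_mul (hD : IsBorelFundamentalDomain Λ D) (g h x : G) :
    cocycle hD (g * h) x = cocycle hD g x * cocycle hD h (domainAction hD g x) := by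
  have : h⁻¹ * domainAction hD g x = ((g * h)⁻¹ * x) * (cocycle hD g x : G) := by
    simp [domainAction, mul_assoc]
  simp only [cocycle] at *
  rw [this, toDomain_mul]
  simp

lemma domainAction_mul (hD : IsBorelFundamentalDomain Λ D) (g h x : G) :
    domainAction hD (g * h) x = domainAction hD h (domainAction hD g x) := by
  have := cocycle_mul hD g h x
  rw [domainAction, this]
  simp [domainAction, mul_assoc]

end Lattice

section Induction

lemma IsLattice.countable {G : Type*} [Group G] [MeasurableSpace G] [TopologicalSpace G]
    [SecondCountableTopology G] {Λ : Subgroup G} (hΛ : IsLattice Λ) : Countable Λ := by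
  have := hΛ.discrete
  exact TopologicalSpace.separableSpace_iff_countable.mp inferInstance

variable {G : Type*} [Group G] [MeasurableSpace G] [TopologicalSpace G] [IsTopologicalGroup G]
  [LocallyCompactSpace G] [SecondCountableTopology G] [T2Space G] [BorelSpace G]
  {Λ : Subgroup G} {D : Set G}

lemma measurable_toDomain (hΛ : IsLattice Λ) (hD : IsBorelFundamentalDomain Λ D) :
    Measurable (toDomain hD) := by
  have := hΛ.countable
  refine measurable_to_countable' fun l => ?_
  have : toDomain hD ⁻¹' {l} = (fun x : G => x * (l : G)) ⁻¹' D := by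
    ext x
    simp only [Set.mem_preimage, Set.mem_singleton_iff]
    exact ⟨fun h => h ▸ toDomain_mem hD x, fun h => toDomain_eq hD h⟩
  rw [this]
  exact (measurable_mul_const _) hD.measurableSet

lemma measurable_domainAction (hΛ : IsLattice Λ) (hD : IsBorelFundamentalDomain Λ D) (g : G) :
    Measurable (domainAction hD g) := by
  have h1 : Measurable fun x : G => g⁻¹ * x := measurable_const_mul _
  exact h1.mul (measurable_subtype_coe.comp ((measurable_toDomain hΛ hD).comp h1))

/-- A Haar measure is invariant under right translation by the elements of a lattice. -/
lemma IsLattice.map_mul_right_eq_self (hΛ : IsLattice Λ) (hD : IsBorelFundamentalDomain Λ D)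
    (μ : Measure G) [μ.IsHaarMeasure] (l₀ : Λ) : μ.map (fun x => x * (l₀ : G)) = μ := by
  have := hΛ.countable
  have := hΛ.discrete
  obtain ⟨m, hm0, hmf, hmi⟩ := hΛ.finite_covolume
  have hr : ∀ a b : G, QuotientGroup.leftRel Λ a b →
      a * (toDomain hD a : G) = b * (toDomain hD b : G) := by
    intro a b hab
    rw [QuotientGroup.leftRel_apply] at hab
    have hb : b = a * ((⟨a⁻¹ * b, hab⟩ : Λ) : G) := by simp
    generalize (⟨a⁻¹ * b, hab⟩ : Λ) = l at hb
    rw [hb, toDomain_mul]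
    simp [mul_assoc]
  let s : G ⧸ Λ → G := Quotient.lift (fun x => x * (toDomain hD x : G)) hr
  have hsm : Measurable s := by
    refine measurable_from_quotient.mpr ?_
    exact measurable_id.mul (measurable_subtype_coe.comp (measurable_toDomain hΛ hD))
  have hs : ∀ q : G ⧸ Λ, ((s q : G) : G ⧸ Λ) = q := by
    intro q
    induction q using QuotientGroup.induction_on with
    | H x => exact (QuotientGroup.eq.mpr (by simp [s])).symm
  let ν : Measure G := Measure.sum fun l : Λ => (m.map s).map fun x => x * (l : G)
  have hν : ∀ f : G → ℝ≥0∞, Measurable f →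
      ∫⁻ x, f x ∂ν = ∫⁻ q, ∑' l : Λ, f (s q * l) ∂m := by
    intro f hf
    rw [lintegral_sum_measure, lintegral_tsum]
    · congr 1
      ext l
      rw [lintegral_map hf (measurable_mul_const _), lintegral_map _ hsm]
      exact hf.comp (measurable_mul_const _)
    · intro l
      exact (hf.comp ((measurable_mul_const _).comp hsm)).aemeasurable
  have hF : ∀ (f : G → ℝ≥0∞) (x : G), ∑' l : Λ, f (s (x : G ⧸ Λ) * l) = ∑' l : Λ, f (x * l) := by
    intro f x
    have : s (x : G ⧸ Λ) = x * (toDomain hD x : G) := rfl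
    rw [this, ← (Equiv.mulLeft (toDomain hD x)).tsum_eq (fun l : Λ => f (x * l))]
    simp [mul_assoc]
  have hleft : ν.IsMulLeftInvariant := by
    refine ⟨fun g => ?_⟩
    refine Measure.ext_of_lintegral _ fun f hf => ?_
    rw [lintegral_map hf (measurable_const_mul _), hν _ hf, hν (fun x => f (g * x)) (hf.comp (measurable_const_mul g))]
    have h1 : ∀ q : G ⧸ Λ, ∑' l : Λ, f (g * (s q * l)) = ∑' l : Λ, f (s (g • q) * l) := by
      intro q
      have h2 : g • q = ((g * s q : G) : G ⧸ Λ) := by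
        conv_lhs => rw [← hs q]
        rfl
      rw [h2, hF]
      simp [mul_assoc]
    simp only [h1]
    have hmp : MeasurePreserving (fun q : G ⧸ Λ => g • q) m m := by
      have hgm : Measurable fun q : G ⧸ Λ => g • q :=
        measurable_from_quotient.mpr (measurable_quotient_mk''.comp (measurable_const_mul g))
      refine ⟨hgm, Measure.ext fun A hA => ?_⟩
      rw [Measure.map_apply hgm hA]
      exact hmi.measure_preimage_smul g hA
    rw [hmp.lintegral_comp (f := fun q => ∑' l : Λ, f (s q * l))]
    exact Measurable.tsum fun l => hf.comp ((measurable_mul_const _).comp hsm)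
  have hright : ν.map (fun x => x * (l₀ : G)) = ν := by
    refine Measure.ext_of_lintegral _ fun f hf => ?_
    rw [lintegral_map hf (measurable_mul_const _), hν _ hf,
      hν (fun x => f (x * (l₀ : G))) (hf.comp (measurable_mul_const _))]
    congr 1
    ext q
    rw [← (Equiv.mulRight l₀).tsum_eq (fun l : Λ => f (s q * l))]
    simp [mul_assoc]
  have hfin : IsFiniteMeasureOnCompacts ν := by
    obtain ⟨U, hU, hUo, hU1⟩ : ∃ U : Set G, (∀ x ∈ U, ∀ y ∈ U, x⁻¹ * y ∈ Λ → x = y) ∧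
        IsOpen U ∧ (1 : G) ∈ U := by
      obtain ⟨O, hO, hOΛ⟩ : ∃ O : Set G, IsOpen O ∧ (Subtype.val : Λ → G) ⁻¹' O = {1} :=
        isOpen_induced_iff.mp (isOpen_discrete ({1} : Set Λ))
      have h1O : (1 : G) ∈ O := by
        have : (1 : Λ) ∈ (Subtype.val : Λ → G) ⁻¹' O := by rw [hOΛ]; rfl
        simpa using this
      have hc : Continuous fun z : G × G => z.1⁻¹ * z.2 := by fun_prop
      have hn : (fun z : G × G => z.1⁻¹ * z.2) ⁻¹' O ∈ 𝓝 ((1 : G), (1 : G)) :=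
        (hO.preimage hc).mem_nhds (by simpa using h1O)
      rw [nhds_prod_eq, Filter.mem_prod_same_iff] at hn
      obtain ⟨t, ht, htO⟩ := hn
      obtain ⟨U, hUt, hUo, hU1⟩ := mem_nhds_iff.mp ht
      refine ⟨U, fun x hx y hy hxy => ?_, hUo, hU1⟩
      have h2 : (⟨x⁻¹ * y, hxy⟩ : Λ) ∈ (Subtype.val : Λ → G) ⁻¹' O :=
        htO (Set.mk_mem_prod (hUt hx) (hUt hy))
      rw [hOΛ, Set.mem_singleton_iff, Subtype.ext_iff] at h2
      exact inv_mul_eq_one.mp h2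
    have hνU : ν U < ⊤ := by
      rw [← lintegral_indicator_one hUo.measurableSet, hν _ (measurable_one.indicator hUo.measurableSet)]
      calc ∫⁻ q, ∑' l : Λ, U.indicator 1 (s q * l) ∂m ≤ ∫⁻ _, 1 ∂m := by
            refine lintegral_mono fun q => ?_
            by_cases h : ∃ l : Λ, s q * l ∈ U
            · obtain ⟨l, hl⟩ := h
              rw [tsum_eq_single l]
              · exact Set.indicator_le_self' (by simp) _
              · intro l' hl'
                refine Set.indicator_of_notMem (fun hh => hl' ?_) _
                have := hU _ hl _ hh (by simp [mul_assoc, Λ.mul_mem])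
                exact (Subtype.ext (mul_left_cancel this)).symm
            · push Not at h
              simp [Set.indicator_of_notMem (h _)]
        _ < ⊤ := by simp
    refine ⟨fun K hK => ?_⟩
    obtain ⟨t, ht⟩ := hK.elim_finite_subcover (fun g : G => (fun x => g⁻¹ * x) ⁻¹' U)
      (fun g => hUo.preimage (continuous_const_mul _)) (fun x _ => Set.mem_iUnion.mpr ⟨x, by simpa⟩)
    refine (measure_mono ht).trans_lt ((measure_biUnion_finset_le _ _).trans_lt ?_)
    refine ENNReal.sum_lt_top.mpr fun g _ => ?_
    rwa [measure_preimage_mul]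
  have huniq := Measure.isMulLeftInvariant_eq_smul ν μ
  have hc0 : ν.haarScalarFactor μ ≠ 0 := by
    intro h0
    rw [h0, zero_smul] at huniq
    have h1 := hν 1 measurable_one
    rw [huniq] at h1
    have h2 : ∀ᵐ q ∂m, ∑' l : Λ, (1 : G → ℝ≥0∞) (s q * l) = 0 := by
      have := (lintegral_eq_zero_iff (by
        exact Measurable.tsum fun l => measurable_const)).mp (h1.symm.trans (by simp))
      exact this
    apply hm0
    rw [← Measure.measure_univ_eq_zero, ← nonpos_iff_eq_zero]
    have h3 : ∀ᵐ q ∂m, False := by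
      filter_upwards [h2] with q hq
      have := ENNReal.tsum_eq_zero.mp hq 1
      simp at this
    simpa [ae_iff] using h3
  generalize ν.haarScalarFactor μ = c at huniq hc0
  have h1 : c • μ.map (fun x => x * (l₀ : G)) = c • μ := by
    rw [← Measure.map_smul, ← huniq, hright]
  calc μ.map (fun x => x * (l₀ : G)) = c⁻¹ • c • μ.map (fun x => x * (l₀ : G)) := by
        rw [smul_smul, inv_mul_cancel₀ hc0, one_smul]
    _ = μ := by rw [h1, smul_smul, inv_mul_cancel₀ hc0, one_smul]

lemma measurePreserving_domainAction (hΛ : IsLattice Λ) (hD : IsBorelFundamentalDomain Λ D)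
    (μ : Measure G) [μ.IsHaarMeasure] (g : G) :
    MeasurePreserving (domainAction hD g) (μ.restrict D) (μ.restrict D) := by
  have := hΛ.countable
  have hcop : Countable Λ.op := Countable.of_equiv Λ Λ.equivOp
  have hinv : SMulInvariantMeasure Λ.op G μ := by
    refine ⟨fun c A hA => ?_⟩
    have h := hΛ.map_mul_right_eq_self hD μ ⟨MulOpposite.unop c.1, c.2⟩
    conv_rhs => rw [← h]
    rw [Measure.map_apply (measurable_mul_const _) hA]
    rfl
  have hfun : ∀ E : Set G, IsBorelFundamentalDomain Λ E → IsFundamentalDomain Λ.op E μ := by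
    intro E hE
    refine IsFundamentalDomain.mk' hE.measurableSet.nullMeasurableSet fun x => ?_
    obtain ⟨l, hl, hu⟩ := hE.existsUnique x
    refine ⟨⟨MulOpposite.op (l : G), l.2⟩, hl, fun c hc => ?_⟩
    have := hu ⟨MulOpposite.unop c.1, c.2⟩ hc
    rw [← this]
    rfl
  have hgD : IsBorelFundamentalDomain Λ ((fun x => g * x) ⁻¹' D) :=
    ⟨measurable_const_mul g hD.measurableSet, fun x => by
      simpa [mul_assoc] using hD.existsUnique (g * x)⟩
  refine ⟨measurable_domainAction hΛ hD g, ?_⟩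
  refine Measure.ext_of_lintegral _ fun f hf => ?_
  rw [lintegral_map hf (measurable_domainAction hΛ hD g)]
  let F : G → ℝ≥0∞ := fun x => f (x * (toDomain hD x : G))
  have hFm : Measurable F := hf.comp
    (measurable_id.mul (measurable_subtype_coe.comp (measurable_toDomain hΛ hD)))
  have hFinv : ∀ (c : Λ.op) (x : G), F (c • x) = F x := by
    intro c x
    have hc : c • x = x * ((⟨MulOpposite.unop c.1, c.2⟩ : Λ) : G) := rfl
    generalize (⟨MulOpposite.unop c.1, c.2⟩ : Λ) = l at hc
    simp only [F, hc, toDomain_mul]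
    simp [mul_assoc]
  calc ∫⁻ x in D, f (domainAction hD g x) ∂μ = ∫⁻ x in D, F (g⁻¹ * x) ∂μ := rfl
    _ = ∫⁻ x in (fun x => g * x) ⁻¹' D, F x ∂μ := by
        have hmp : MeasurePreserving (fun x : G => g * x) μ μ := measurePreserving_mul_left μ g
        have := (hmp.setLIntegral_comp_preimage hD.measurableSet
          (f := fun x => F (g⁻¹ * x)) (hFm.comp (measurable_const_mul _)))
        rw [← this]
        simp
    _ = ∫⁻ x in D, F x ∂μ := (hfun _ hgD).setLIntegral_eq (hfun _ hD) F hFinv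
    _ = ∫⁻ x in D, f x ∂μ := by
        refine setLIntegral_congr_fun hD.measurableSet fun x hx => ?_
        simp [F, toDomain_of_mem hD hx]

variable {𝕜 V : Type*} [RCLike 𝕜] [NormedAddCommGroup V] [NormedSpace 𝕜 V]

lemma aestronglyMeasurable_twist (hΛ : IsLattice Λ) (hD : IsBorelFundamentalDomain Λ D)
    (μ : Measure G) [μ.IsHaarMeasure] (ρ : Λ →* (V →ₗᵢ[𝕜] V)) (g : G) {f : G → V}
    (hf : AEStronglyMeasurable f (μ.restrict D)) :
    AEStronglyMeasurable (fun x => ρ (cocycle hD g x) (f (domainAction hD g x)))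
      (μ.restrict D) := by
  have := hΛ.countable
  have := hΛ.discrete
  have h1 : Measurable (cocycle hD g) :=
    (measurable_toDomain hΛ hD).comp (measurable_const_mul g⁻¹)
  have h2 : AEStronglyMeasurable (fun x => f (domainAction hD g x)) (μ.restrict D) :=
    hf.comp_measurePreserving (measurePreserving_domainAction hΛ hD μ g)
  have h3 : Continuous fun z : Λ × V => ρ z.1 z.2 :=
    continuous_prod_of_discrete_left.mpr fun l => (ρ l).continuous
  exact h3.comp_aestronglyMeasurable (h1.aestronglyMeasurable.prodMk h2)

lemma memLp_twist (hΛ : IsLattice Λ) (hD : IsBorelFundamentalDomain Λ D)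
    (μ : Measure G) [μ.IsHaarMeasure] (ρ : Λ →* (V →ₗᵢ[𝕜] V)) (p : ℝ≥0∞) (g : G) {f : G → V}
    (hf : MemLp f p (μ.restrict D)) :
    MemLp (fun x => ρ (cocycle hD g x) (f (domainAction hD g x))) p (μ.restrict D) :=
  (hf.comp_measurePreserving (measurePreserving_domainAction hΛ hD μ g)).of_le
    (aestronglyMeasurable_twist hΛ hD μ ρ g hf.1)
    (Filter.Eventually.of_forall fun x => by simp)

/-- The `L^p`-induced representation `I^p(ρ)` of `G` on `L^p(D, V)`:
`(I(g)F)(x) = ρ(α(g, x)) F(g⁻¹ · x)` for almost every `x ∈ D`. -/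
def inducedRep (hΛ : IsLattice Λ) (hD : IsBorelFundamentalDomain Λ D)
    (μ : Measure G) [μ.IsHaarMeasure] (ρ : Λ →* (V →ₗᵢ[𝕜] V)) (p : ℝ≥0∞) [Fact (1 ≤ p)] :
    G →* (Lp V p (μ.restrict D) →ₗᵢ[𝕜] Lp V p (μ.restrict D)) where
  toFun g :=
    { toFun := fun F => (memLp_twist hΛ hD μ ρ p g (Lp.memLp F)).toLp
        (fun x => ρ (cocycle hD g x) (F (domainAction hD g x)))
      map_add' := fun F F' => by
        have hq := (measurePreserving_domainAction hΛ hD μ g).quasiMeasurePreserving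
        rw [← MemLp.toLp_add, MemLp.toLp_eq_toLp_iff]
        filter_upwards [hq.ae (Lp.coeFn_add F F')] with x hx
        rw [hx, Pi.add_apply, map_add]
        rfl
      map_smul' := fun r F => by
        have hq := (measurePreserving_domainAction hΛ hD μ g).quasiMeasurePreserving
        rw [RingHom.id_apply, ← MemLp.toLp_const_smul, MemLp.toLp_eq_toLp_iff]
        filter_upwards [hq.ae (Lp.coeFn_smul r F)] with x hx
        rw [hx, Pi.smul_apply, map_smul]
        rfl
      norm_map' := fun F => by
        have hmp := measurePreserving_domainAction hΛ hD μ g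
        change ‖(memLp_twist hΛ hD μ ρ p g (Lp.memLp F)).toLp _‖ = ‖F‖
        rw [Lp.norm_toLp, Lp.norm_def]
        congr 1
        rw [← eLpNorm_comp_measurePreserving (Lp.aestronglyMeasurable F) hmp]
        exact eLpNorm_congr_norm_ae (Filter.Eventually.of_forall fun x => by simp) }
  map_one' := by
    ext F
    refine (MemLp.coeFn_toLp (memLp_twist hΛ hD μ ρ p 1 (Lp.memLp F))).trans ?_
    filter_upwards [ae_restrict_mem hD.measurableSet] with x hx
    simp [cocycle, domainAction, toDomain_of_mem hD hx]
  map_mul' g h := by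
    ext F
    refine (MemLp.coeFn_toLp (memLp_twist hΛ hD μ ρ p (g * h) (Lp.memLp F))).trans ?_
    refine Filter.EventuallyEq.trans ?_
      (MemLp.coeFn_toLp (memLp_twist hΛ hD μ ρ p g (Lp.memLp
        ((memLp_twist hΛ hD μ ρ p h (Lp.memLp F)).toLp _)))).symm
    have hq := (measurePreserving_domainAction hΛ hD μ g).quasiMeasurePreserving
    filter_upwards [hq.ae (MemLp.coeFn_toLp (memLp_twist hΛ hD μ ρ p h (Lp.memLp F)))] with x hx
    rw [hx, cocycle_mul, domainAction_mul, map_mul]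
    rfl

end Induction

end LatticeInduction

end

open LatticeInduction

/-!
The map in cohomology is a *transfer*: a continuous equivariant cochain of `G` with values in
`L^p(D, V)` is read as a `Λ`-equivariant function on tuples of `G` with values in `V`, which is
averaged over translates and restricted to `Λ`. Only its surjectivity, on cocycles modulo
coboundaries, needs the filling functions and the integrability of `Λ`.

**Transfer.** A continuous equivariant cochain `c` is represented by a measurable kernel
`Φ : G^{k+1} → V` with `Φ (l g) = ρ l (Φ g)` for `l ∈ Λ`, unique almost everywhere
(`exists_isKernel`, `IsKernel`). Averaging `Φ` over independent translates of its arguments, with a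
compactly supported continuous density `θ`, gives a function that is defined everywhere, is
equivariant, depends continuously on `c` and commutes with the homogeneous coboundary. Its
restriction to `Λ^{k+1}` is `transfer`.

**Surjectivity.** Every cocycle of `Λ` is cohomologous to one whose norm at `γ` is bounded by a
multiple of `(1 + ∑ |γᵢ|)^{N_k}` (`exists_cocycle_polynomial_growth`). Indeed an equivariant chain
map of ordered chains of `Λ` that factors through `X` is built by filling cycles degree by degree. In
degree `i` a cycle of mass at most `t` has a filling of mass at most of order `t^{deg cFV^i}`, so that
a `k`-simplex of size at most `t` is sent to a chain of mass at most of order `t^{N_k}`, composed of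
simplices from finitely many orbits, on which the cocycle is bounded.

Such a cocycle `b` can be induced. The fundamental domain `D'` for which `Λ` is integrable provides an
equivariant retraction `r : G → Λ` with `r(x⁻¹g) = α(g, x)`. Averaging the pullback of `b` along it
over translates gives a continuous cocycle of `G` with values in `L^p(D, V)`, because the integral of
`|α(g, ·)|^{p N_k}` over `D'` is locally bounded in `g` (`inducedCochain`,
`exists_lintegral_cocycle_le`). The transfer of the induced cocycle is the average of `b` over random
translations of its arguments in `Λ`. This is cohomologous to `b`, by integrating the homotopy
between a translation and the identity, whose terms are integrable by the same weight estimate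
(`exists_integral_translation_sub_eq`).

So the transfer is surjective on cocycles modulo coboundaries, and a continuous linear map with this
property that preserves coboundaries induces surjections of both quotients
(`exists_surjective_quotient_maps`).
-/

noncomputable section

namespace LatticeInduction

/-! ### Ordered chains on tuples, cones and homotopies -/

section TupleChains

variable {𝕜 Y Z V : Type*} [CommRing 𝕜] [AddCommGroup V] [Module 𝕜 V]

variable (𝕜 Y) in
/-- The space of ordered chains: formal `𝕜`-linear combinations of `n`-tuples of points of `Y`. The
index is the number `n` of vertices, so that degree `0` is the augmentation term. -/
abbrev TupleChain (n : ℕ) : Type _ := (Fin n → Y) →₀ 𝕜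

/-- The boundary of ordered chains, the alternating sum of the faces. -/
def tupleBoundary (n : ℕ) : TupleChain 𝕜 Y (n + 1) →ₗ[𝕜] TupleChain 𝕜 Y n :=
  Finsupp.linearCombination 𝕜 fun y : Fin (n + 1) → Y =>
    ∑ i : Fin (n + 1), (-1 : 𝕜) ^ (i : ℕ) • Finsupp.single (fun j => y (i.succAbove j)) (1 : 𝕜)

/-- The cone with apex `a`: the vertex `a` is put in front of every tuple. -/
def cone {n : ℕ} (a : Y) : TupleChain 𝕜 Y n →ₗ[𝕜] TupleChain 𝕜 Y (n + 1) :=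
  Finsupp.lmapDomain 𝕜 𝕜 fun y => (Fin.cons a y : Fin (n + 1) → Y)

/-- The diagonal action of `γ` on ordered chains. -/
def chainAct {Γ : Type*} [SMul Γ Y] (γ : Γ) (n : ℕ) : TupleChain 𝕜 Y n →ₗ[𝕜] TupleChain 𝕜 Y n :=
  Finsupp.lmapDomain 𝕜 𝕜 fun y i => γ • y i

/-- The value of a function on tuples at an ordered chain. -/
def evalChain (𝕜 : Type*) [CommRing 𝕜] [Module 𝕜 V] {n : ℕ} (f : (Fin n → Y) → V) :
    TupleChain 𝕜 Y n →ₗ[𝕜] V :=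
  Finsupp.linearCombination 𝕜 f

/-- The homogeneous coboundary of a function on tuples. -/
def tupleCoboundary (𝕜 : Type*) [CommRing 𝕜] [Module 𝕜 V] {n : ℕ} (f : (Fin n → Y) → V)
    (y : Fin (n + 1) → Y) : V :=
  ∑ i : Fin (n + 1), (-1 : 𝕜) ^ (i : ℕ) • f fun j => y (i.succAbove j)

@[simp]
lemma tupleBoundary_single {n : ℕ} (y : Fin (n + 1) → Y) :
    tupleBoundary (𝕜 := 𝕜) n (Finsupp.single y 1) = ∑ i : Fin (n + 1),
      (-1 : 𝕜) ^ (i : ℕ) • Finsupp.single (fun j => y (i.succAbove j)) (1 : 𝕜) := by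
  simp [tupleBoundary]

@[simp]
lemma cone_single {n : ℕ} (a : Y) (y : Fin n → Y) (r : 𝕜) :
    cone a (Finsupp.single y r) = Finsupp.single (Fin.cons a y : Fin (n + 1) → Y) r := by
  simp [cone]

@[simp]
lemma chainAct_single {Γ : Type*} [SMul Γ Y] (γ : Γ) {n : ℕ} (y : Fin n → Y) (r : 𝕜) :
    chainAct γ n (Finsupp.single y r) = Finsupp.single (fun i => γ • y i) r := by
  simp [chainAct]

@[simp]
lemma evalChain_single {n : ℕ} (f : (Fin n → Y) → V) (y : Fin n → Y) (r : 𝕜) :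
    evalChain 𝕜 f (Finsupp.single y r) = r • f y := by
  simp [evalChain]

lemma evalChain_tupleBoundary {n : ℕ} (f : (Fin n → Y) → V) (x : TupleChain 𝕜 Y (n + 1)) :
    evalChain 𝕜 f (tupleBoundary n x) = evalChain 𝕜 (tupleCoboundary 𝕜 f) x := by
  suffices h : evalChain 𝕜 f ∘ₗ tupleBoundary n = evalChain 𝕜 (tupleCoboundary 𝕜 f) from
    LinearMap.congr_fun h x
  ext y
  simp [tupleCoboundary]

lemma evalChain_cone {n : ℕ} (f : (Fin (n + 1) → Y) → V) (a : Y) (x : TupleChain 𝕜 Y n) :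
    evalChain 𝕜 f (cone a x) = evalChain 𝕜 (fun y => f (Fin.cons a y)) x := by
  suffices h : evalChain 𝕜 f ∘ₗ cone a = evalChain 𝕜 (fun y => f (Fin.cons a y)) from
    LinearMap.congr_fun h x
  ext y
  simp

lemma cons_comp_succAbove_succ {n : ℕ} (a : Y) (y : Fin (n + 1) → Y) (i : Fin (n + 1)) :
    (fun j => (Fin.cons a y : Fin (n + 2) → Y) (i.succ.succAbove j)) =
      (Fin.cons a (fun j => y (i.succAbove j)) : Fin (n + 1) → Y) := by
  funext j
  refine Fin.cases ?_ (fun j => ?_) j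
  · simp
  · simp

/-- A cone is a contracting homotopy. -/
lemma tupleBoundary_cone {n : ℕ} (a : Y) (x : TupleChain 𝕜 Y (n + 1)) :
    tupleBoundary (n + 1) (cone a x) = x - cone a (tupleBoundary n x) := by
  suffices h : tupleBoundary (n + 1) ∘ₗ cone a =
      LinearMap.id - cone (𝕜 := 𝕜) a ∘ₗ tupleBoundary n from LinearMap.congr_fun h x
  refine Finsupp.lhom_ext' fun y => LinearMap.ext_ring ?_
  simp only [LinearMap.comp_apply, Finsupp.lsingle_apply, cone_single, tupleBoundary_single,
    LinearMap.sub_apply, LinearMap.id_apply, map_sum, map_smul]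
  rw [Fin.sum_univ_succ]
  simp only [cons_comp_succAbove_succ]
  simp [pow_succ, Finset.sum_neg_distrib, sub_eq_add_neg]

lemma tupleBoundary_cone_zero (a : Y) (x : TupleChain 𝕜 Y 0) :
    tupleBoundary 0 (cone a x) = x := by
  suffices h : tupleBoundary 0 ∘ₗ cone a = LinearMap.id (R := 𝕜) (M := TupleChain 𝕜 Y 0) from
    LinearMap.congr_fun h x
  refine Finsupp.lhom_ext' fun y => LinearMap.ext_ring ?_
  simp [Subsingleton.elim (fun j : Fin 0 => _) y]

lemma single_eq_cone {n : ℕ} (y : Fin (n + 1) → Y) (r : 𝕜) :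
    Finsupp.single y r = cone (y 0) (Finsupp.single (Fin.tail y) r) := by
  simp [Fin.cons_self_tail]

lemma tupleBoundary_tupleBoundary : ∀ {n : ℕ} (x : TupleChain 𝕜 Y (n + 2)),
    tupleBoundary n (tupleBoundary (n + 1) x) = 0 := by
  intro n
  induction n with
  | zero =>
    intro x
    suffices h : tupleBoundary 0 ∘ₗ tupleBoundary (𝕜 := 𝕜) (Y := Y) 1 = 0 from
      LinearMap.congr_fun h x
    refine Finsupp.lhom_ext' fun y => LinearMap.ext_ring ?_
    simp only [LinearMap.comp_apply, Finsupp.lsingle_apply, LinearMap.zero_apply]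
    rw [single_eq_cone, tupleBoundary_cone, map_sub, tupleBoundary_cone_zero, sub_self]
  | succ n ih =>
    intro x
    suffices h : tupleBoundary (n + 1) ∘ₗ tupleBoundary (𝕜 := 𝕜) (Y := Y) (n + 2) = 0 from
      LinearMap.congr_fun h x
    refine Finsupp.lhom_ext' fun y => LinearMap.ext_ring ?_
    simp only [LinearMap.comp_apply, Finsupp.lsingle_apply, LinearMap.zero_apply]
    rw [single_eq_cone, tupleBoundary_cone, map_sub, tupleBoundary_cone, ih]
    simp

lemma tupleCoboundary_tupleCoboundary {n : ℕ} (f : (Fin n → Y) → V) :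
    tupleCoboundary 𝕜 (tupleCoboundary 𝕜 f) = 0 := by
  funext y
  have h := evalChain_tupleBoundary (𝕜 := 𝕜) f (tupleBoundary (n + 1) (Finsupp.single y (1 : 𝕜)))
  rw [tupleBoundary_tupleBoundary, map_zero, evalChain_tupleBoundary] at h
  simpa using h.symm

lemma chainAct_cone {Γ : Type*} [SMul Γ Y] (γ : Γ) {n : ℕ} (a : Y) (x : TupleChain 𝕜 Y n) :
    chainAct γ (n + 1) (cone a x) = cone (γ • a) (chainAct γ n x) := by
  suffices h : chainAct γ (n + 1) ∘ₗ cone a = cone (𝕜 := 𝕜) (γ • a) ∘ₗ chainAct γ n from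
    LinearMap.congr_fun h x
  refine Finsupp.lhom_ext' fun y => LinearMap.ext_ring ?_
  simp only [LinearMap.comp_apply, Finsupp.lsingle_apply, cone_single, chainAct_single]
  congr 1
  funext j
  refine Fin.cases ?_ (fun j => ?_) j <;> simp

lemma chainAct_tupleBoundary {Γ : Type*} [SMul Γ Y] (γ : Γ) {n : ℕ} (x : TupleChain 𝕜 Y (n + 1)) :
    chainAct γ n (tupleBoundary n x) = tupleBoundary n (chainAct γ (n + 1) x) := by
  suffices h : chainAct γ n ∘ₗ tupleBoundary n =
      tupleBoundary (𝕜 := 𝕜) (Y := Y) n ∘ₗ chainAct γ (n + 1) from LinearMap.congr_fun h x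
  refine Finsupp.lhom_ext' fun y => LinearMap.ext_ring ?_
  simp

/-- The homotopy from a chain map `δ` to zero obtained by coning, tuple by tuple, off an apex that
depends on the first vertex only. -/
def coneHomotopy (e : Y → Z) (δ : ∀ n, TupleChain 𝕜 Y n →ₗ[𝕜] TupleChain 𝕜 Z n) :
    ∀ n, TupleChain 𝕜 Y n →ₗ[𝕜] TupleChain 𝕜 Z (n + 1)
  | 0 => 0
  | n + 1 => Finsupp.linearCombination 𝕜 fun y : Fin (n + 1) → Y =>
      cone (e (y 0)) (δ (n + 1) (Finsupp.single y 1) -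
        coneHomotopy e δ n (tupleBoundary n (Finsupp.single y 1)))

lemma coneHomotopy_succ_single (e : Y → Z) (δ : ∀ n, TupleChain 𝕜 Y n →ₗ[𝕜] TupleChain 𝕜 Z n)
    {n : ℕ} (y : Fin (n + 1) → Y) :
    coneHomotopy e δ (n + 1) (Finsupp.single y 1) =
      cone (e (y 0)) (δ (n + 1) (Finsupp.single y 1) -
        coneHomotopy e δ n (tupleBoundary n (Finsupp.single y 1))) := by
  simp [coneHomotopy]

/-- A chain map up to degree `N` that vanishes on the augmentation term is null-homotopic up to
degree `N`. -/
lemma tupleBoundary_coneHomotopy (e : Y → Z)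
    (δ : ∀ n, TupleChain 𝕜 Y n →ₗ[𝕜] TupleChain 𝕜 Z n) (h0 : δ 0 = 0) {N : ℕ}
    (hδ : ∀ n < N, ∀ x, tupleBoundary n (δ (n + 1) x) = δ n (tupleBoundary n x)) :
    ∀ n < N, ∀ x, tupleBoundary (n + 1) (coneHomotopy e δ (n + 1) x) =
      δ (n + 1) x - coneHomotopy e δ n (tupleBoundary n x) := by
  have key : ∀ n < N, (∀ x, tupleBoundary n (δ (n + 1) x - coneHomotopy e δ n (tupleBoundary n x)) =
      0) → ∀ x, tupleBoundary (n + 1) (coneHomotopy e δ (n + 1) x) =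
      δ (n + 1) x - coneHomotopy e δ n (tupleBoundary n x) := by
    intro n hn hz x
    suffices h : tupleBoundary (n + 1) ∘ₗ coneHomotopy e δ (n + 1) =
      δ (n + 1) - coneHomotopy e δ n ∘ₗ tupleBoundary n from LinearMap.congr_fun h x
    refine Finsupp.lhom_ext' fun y => LinearMap.ext_ring ?_
    simp only [LinearMap.comp_apply, Finsupp.lsingle_apply, LinearMap.sub_apply]
    rw [coneHomotopy_succ_single, tupleBoundary_cone, hz]
    simp
  intro n
  induction n with
  | zero =>
    intro hn
    refine key 0 hn fun x => ?_
    simp [coneHomotopy, hδ 0 hn, h0]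
  | succ n ih =>
    intro hn
    refine key (n + 1) hn fun x => ?_
    rw [map_sub, hδ (n + 1) hn, ih (by omega), tupleBoundary_tupleBoundary]
    simp

lemma coneHomotopy_chainAct {Γ : Type*} [SMul Γ Y] [SMul Γ Z] {e : Y → Z}
    {δ : ∀ n, TupleChain 𝕜 Y n →ₗ[𝕜] TupleChain 𝕜 Z n} (γ : Γ) (he : ∀ y, e (γ • y) = γ • e y)
    (hδ : ∀ n x, δ n (chainAct γ n x) = chainAct γ n (δ n x)) :
    ∀ n x, coneHomotopy e δ n (chainAct γ n x) = chainAct γ (n + 1) (coneHomotopy e δ n x) := by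
  intro n
  induction n with
  | zero => simp [coneHomotopy]
  | succ n ih =>
    intro x
    suffices h : coneHomotopy e δ (n + 1) ∘ₗ chainAct γ (n + 1) =
      chainAct γ (n + 2) ∘ₗ coneHomotopy e δ (n + 1) from LinearMap.congr_fun h x
    refine Finsupp.lhom_ext' fun y => LinearMap.ext_ring ?_
    simp only [LinearMap.comp_apply, Finsupp.lsingle_apply]
    rw [coneHomotopy_succ_single, chainAct_cone, map_sub, ← ih, ← hδ, chainAct_tupleBoundary,
      chainAct_single, coneHomotopy_succ_single, he]

/-- A cocycle `f` changes by a coboundary under a null-homotopic chain map. -/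
lemma evalChain_eq_tupleCoboundary (e : Y → Z)
    (δ : ∀ n, TupleChain 𝕜 Y n →ₗ[𝕜] TupleChain 𝕜 Z n) (h0 : δ 0 = 0) {n : ℕ}
    (hδ : ∀ m < n + 1, ∀ x, tupleBoundary m (δ (m + 1) x) = δ m (tupleBoundary m x))
    {f : (Fin (n + 1) → Z) → V} (hf : tupleCoboundary 𝕜 f = 0) (y : Fin (n + 1) → Y) :
    evalChain 𝕜 f (δ (n + 1) (Finsupp.single y 1)) = tupleCoboundary 𝕜
      (fun z => evalChain 𝕜 f (coneHomotopy e δ n (Finsupp.single z 1))) y := by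
  have h := tupleBoundary_coneHomotopy e δ h0 hδ n (by omega) (Finsupp.single y 1)
  rw [eq_comm, sub_eq_iff_eq_add] at h
  rw [h, map_add, evalChain_tupleBoundary, hf]
  have h2 : evalChain 𝕜 (0 : (Fin (n + 2) → Z) → V) = 0 := by
    refine Finsupp.lhom_ext' fun y => LinearMap.ext_ring ?_
    simp
  rw [h2, LinearMap.zero_apply, zero_add, tupleBoundary_single, tupleCoboundary, map_sum, map_sum]
  exact Finset.sum_congr rfl fun i _ => by rw [map_smul, map_smul]

/-- The chain map induced by a map of vertices. -/
def vertexMap (a : Y → Z) (n : ℕ) : TupleChain 𝕜 Y n →ₗ[𝕜] TupleChain 𝕜 Z n :=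
  Finsupp.lmapDomain 𝕜 𝕜 fun y i => a (y i)

@[simp]
lemma vertexMap_single (a : Y → Z) {n : ℕ} (y : Fin n → Y) (r : 𝕜) :
    vertexMap a n (Finsupp.single y r) = Finsupp.single (fun i => a (y i)) r := by
  simp [vertexMap]

lemma tupleBoundary_vertexMap (a : Y → Z) {n : ℕ} (x : TupleChain 𝕜 Y (n + 1)) :
    tupleBoundary n (vertexMap a (n + 1) x) = vertexMap a n (tupleBoundary n x) := by
  suffices h : tupleBoundary n ∘ₗ vertexMap a (n + 1) =
      vertexMap a n ∘ₗ tupleBoundary (𝕜 := 𝕜) n from LinearMap.congr_fun h x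
  refine Finsupp.lhom_ext' fun y => LinearMap.ext_ring ?_
  simp

end TupleChains

section Norms

variable {𝕜 Y Z V : Type*} [RCLike 𝕜] [NormedAddCommGroup V] [NormedSpace 𝕜 V]

/-- If `f` is equivariant, so is its value at chains. -/
lemma evalChain_chainAct {Γ : Type*} [Monoid Γ] [SMul Γ Y] (ρ : Γ →* (V →ₗᵢ[𝕜] V)) {n : ℕ}
    {f : (Fin n → Y) → V} (hf : ∀ (γ : Γ) (y : Fin n → Y), f (fun i => γ • y i) = ρ γ (f y))
    (γ : Γ) (x : TupleChain 𝕜 Y n) :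
    evalChain 𝕜 f (chainAct γ n x) = ρ γ (evalChain 𝕜 f x) := by
  suffices h : evalChain 𝕜 f ∘ₗ chainAct γ n = (ρ γ).toLinearMap ∘ₗ evalChain 𝕜 f from
    LinearMap.congr_fun h x
  refine Finsupp.lhom_ext' fun y => LinearMap.ext_ring ?_
  simp [hf]

/-- The number of tuples in the cone homotopy between two vertex maps, counted with
multiplicities. -/
def homotopyCount : ℕ → ℝ
  | 0 => 0
  | n + 1 => 2 + (n + 1) * homotopyCount n

lemma homotopyCount_nonneg (n : ℕ) : 0 ≤ homotopyCount n := by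
  induction n with
  | zero => simp [homotopyCount]
  | succ n ih => simp only [homotopyCount]; positivity

/-- The cone homotopy between two vertex maps only involves the images of the given vertices. -/
lemma norm_evalChain_coneHomotopy_le (a b : Y → Z) :
    ∀ (n : ℕ) (f : (Fin (n + 1) → Z) → V) (y : Fin n → Y) (B : ℝ),
      (∀ z, (∀ i, ∃ j, z i = a (y j) ∨ z i = b (y j)) → ‖f z‖ ≤ B) →
      ‖evalChain 𝕜 f (coneHomotopy a (fun n => vertexMap b n - vertexMap a n) n
        (Finsupp.single y 1))‖ ≤ homotopyCount n * B := by
  intro n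
  induction n with
  | zero => intro f y B _; simp [coneHomotopy, homotopyCount]
  | succ n ih =>
    intro f y B hB
    rw [coneHomotopy_succ_single, evalChain_cone, map_sub]
    have h1 : ∀ (c : Fin (n + 1) → Z), (∀ i, c i = a (y i) ∨ c i = b (y i)) →
        ‖f (Fin.cons (a (y 0)) c)‖ ≤ B := by
      intro c hc
      refine hB _ fun i => ?_
      refine Fin.cases ⟨0, Or.inl (by simp)⟩ (fun i => ⟨i, ?_⟩) i
      simpa using hc i
    have h2 : ‖evalChain 𝕜 (fun z => f (Fin.cons (a (y 0)) z))
        ((vertexMap b (n + 1) - vertexMap a (n + 1) : TupleChain 𝕜 Y (n + 1) →ₗ[𝕜] _)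
          (Finsupp.single y 1))‖ ≤ B + B := by
      rw [LinearMap.sub_apply, map_sub]
      refine (norm_sub_le _ _).trans (add_le_add ?_ ?_)
      · simpa using h1 (fun i => b (y i)) fun i => Or.inr rfl
      · simpa using h1 (fun i => a (y i)) fun i => Or.inl rfl
    have h3 : ‖evalChain 𝕜 (fun z => f (Fin.cons (a (y 0)) z))
        (coneHomotopy a (fun n => vertexMap b n - vertexMap a n) n
          (tupleBoundary n (Finsupp.single y 1)))‖ ≤ ∑ _i : Fin (n + 1), homotopyCount n * B := by
      rw [tupleBoundary_single, map_sum, map_sum]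
      refine norm_sum_le_of_le _ fun i _ => ?_
      rw [map_smul, map_smul, norm_smul]
      simp only [norm_pow, norm_neg, norm_one, one_pow, one_mul]
      refine ih _ _ _ fun z hz => hB _ fun l => ?_
      refine Fin.cases ⟨0, Or.inl (by simp)⟩ (fun l => ?_) l
      obtain ⟨j, hj⟩ := hz l
      exact ⟨i.succAbove j, by simpa using hj⟩
    refine (norm_sub_le _ _).trans ((add_le_add h2 h3).trans (le_of_eq ?_))
    simp only [homotopyCount, Finset.sum_const, Finset.card_univ, Fintype.card_fin, nsmul_eq_mul]
    push_cast
    ring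

end Norms

/-! ### Degrees of polynomial functions -/

section Degree

lemma powerFun_eq_ofReal {r : ℝ} (hr : 0 ≤ r) (n : ℕ) :
    powerFun r n = ENNReal.ofReal ((n : ℝ) ^ r) := by
  rw [powerFun, ← ENNReal.ofReal_rpow_of_nonneg (Nat.cast_nonneg n) hr, ENNReal.ofReal_natCast]

lemma AsympLE.exists_le {f : ℕ → ℝ≥0∞} {r : ℝ} (hr : 1 ≤ r) (hf : AsympLE f (powerFun r)) :
    ∃ K : ℝ, 0 ≤ K ∧ ∀ n : ℕ, 0 < n → f n ≤ ENNReal.ofReal (K * (n : ℝ) ^ r) := by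
  obtain ⟨C, hC, h⟩ := hf
  have hC' : (0 : ℝ) ≤ C := Nat.cast_nonneg C
  refine ⟨C * (2 * C) ^ r + 2 * C, by positivity, fun n hn => (h n hn).trans ?_⟩
  have hn1 : (1 : ℝ) ≤ n := by exact_mod_cast hn
  have h1 : (n : ℝ) ≤ (n : ℝ) ^ r := by
    simpa using Real.rpow_le_rpow_of_exponent_le hn1 hr
  have h2 : ((C * n + C : ℕ) : ℝ) ^ r ≤ (2 * C) ^ r * (n : ℝ) ^ r := by
    rw [← Real.mul_rpow (by positivity) (by positivity)]
    refine Real.rpow_le_rpow (by positivity) ?_ (by linarith)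
    push_cast
    nlinarith
  have e1 : (C : ℝ≥0∞) = ENNReal.ofReal C := by simp
  have e2 : (n : ℝ≥0∞) = ENNReal.ofReal n := by simp
  rw [powerFun_eq_ofReal (by linarith), e1, e2, ← ENNReal.ofReal_mul (by positivity),
    ← ENNReal.ofReal_mul (by positivity), ← ENNReal.ofReal_add (by positivity) (by positivity),
    ← ENNReal.ofReal_add (by positivity) (by positivity)]
  refine ENNReal.ofReal_le_ofReal ?_
  have h3 : (C : ℝ) * ((C * n + C : ℕ) : ℝ) ^ r ≤ C * ((2 * C) ^ r * (n : ℝ) ^ r) :=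
    mul_le_mul_of_nonneg_left h2 hC'
  nlinarith

lemma AsympLE.powerFun_mono {f : ℕ → ℝ≥0∞} {r s : ℝ} (hrs : r ≤ s)
    (hf : AsympLE f (powerFun r)) : AsympLE f (powerFun s) := by
  obtain ⟨C, hC, h⟩ := hf
  refine ⟨C, hC, fun n hn => (h n hn).trans ?_⟩
  have : powerFun r (C * n + C) ≤ powerFun s (C * n + C) :=
    ENNReal.rpow_le_rpow_of_exponent_le (by
      have : 1 ≤ C * n + C := by omega
      exact_mod_cast this) hrs
  gcongr

lemma AsympLE.exponent_le {f : ℕ → ℝ≥0∞} {r s : ℝ} (hr : 0 ≤ r) (hs : 1 ≤ s)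
    (h1 : AsympLE (powerFun r) f) (h2 : AsympLE f (powerFun s)) : r ≤ s := by
  obtain ⟨K, hK, hf⟩ := h2.exists_le hs
  obtain ⟨C, hC, h⟩ := h1
  have hC' : (0 : ℝ) ≤ C := Nat.cast_nonneg C
  by_contra! hlt
  have key : ∀ n : ℕ, 0 < n → (n : ℝ) ^ (r - s) ≤ C * (K * (2 * C) ^ s) + 2 * C := by
    intro n hn
    have hn1 : (1 : ℝ) ≤ n := by exact_mod_cast hn
    have h0 := (h n hn).trans (add_le_add (add_le_add
      (mul_le_mul' le_rfl (hf (C * n + C) (by omega))) le_rfl) le_rfl)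
    have e1 : (C : ℝ≥0∞) = ENNReal.ofReal C := by simp
    have e2 : (n : ℝ≥0∞) = ENNReal.ofReal n := by simp
    rw [powerFun_eq_ofReal hr, e1, e2, ← ENNReal.ofReal_mul (by positivity),
      ← ENNReal.ofReal_mul (by positivity), ← ENNReal.ofReal_add (by positivity) (by positivity),
      ← ENNReal.ofReal_add (by positivity) (by positivity),
      ENNReal.ofReal_le_ofReal_iff (by positivity)] at h0
    have h1 : (n : ℝ) ≤ (n : ℝ) ^ s := by
      simpa using Real.rpow_le_rpow_of_exponent_le hn1 hs
    have h2 : ((C * n + C : ℕ) : ℝ) ^ s ≤ (2 * C) ^ s * (n : ℝ) ^ s := by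
      rw [← Real.mul_rpow (by positivity) (by positivity)]
      refine Real.rpow_le_rpow (by positivity) ?_ (by linarith)
      push_cast
      nlinarith
    have h3 : (C : ℝ) * (K * ((C * n + C : ℕ) : ℝ) ^ s) ≤ C * (K * ((2 * C) ^ s * (n : ℝ) ^ s)) := by
      gcongr
    rw [Real.rpow_sub (by linarith), div_le_iff₀ (by positivity)]
    nlinarith
  have ht := (tendsto_rpow_atTop (sub_pos.mpr hlt)).comp (tendsto_natCast_atTop_atTop (R := ℝ))
  have := (ht.eventually_gt_atTop (C * (K * (2 * C) ^ s) + 2 * C)).and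
    (Filter.eventually_gt_atTop 0)
  obtain ⟨n, hn, hn0⟩ := this.exists
  exact absurd (key n hn0) (not_le.mpr hn)

/-- The infimum in the definition of the degree of a polynomial function is attained. -/
lemma IsPolynomial.exists_le_degree {f : ℕ → ℝ≥0∞} (hf : IsPolynomial f) :
    1 ≤ degree f ∧
      ∃ K : ℝ, 0 ≤ K ∧ ∀ n : ℕ, 0 < n → f n ≤ ENNReal.ofReal (K * (n : ℝ) ^ degree f) := by
  obtain ⟨r, hr, h1, h2⟩ := hf
  have hd : degree f = max 1 r := by
    refine IsLeast.csInf_eq ⟨⟨le_max_left _ _, h1.powerFun_mono (le_max_right _ _)⟩, ?_⟩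
    rintro s ⟨hs1, hs⟩
    exact max_le hs1 (h2.exponent_le hr.le hs1 hs)
  rw [hd]
  exact ⟨le_max_left _ _, (h1.powerFun_mono (le_max_right _ _)).exists_le (le_max_left _ _)⟩

end Degree

/-! ### Word lengths -/

section WordLength

variable {Γ : Type*} [Group Γ] {S : Set Γ}

lemma exists_word (hS : Subgroup.closure S = ⊤) (γ : Γ) :
    ∃ l : List Γ, l.length = wordLength S γ ∧ (∀ s ∈ l, s ∈ S ∨ s⁻¹ ∈ S) ∧ l.prod = γ := by
  have hγ : γ ∈ (Subgroup.closure S).toSubmonoid := by rw [hS]; trivial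
  rw [Subgroup.closure_toSubmonoid] at hγ
  obtain ⟨l, hl, hp⟩ := Submonoid.exists_list_of_mem_closure hγ
  exact Nat.sInf_mem (s := {n | ∃ l : List Γ, l.length = n ∧ (∀ s ∈ l, s ∈ S ∨ s⁻¹ ∈ S) ∧
    l.prod = γ}) ⟨_, l, rfl, hl, hp⟩

lemma wordLength_le {l : List Γ} (hl : ∀ s ∈ l, s ∈ S ∨ s⁻¹ ∈ S) :
    wordLength S l.prod ≤ l.length :=
  Nat.sInf_le ⟨l, rfl, hl, rfl⟩

lemma wordLength_mul_le (hS : Subgroup.closure S = ⊤) (a b : Γ) :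
    wordLength S (a * b) ≤ wordLength S a + wordLength S b := by
  obtain ⟨l, hl, hlS, rfl⟩ := exists_word hS a
  obtain ⟨l', hl', hlS', rfl⟩ := exists_word hS b
  rw [← hl, ← hl', ← List.length_append, ← List.prod_append]
  refine wordLength_le fun s hs => ?_
  rcases List.mem_append.mp hs with h | h
  · exact hlS s h
  · exact hlS' s h

lemma wordLength_inv_le (hS : Subgroup.closure S = ⊤) (a : Γ) :
    wordLength S a⁻¹ ≤ wordLength S a := by
  obtain ⟨l, hl, hlS, rfl⟩ := exists_word hS a
  rw [← hl, List.prod_inv_reverse]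
  refine (wordLength_le ?_).trans (by simp)
  intro s hs
  simp only [List.mem_reverse, List.mem_map] at hs
  obtain ⟨t, ht, rfl⟩ := hs
  simpa [or_comm] using hlS t ht

end WordLength

/-! ### Fillings of integral cycles -/

section Fillings

variable {W : Type*}

/-- The unnormalized `ℓ¹`-norm of a chain, a natural number. -/
def absSum {m : ℕ} (c : (Fin m → W) →₀ ℤ) : ℕ := ∑ v ∈ c.support, (c v).natAbs

lemma l1Norm_eq_absSum {m : ℕ} (c : (Fin m → W) →₀ ℤ) :
    l1Norm c = (absSum c : ℝ≥0∞) / (m ! : ℝ≥0∞) := by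
  simp [l1Norm, absSum]

lemma absSum_eq_of_subset {m : ℕ} {c : (Fin m → W) →₀ ℤ} {s : Finset (Fin m → W)}
    (h : c.support ⊆ s) : absSum c = ∑ v ∈ s, (c v).natAbs :=
  Finset.sum_subset h fun v _ hv => by simpa using hv

@[simp]
lemma absSum_zero {m : ℕ} : absSum (0 : (Fin m → W) →₀ ℤ) = 0 := by simp [absSum]

@[simp]
lemma absSum_neg {m : ℕ} (c : (Fin m → W) →₀ ℤ) : absSum (-c) = absSum c := by
  simp [absSum]

@[simp]
lemma absSum_single {m : ℕ} (v : Fin m → W) (z : ℤ) : absSum (Finsupp.single v z) = z.natAbs := by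
  rw [absSum_eq_of_subset (s := {v}) Finsupp.support_single_subset]
  simp

lemma absSum_add_le {m : ℕ} (b c : (Fin m → W) →₀ ℤ) : absSum (b + c) ≤ absSum b + absSum c := by
  classical
  rw [absSum_eq_of_subset (Finsupp.support_add (g₁ := b) (g₂ := c)),
    absSum_eq_of_subset (Finset.subset_union_left (s₁ := b.support) (s₂ := c.support)),
    absSum_eq_of_subset (Finset.subset_union_right (s₁ := b.support) (s₂ := c.support)),
    ← Finset.sum_add_distrib]
  exact Finset.sum_le_sum fun v _ => Int.natAbs_add_le _ _

lemma absSum_sum_le {m : ℕ} {ι : Type*} (s : Finset ι) (c : ι → (Fin m → W) →₀ ℤ) :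
    absSum (∑ i ∈ s, c i) ≤ ∑ i ∈ s, absSum (c i) :=
  Finset.le_sum_of_subadditive absSum absSum_zero.le absSum_add_le s c

/-- The diagonal action on integral chains. -/
def translateChain {Γ : Type*} [Group Γ] [MulAction Γ W] (γ : Γ) {m : ℕ}
    (c : (Fin m → W) →₀ ℤ) : (Fin m → W) →₀ ℤ :=
  c.mapDomain fun v i => γ • v i

section Action

variable {Γ : Type*} [Group Γ] [MulAction Γ W]

lemma translateChain_apply (γ : Γ) {m : ℕ} (c : (Fin m → W) →₀ ℤ) (v : Fin m → W) :
    translateChain γ c v = c fun i => γ⁻¹ • v i := by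
  have hinj : Function.Injective fun (v : Fin m → W) i => γ • v i := by
    intro v w h
    funext i
    exact smul_left_cancel γ (congrFun h i)
  have : v = fun i => γ • (fun i => γ⁻¹ • v i) i := by simp
  conv_lhs => rw [this]
  exact Finsupp.mapDomain_apply hinj c _

lemma translateChain_mul (γ γ' : Γ) {m : ℕ} (c : (Fin m → W) →₀ ℤ) :
    translateChain (γ * γ') c = translateChain γ (translateChain γ' c) := by
  ext v
  simp [translateChain_apply, mul_smul]

@[simp]
lemma translateChain_one {m : ℕ} (c : (Fin m → W) →₀ ℤ) : translateChain (1 : Γ) c = c := by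
  ext v
  simp [translateChain_apply]

lemma translateChain_sum (γ : Γ) {m : ℕ} {ι : Type*} (s : Finset ι) (c : ι → (Fin m → W) →₀ ℤ) :
    translateChain γ (∑ i ∈ s, c i) = ∑ i ∈ s, translateChain γ (c i) :=
  Finsupp.mapDomain_finsetSum

lemma translateChain_smul (γ : Γ) {m : ℕ} (z : ℤ) (c : (Fin m → W) →₀ ℤ) :
    translateChain γ (z • c) = z • translateChain γ c :=
  Finsupp.mapDomain_smul z c

lemma absSum_translateChain_le (γ : Γ) {m : ℕ} (c : (Fin m → W) →₀ ℤ) :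
    absSum (translateChain γ c) ≤ absSum c := by
  have h : translateChain γ c = ∑ v ∈ c.support, Finsupp.single (fun i => γ • v i) (c v) := rfl
  rw [h]
  refine (absSum_sum_le _ _).trans (le_of_eq ?_)
  simp_rw [absSum_single]
  rfl

lemma boundary_translateChain (γ : Γ) {m : ℕ} (c : (Fin (m + 1) → W) →₀ ℤ) :
    boundary (translateChain γ c) = translateChain γ (boundary c) := by
  rw [boundary, translateChain, translateChain, boundary, ← Finsupp.mapDomain_comp,
    ← Finsupp.mapDomain_comp]
  rfl

lemma translateChain_mem_chains {X : AbstractSimplicialComplex W}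
    (hX : ∀ (γ : Γ), ∀ s ∈ X.faces, translate γ s ∈ X.faces) (γ : Γ) {m : ℕ}
    {c : (Fin m → W) →₀ ℤ} (hc : c ∈ chains X m) : translateChain γ c ∈ chains X m := by
  refine ⟨fun v hv => ?_, fun σ v => ?_⟩
  · rw [translateChain_apply] at hv
    obtain ⟨hinj, s, hs, hsv⟩ := hc.1 _ hv
    refine ⟨fun i j hij => hinj (by simp [hij]), translate γ s, hX γ s hs, ?_⟩
    ext w
    simp only [translate, Finset.coe_map, hsv, Set.mem_image, Set.mem_range]
    constructor
    · rintro ⟨_, ⟨i, rfl⟩, rfl⟩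
      exact ⟨i, by simp⟩
    · rintro ⟨i, rfl⟩
      exact ⟨_, ⟨i, rfl⟩, by simp⟩
  · rw [translateChain_apply, translateChain_apply]
    exact hc.2 σ fun i => γ⁻¹ • v i

end Action

lemma boundary_sum {m : ℕ} {ι : Type*} (s : Finset ι) (c : ι → (Fin (m + 1) → W) →₀ ℤ) :
    boundary (∑ i ∈ s, c i) = ∑ i ∈ s, boundary (c i) :=
  Finsupp.mapDomain_finsetSum

lemma boundary_smul {m : ℕ} (z : ℤ) (c : (Fin (m + 1) → W) →₀ ℤ) :
    boundary (z • c) = z • boundary c :=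
  Finsupp.mapDomain_smul z c

lemma boundary_add {m : ℕ} (b c : (Fin (m + 1) → W) →₀ ℤ) :
    boundary (b + c) = boundary b + boundary c :=
  Finsupp.mapDomain_add

lemma boundary_single {m : ℕ} (v : Fin (m + 1) → W) (z : ℤ) :
    boundary (Finsupp.single v z) = Finsupp.single (Fin.tail v) z :=
  Finsupp.mapDomain_single

/-- The chain `c` bounds in `X`. -/
def IsFillable (X : AbstractSimplicialComplex W) {m : ℕ} (c : (Fin m → W) →₀ ℤ) : Prop :=
  ∃ b ∈ chains X (m + 1), boundary b = c

open Classical in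
/-- A filling of `c` of least norm (zero if there is none). -/
def minFilling (X : AbstractSimplicialComplex W) {m : ℕ} (c : (Fin m → W) →₀ ℤ) :
    (Fin (m + 1) → W) →₀ ℤ :=
  if h : IsFillable X c then
    Function.argminOn absSum {b | b ∈ chains X (m + 1) ∧ boundary b = c} h
  else 0

lemma minFilling_mem_chains (X : AbstractSimplicialComplex W) {m : ℕ} (c : (Fin m → W) →₀ ℤ) :
    minFilling X c ∈ chains X (m + 1) := by
  unfold minFilling
  split_ifs with h
  · exact (Function.argminOn_mem absSum {b | b ∈ chains X (m + 1) ∧ boundary b = c} h).1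
  · exact zero_mem _

lemma IsFillable.boundary_minFilling {X : AbstractSimplicialComplex W} {m : ℕ}
    {c : (Fin m → W) →₀ ℤ} (h : IsFillable X c) : boundary (minFilling X c) = c := by
  rw [minFilling, dif_pos h]
  exact (Function.argminOn_mem absSum {b | b ∈ chains X (m + 1) ∧ boundary b = c} h).2

lemma absSum_minFilling_le {X : AbstractSimplicialComplex W} {m : ℕ} {c : (Fin m → W) →₀ ℤ}
    {b : (Fin (m + 1) → W) →₀ ℤ} (hb : b ∈ chains X (m + 1)) (hbc : boundary b = c) :
    absSum (minFilling X c) ≤ absSum b := by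
  have h : IsFillable X c := ⟨b, hb, hbc⟩
  rw [minFilling, dif_pos h]
  exact Function.argminOn_le absSum {b | b ∈ chains X (m + 1) ∧ boundary b = c} ⟨hb, hbc⟩

/-- A finite value of the filling function yields fillings of controlled norm. -/
lemma exists_filling_of_fillingFunction_le {X : AbstractSimplicialComplex W} {j t : ℕ} {B : ℝ}
    (hB : 0 ≤ B) (hF : fillingFunction X (j + 1) t ≤ ENNReal.ofReal B)
    {c : (Fin (j + 1) → W) →₀ ℤ} (hc : c ∈ chains X (j + 1)) (hc0 : boundary c = 0)
    (ht : absSum c ≤ t) :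
    ∃ b ∈ chains X (j + 2), boundary b = c ∧ (absSum b : ℝ) ≤ (j + 2)! * (B + 1) := by
  have h1 : l1Norm c ≤ t := by
    rw [l1Norm_eq_absSum]
    refine ENNReal.div_le_of_le_mul ?_
    have : absSum c ≤ t * (j + 1)! := ht.trans (Nat.le_mul_of_pos_right _ (Nat.factorial_pos _))
    exact_mod_cast this
  have h2 : fillingVolume X c ≤ ENNReal.ofReal B := by
    refine le_trans ?_ hF
    exact le_iSup₂ (f := fun (c : (Fin (j + 1) → W) →₀ ℤ)
      (_ : c ∈ {c | c ∈ chains X (j + 1) ∧ boundary c = 0 ∧ l1Norm c ≤ t}) => fillingVolume X c)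
      c ⟨hc, hc0, h1⟩
  have h3 : fillingVolume X c < ENNReal.ofReal (B + 1) :=
    h2.trans_lt (by rw [ENNReal.ofReal_lt_ofReal_iff (by linarith)]; linarith)
  rw [fillingVolume, iInf_lt_iff] at h3
  obtain ⟨b, hb⟩ := h3
  rw [iInf_lt_iff] at hb
  obtain ⟨⟨hb1, hb2⟩, hb3⟩ := hb
  refine ⟨b, hb1, hb2, ?_⟩
  rw [l1Norm_eq_absSum, ENNReal.div_lt_iff (by simp [Nat.factorial_ne_zero]) (by simp)] at hb3
  have e1 : ((absSum b : ℕ) : ℝ≥0∞) = ENNReal.ofReal (absSum b) := by simp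
  have e2 : (((j + 1 + 1)! : ℕ) : ℝ≥0∞) = ENNReal.ofReal ((j + 1 + 1)! : ℕ) := by simp
  rw [e1, e2, ← ENNReal.ofReal_mul (by positivity), ENNReal.ofReal_lt_ofReal_iff_of_nonneg
    (by positivity)] at hb3
  rw [mul_comm]
  exact hb3.le

end Fillings

/-! ### Paths in a connected complex -/

section Paths

variable {W : Type*} {X : AbstractSimplicialComplex W}

/-- The `1`-chain of the oriented edge from `v` to `w`. -/
def edgeChain (v w : W) : (Fin 2 → W) →₀ ℤ :=
  Finsupp.single ![v, w] 1 - Finsupp.single ![w, v] 1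

lemma edgeChain_mem_chains {v w : W} (hvw : v ≠ w) {s : Finset W} (hs : s ∈ X.faces) (hv : v ∈ s)
    (hw : w ∈ s) : edgeChain v w ∈ chains X 2 := by
  classical
  have hne : ![v, w] ≠ ![w, v] := fun h => hvw (by simpa using congrFun h 0)
  have hface : ({v, w} : Finset W) ∈ X.faces := by
    refine X.isRelLowerSet_faces.mem_of_le hs ?_ (by simp)
    intro x hx
    rcases Finset.mem_insert.mp hx with rfl | hx
    · exact hv
    · rw [Finset.mem_singleton.mp hx]; exact hw
  refine ⟨fun u hu => ?_, fun σ u => ?_⟩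
  · have hu' : u = ![v, w] ∨ u = ![w, v] := by
      by_contra! h
      exact hu (by simp [edgeChain, h.1.symm, h.2.symm])
    rcases hu' with rfl | rfl
    · refine ⟨?_, {v, w}, hface, by simp [Matrix.range_cons, Set.pair_comm]⟩
      intro i j
      fin_cases i <;> fin_cases j <;> simp [hvw, hvw.symm]
    · refine ⟨?_, {v, w}, hface, by simp [Matrix.range_cons, Set.pair_comm]⟩
      intro i j
      fin_cases i <;> fin_cases j <;> simp [hvw, hvw.symm]
  · have hσ : ∀ σ : Equiv.Perm (Fin 2), σ = 1 ∨ σ = Equiv.swap 0 1 := by decide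
    rcases hσ σ with rfl | rfl
    · simp
    · have h1 : ∀ a b : W, ![a, b] = u ∘ (Equiv.swap 0 1 : Equiv.Perm (Fin 2)) ↔ ![b, a] = u := by
        intro a b
        constructor
        · intro h
          funext i
          fin_cases i
          · simpa using congrFun h 1
          · simpa using congrFun h 0
        · rintro rfl
          funext i
          fin_cases i <;> simp
      simp [edgeChain, Finsupp.single_apply, h1]

lemma boundary_edgeChain (v w : W) :
    boundary (edgeChain v w) = Finsupp.single (fun _ => w) 1 - Finsupp.single (fun _ => v) 1 := by
  have h : ∀ a b : W, Fin.tail ![a, b] = fun _ : Fin 1 => b := by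
    intro a b
    funext i
    fin_cases i
    rfl
  rw [edgeChain, sub_eq_add_neg, ← Finsupp.single_neg, boundary_add, boundary_single,
    boundary_single, h, h, Finsupp.single_neg, sub_eq_add_neg]

variable (X) in
/-- The vertices `v` and `w` are joined by a `1`-chain. -/
def Joined₁ (v w : W) : Prop :=
  IsFillable X (Finsupp.single (fun _ : Fin 1 => w) (1 : ℤ) - Finsupp.single (fun _ => v) 1)

lemma Joined₁.trans {u v w : W} (h : Joined₁ X u v) (h' : Joined₁ X v w) : Joined₁ X u w := by
  obtain ⟨b, hb, hb'⟩ := h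
  obtain ⟨c, hc, hc'⟩ := h'
  exact ⟨b + c, add_mem hb hc, by rw [boundary_add, hb', hc']; abel⟩

lemma joined₁_of_mem_face {s : Finset W} (hs : s ∈ X.faces) {v w : W} (hv : v ∈ s) (hw : w ∈ s) :
    Joined₁ X v w := by
  rcases eq_or_ne v w with rfl | h
  · exact ⟨0, zero_mem _, by simp [boundary]⟩
  · exact ⟨_, edgeChain_mem_chains h hs hv hw, boundary_edgeChain v w⟩

/-- In a connected realization any two vertices are joined by a `1`-chain: the union of the closed
simplices whose vertices can be reached from a given vertex is open and closed. -/
lemma joined₁_of_connectedSpace [ConnectedSpace (Realization X)] (v w : W) : Joined₁ X v w := by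
  classical
  -- The points all of whose carrying vertices are joined to `v`. A closed simplex lies in `U` or is
  -- disjoint from it, so that `U` is clopen in the weak topology.
  let U : Set (Realization X) := {x | ∀ u, x.1 u ≠ 0 → Joined₁ X v u}
  have hpre : ∀ s : X.faces, Realization.incl X s ⁻¹' U = Set.univ ∨
      Realization.incl X s ⁻¹' U = ∅ := by
    intro s
    have hval : ∀ (t : stdSimplex ℝ s.1) (u : s.1),
        (Realization.incl X s t).1 u = t.1 u := fun t u =>
      Subtype.val_injective.extend_apply _ _ _
    have hval' : ∀ (t : stdSimplex ℝ s.1) (u : W), (Realization.incl X s t).1 u ≠ 0 → u ∈ s.1 := by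
      intro t u hu
      by_contra hus
      refine hu (Function.extend_apply' _ _ _ ?_)
      rintro ⟨a, rfl⟩
      exact hus a.2
    by_cases h : ∃ u ∈ s.1, Joined₁ X v u
    · obtain ⟨u, hus, hu⟩ := h
      left
      refine Set.eq_univ_of_forall fun t u' hu' => ?_
      exact hu.trans (joined₁_of_mem_face s.2 hus (hval' t u' hu'))
    · right
      refine Set.eq_empty_of_forall_notMem fun t ht => h ?_
      have hsum : ∑ u, t.1 u ≠ 0 := by rw [t.2.2]; exact one_ne_zero
      obtain ⟨u, -, hu⟩ := Finset.exists_ne_zero_of_sum_ne_zero hsum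
      exact ⟨u, u.2, ht u (by rwa [hval])⟩
  have hclopen : IsClopen U := by
    constructor
    · rw [← isOpen_compl_iff, isOpen_iSup_iff]
      intro s
      rw [isOpen_coinduced, Set.preimage_compl]
      rcases hpre s with h | h <;> simp [h]
    · rw [isOpen_iSup_iff]
      intro s
      rw [isOpen_coinduced]
      rcases hpre s with h | h <;> simp [h]
  have hpt : ∀ u : W, ∃ x : Realization X, x.1 u ≠ 0 ∧ ∀ u', x.1 u' ≠ 0 → u' = u := by
    intro u
    let t : stdSimplex ℝ ({u} : Finset W) := ⟨_, single_mem_stdSimplex ℝ ⟨u, by simp⟩⟩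
    refine ⟨Realization.incl X ⟨{u}, X.singleton_mem u⟩ t, ?_, fun u' hu' => ?_⟩
    · have : (Realization.incl X ⟨{u}, X.singleton_mem u⟩ t).1 u = t.1 ⟨u, by simp⟩ :=
        Subtype.val_injective.extend_apply (f := (Subtype.val : ({u} : Finset W) → W)) _ _
          ⟨u, by simp⟩
      rw [this]
      simp [t]
    · by_contra hne
      refine hu' (Function.extend_apply' _ _ _ ?_)
      rintro ⟨a, rfl⟩
      exact hne (Finset.mem_singleton.mp a.2)
  obtain ⟨x, hx, hx'⟩ := hpt v
  obtain ⟨y, hy, hy'⟩ := hpt w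
  have hxU : x ∈ U := fun u hu => by
    rw [hx' u hu]
    exact joined₁_of_mem_face (X.singleton_mem v) (by simp) (by simp)
  have huniv : U = Set.univ := hclopen.eq_univ ⟨x, hxU⟩
  have hyU : y ∈ U := by rw [huniv]; trivial
  exact hyU w hy

end Paths

/-! ### From alternating chains of the complex to ordered chains of the group -/

section Spread

variable {𝕜 Γ W : Type*} [RCLike 𝕜]

/-- The product of the uniform probability measures on the finite sets `F (v i)`, as an ordered
chain. -/
def spread (𝕜 : Type*) [RCLike 𝕜] (F : W → Finset Γ) : ∀ n, (Fin n → W) → TupleChain 𝕜 Γ n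
  | 0, _ => Finsupp.single (fun i => i.elim0) 1
  | n + 1, v => ∑ γ ∈ F (v 0), ((F (v 0)).card : 𝕜)⁻¹ • cone γ (spread 𝕜 F n (Fin.tail v))

lemma tupleBoundary_spread {F : W → Finset Γ} (hF : ∀ w, (F w).Nonempty) :
    ∀ n (v : Fin (n + 1) → W), tupleBoundary n (spread 𝕜 F (n + 1) v) =
      tupleCoboundary 𝕜 (spread 𝕜 F n) v := by
  have hcard : ∀ w, ((F w).card : 𝕜) ≠ 0 := fun w => by
    exact_mod_cast (hF w).card_pos.ne'
  intro n
  induction n with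
  | zero =>
    intro v
    have h : ∀ γ, tupleBoundary 0 (cone γ (spread 𝕜 F 0 (Fin.tail v))) =
        spread 𝕜 F 0 (Fin.tail v) := fun γ => tupleBoundary_cone_zero γ _
    simp only [spread, map_sum, map_smul] at h ⊢
    simp only [h, tupleCoboundary, Finset.sum_const, ← Nat.cast_smul_eq_nsmul 𝕜, smul_smul,
      mul_inv_cancel₀ (hcard _)]
    simp
  | succ n ih =>
    intro v
    rw [spread, map_sum, tupleCoboundary, Fin.sum_univ_succ]
    simp only [map_smul, tupleBoundary_cone, smul_sub, Finset.sum_sub_distrib, Finset.sum_const,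
      ← Nat.cast_smul_eq_nsmul 𝕜, smul_smul, mul_inv_cancel₀ (hcard _), ih, one_smul]
    rw [sub_eq_add_neg]
    congr 1
    · simp
      rfl
    · simp only [tupleCoboundary, map_sum, map_smul, Finset.smul_sum]
      rw [Finset.sum_comm, ← Finset.sum_neg_distrib]
      refine Finset.sum_congr rfl fun i _ => ?_
      have h0 : v (i.succ.succAbove 0) = v 0 := by simp
      have ht : (Fin.tail fun j => v (i.succ.succAbove j)) = fun j => Fin.tail v (i.succAbove j) := by
        funext j
        simp [Fin.tail]
      rw [spread, h0, ht, Finset.smul_sum, ← Finset.sum_neg_distrib]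
      refine Finset.sum_congr rfl fun γ _ => ?_
      rw [smul_comm, Fin.val_succ, pow_succ, mul_neg_one, neg_smul]

/-- The linear extension of `spread`. -/
def spreadChain (𝕜 : Type*) [RCLike 𝕜] (F : W → Finset Γ) (n : ℕ) :
    TupleChain 𝕜 W n →ₗ[𝕜] TupleChain 𝕜 Γ n :=
  Finsupp.linearCombination 𝕜 (spread 𝕜 F n)

lemma tupleBoundary_spreadChain {F : W → Finset Γ} (hF : ∀ w, (F w).Nonempty) {n : ℕ}
    (x : TupleChain 𝕜 W (n + 1)) :
    tupleBoundary n (spreadChain 𝕜 F (n + 1) x) = spreadChain 𝕜 F n (tupleBoundary n x) := by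
  suffices h : tupleBoundary n ∘ₗ spreadChain 𝕜 F (n + 1) = spreadChain 𝕜 F n ∘ₗ tupleBoundary n
    from LinearMap.congr_fun h x
  refine Finsupp.lhom_ext' fun y => LinearMap.ext_ring ?_
  simp only [LinearMap.comp_apply, Finsupp.lsingle_apply, tupleBoundary_single, map_sum]
  rw [show spreadChain 𝕜 F (n + 1) (Finsupp.single y 1) = spread 𝕜 F (n + 1) y by
    simp [spreadChain], tupleBoundary_spread hF, tupleCoboundary]
  refine Finset.sum_congr rfl fun i _ => ?_
  rw [map_smul]
  simp [spreadChain]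

lemma chainAct_spread [Group Γ] [MulAction Γ W] {F : W → Finset Γ}
    (hF : ∀ (γ : Γ) w, F (γ • w) = (F w).map (Equiv.mulLeft γ).toEmbedding) (γ : Γ) :
    ∀ n (v : Fin n → W), chainAct γ n (spread 𝕜 F n v) = spread 𝕜 F n fun i => γ • v i := by
  intro n
  induction n with
  | zero =>
    intro v
    simp only [spread, chainAct_single]
    congr 1
    funext i
    exact i.elim0
  | succ n ih =>
    intro v
    simp only [spread, map_sum, map_smul, chainAct_cone, ih, hF, Finset.sum_map, Finset.card_map]
    rfl

end Spread

section Alternating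

variable {𝕜 W : Type*} [RCLike 𝕜]

/-- An integral alternating chain as an ordered chain. Every oriented simplex with `m` vertices
appears as `m!` tuples, so one divides by `m!`. -/
def orderedChain (𝕜 : Type*) [RCLike 𝕜] {m : ℕ} (c : (Fin m → W) →₀ ℤ) : TupleChain 𝕜 W m :=
  (m ! : 𝕜)⁻¹ • Finsupp.mapRange.addMonoidHom (Int.castAddHom 𝕜) c

lemma orderedChain_eq_sum {m : ℕ} (c : (Fin m → W) →₀ ℤ) :
    orderedChain 𝕜 c = (m ! : 𝕜)⁻¹ • ∑ v ∈ c.support, (c v : 𝕜) • Finsupp.single v (1 : 𝕜) := by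
  rw [orderedChain]
  congr 1
  conv_lhs => rw [← c.sum_single, Finsupp.sum, map_sum]
  simp

/-- The ordered boundary of an alternating chain is its simplicial boundary: by alternation, all
`m + 1` faces contribute alike. -/
lemma tupleBoundary_orderedChain {m : ℕ} {c : (Fin (m + 1) → W) →₀ ℤ}
    (hc : ∀ (σ : Equiv.Perm (Fin (m + 1))) (v : Fin (m + 1) → W),
      c (v ∘ σ) = (Equiv.Perm.sign σ : ℤ) * c v) :
    tupleBoundary m (orderedChain 𝕜 c) = orderedChain 𝕜 (boundary c) := by
  classical
  have hface : ∀ i : Fin (m + 1), ∑ v ∈ c.support, (c v : 𝕜) • (-1 : 𝕜) ^ (i : ℕ) •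
      Finsupp.single (fun j => v (i.succAbove j)) (1 : 𝕜) =
      ∑ v ∈ c.support, (c v : 𝕜) • Finsupp.single (Fin.tail v) (1 : 𝕜) := by
    intro i
    let σ : Equiv.Perm (Fin (m + 1)) := i.cycleRange
    have hσ : (Equiv.Perm.sign σ : ℤ) = (-1) ^ (i : ℕ) := by
      simp [σ, Fin.sign_cycleRange]
    have hsq : ((-1 : ℤ) ^ (i : ℕ)) * (-1) ^ (i : ℕ) = 1 := by
      rw [← mul_pow]; simp
    have hinv : (Equiv.Perm.sign σ.symm : ℤ) = (-1) ^ (i : ℕ) := by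
      rw [Equiv.Perm.sign_symm, hσ]
    refine Finset.sum_bij' (fun v _ => v ∘ σ.symm) (fun v _ => v ∘ σ) ?_ ?_ ?_ ?_ ?_
    · intro v hv
      rw [Finsupp.mem_support_iff] at hv ⊢
      rw [hc, hinv]
      exact mul_ne_zero (by simp) hv
    · intro v hv
      rw [Finsupp.mem_support_iff] at hv ⊢
      rw [hc, hσ]
      exact mul_ne_zero (by simp) hv
    · intro v _
      funext j
      simp
    · intro v _
      funext j
      simp
    · intro v _
      have h1 : Fin.tail (v ∘ σ.symm) = fun j => v (i.succAbove j) := by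
        funext j
        simp only [Fin.tail, Function.comp_apply]
        congr 1
        exact Fin.cycleRange_symm_succ i j
      rw [h1, hc, hinv, smul_smul]
      push_cast
      rw [mul_comm]
  have hb : orderedChain 𝕜 (boundary c) =
      (m ! : 𝕜)⁻¹ • ∑ v ∈ c.support, (c v : 𝕜) • Finsupp.single (Fin.tail v) (1 : 𝕜) := by
    rw [orderedChain]
    congr 1
    have : boundary c = ∑ v ∈ c.support, Finsupp.single (Fin.tail v) (c v) := rfl
    rw [this, map_sum]
    simp
  have hm : ((m + 1 : ℕ) : 𝕜) ≠ 0 := Nat.cast_ne_zero.mpr (Nat.succ_ne_zero m)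
  rw [hb, orderedChain_eq_sum]
  simp only [map_smul, map_sum, tupleBoundary_single, Finset.smul_sum]
  rw [Finset.sum_comm]
  simp only [← Finset.smul_sum, hface, Finset.sum_const, Finset.card_univ, Fintype.card_fin]
  rw [← Nat.cast_smul_eq_nsmul 𝕜, smul_smul, Nat.factorial_succ, Nat.cast_mul,
    mul_inv, mul_comm, ← mul_assoc, mul_inv_cancel₀ hm, one_mul]

end Alternating

section Stabilizers

variable {Γ W : Type*} [Group Γ] [MulAction Γ W]

/-- The elements of `Γ` that carry the chosen representative of the orbit of `w` to `w`. -/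
def orbitFiber (w : W) : Set Γ :=
  {γ | γ • (Quotient.mk (MulAction.orbitRel Γ W) w).out = w}

lemma orbitFiber_nonempty (w : W) : (orbitFiber (Γ := Γ) w).Nonempty := by
  have h : (MulAction.orbitRel Γ W) w (Quotient.mk (MulAction.orbitRel Γ W) w).out :=
    (MulAction.orbitRel Γ W).symm (Quotient.exact (Quotient.out_eq _))
  exact MulAction.orbitRel_apply.mp h

lemma mem_orbitFiber_smul {γ γ' : Γ} {w : W} :
    γ' ∈ orbitFiber (γ • w) ↔ γ⁻¹ * γ' ∈ orbitFiber w := by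
  have h : Quotient.mk (MulAction.orbitRel Γ W) (γ • w) = Quotient.mk (MulAction.orbitRel Γ W) w :=
    Quotient.sound (MulAction.orbitRel_apply.mpr ⟨γ, rfl⟩)
  simp only [orbitFiber, Set.mem_ofPred_eq, h, mul_smul, inv_smul_eq_iff]

lemma finite_orbitFiber {X : AbstractSimplicialComplex W}
    (hX : ∀ s ∈ X.faces, {γ : Γ | translate γ s = s}.Finite) (w : W) :
    (orbitFiber (Γ := Γ) w).Finite := by
  obtain ⟨γ₀, h₀⟩ := orbitFiber_nonempty (Γ := Γ) w
  refine ((hX {w} (X.singleton_mem w)).image fun γ => γ * γ₀).subset fun γ hγ => ?_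
  refine ⟨γ * γ₀⁻¹, ?_, by simp⟩
  have h1 : (γ * γ₀⁻¹) • w = w := by
    rw [mul_smul]
    nth_rewrite 1 [← (show γ₀ • _ = w from h₀)]
    rw [inv_smul_smul]
    exact hγ
  simp [translate, h1]

end Stabilizers

/-! ### Equivariant fillings of simplices of the group -/

section SimplexFilling

variable {Γ W : Type*} [Group Γ] [MulAction Γ W] {X : AbstractSimplicialComplex W}

lemma IsFillable.add {m : ℕ} {b c : (Fin m → W) →₀ ℤ} (hb : IsFillable X b) (hc : IsFillable X c) :
    IsFillable X (b + c) := by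
  obtain ⟨x, hx, rfl⟩ := hb
  obtain ⟨y, hy, rfl⟩ := hc
  exact ⟨x + y, add_mem hx hy, boundary_add x y⟩

lemma IsFillable.smul {m : ℕ} {c : (Fin m → W) →₀ ℤ} (z : ℤ) (hc : IsFillable X c) :
    IsFillable X (z • c) := by
  obtain ⟨y, hy, rfl⟩ := hc
  exact ⟨z • y, zsmul_mem hy z, boundary_smul z y⟩

lemma isFillable_zero {m : ℕ} : IsFillable X (0 : (Fin m → W) →₀ ℤ) :=
  ⟨0, zero_mem _, by simp [boundary]⟩

/-- In a connected complex every `0`-cycle is fillable. -/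
lemma isFillable_of_boundary_eq_zero_one [ConnectedSpace (Realization X)]
    {c : (Fin 1 → W) →₀ ℤ} (hc : boundary c = 0) : IsFillable X c := by
  classical
  rcases c.support.eq_empty_or_nonempty with h | ⟨v₀, -⟩
  · rw [Finsupp.support_eq_empty.mp h]
    exact isFillable_zero
  have hsum : ∑ v ∈ c.support, c v = 0 := by
    have h1 : boundary c = Finsupp.single (fun i => i.elim0) (∑ v ∈ c.support, c v) := by
      rw [Finsupp.single_finsetSum]
      exact Finset.sum_congr rfl fun v _ =>
      congrArg (fun u => Finsupp.single u (c v)) (Subsingleton.elim _ _)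
    rw [h1] at hc
    simpa using hc
  have hc' : c = ∑ v ∈ c.support, c v • (Finsupp.single v (1 : ℤ) - Finsupp.single v₀ 1) := by
    simp only [smul_sub, Finset.sum_sub_distrib, ← Finset.sum_smul, hsum, zero_smul, sub_zero]
    conv_lhs => rw [← c.sum_single]
    simp [Finsupp.sum]
  rw [hc']
  refine Finset.sum_induction _ (IsFillable X) (fun _ _ => IsFillable.add) isFillable_zero ?_
  intro v _
  refine IsFillable.smul _ ?_
  have h : ∀ u : Fin 1 → W, u = fun _ => u 0 := fun u => by
    funext i
    rw [Subsingleton.elim i 0]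
  rw [h v, h v₀]
  exact joined₁_of_connectedSpace (v₀ 0) (v 0)

/-- The cycles of dimension at most `d - 1` are fillable. -/
lemma isFillable_of_boundary_eq_zero [ConnectedSpace (Realization X)] {d : ℕ}
    (hpoly : ∀ i : ℕ, 2 ≤ i → i ≤ d → IsPolynomial (fillingFunction X i)) {n : ℕ} (hn : n + 1 ≤ d)
    {c : (Fin (n + 1) → W) →₀ ℤ} (hc : c ∈ chains X (n + 1)) (hc0 : boundary c = 0) :
    IsFillable X c := by
  cases n with
  | zero => exact isFillable_of_boundary_eq_zero_one hc0
  | succ n =>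
    obtain ⟨-, K, hK, h⟩ := (hpoly (n + 2) (by omega) hn).exists_le_degree
    obtain ⟨b, hb, hbc, -⟩ := exists_filling_of_fillingFunction_le (by positivity)
      (h (absSum c + 1) (by omega)) hc hc0 (by omega)
    exact ⟨b, hb, hbc⟩

variable (Γ X) in
/-- The equivariant system of integral chains in `X` indexed by tuples of group elements: the chain
of an `(n + 1)`-tuple is a minimal filling of the alternating sum of the chains of its faces. -/
def simplexFilling : ∀ n, (Fin n → Γ) → ((Fin n → W) →₀ ℤ)
  | 0, _ => Finsupp.single (fun i => i.elim0) 1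
  | n + 1, γ => translateChain (γ 0) (minFilling X
      (translateChain (γ 0)⁻¹ (tupleCoboundary ℤ (simplexFilling n) γ)))

lemma translateChain_tupleCoboundary (g : Γ) {n m : ℕ} {f : (Fin n → Γ) → ((Fin m → W) →₀ ℤ)}
    (hf : ∀ γ, f (fun i => g * γ i) = translateChain g (f γ)) (γ : Fin (n + 1) → Γ) :
    tupleCoboundary ℤ f (fun i => g * γ i) = translateChain g (tupleCoboundary ℤ f γ) := by
  simp only [tupleCoboundary, translateChain_sum, translateChain_smul]
  exact Finset.sum_congr rfl fun i _ => by rw [hf fun j => γ (i.succAbove j)]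

lemma simplexFilling_mul (g : Γ) : ∀ n (γ : Fin n → Γ),
    simplexFilling Γ X n (fun i => g * γ i) = translateChain g (simplexFilling Γ X n γ) := by
  intro n
  induction n with
  | zero =>
    intro γ
    simp only [simplexFilling, translateChain, Finsupp.mapDomain_single]
    congr 1
    funext i
    exact i.elim0
  | succ n ih =>
    intro γ
    rw [simplexFilling, translateChain_tupleCoboundary g ih, ← translateChain_mul, mul_inv_rev,
      inv_mul_cancel_right, translateChain_mul]
    rfl

lemma simplexFilling_mem_chains (hX : ∀ (γ : Γ), ∀ s ∈ X.faces, translate γ s ∈ X.faces) {n : ℕ}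
    (γ : Fin (n + 1) → Γ) : simplexFilling Γ X (n + 1) γ ∈ chains X (n + 1) :=
  translateChain_mem_chains hX _ (minFilling_mem_chains X _)

lemma tupleCoboundary_mem {n m : ℕ} {f : (Fin n → Γ) → ((Fin m → W) →₀ ℤ)}
    (hf : ∀ γ, f γ ∈ chains X m) (γ : Fin (n + 1) → Γ) : tupleCoboundary ℤ f γ ∈ chains X m :=
  sum_mem fun _ _ => zsmul_mem (hf _) _

lemma boundary_tupleCoboundary {n m : ℕ} (f : (Fin n → Γ) → ((Fin (m + 1) → W) →₀ ℤ))
    (γ : Fin (n + 1) → Γ) :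
    boundary (tupleCoboundary ℤ f γ) = tupleCoboundary ℤ (fun γ => boundary (f γ)) γ := by
  simp only [tupleCoboundary, boundary_sum, boundary_smul]

lemma isFillable_single_zero (w : W) :
    IsFillable X (Finsupp.single (fun i : Fin 0 => i.elim0) (1 : ℤ)) := by
  classical
  have : Subsingleton (Fin (0 + 1)) := inferInstanceAs (Subsingleton (Fin 1))
  refine ⟨Finsupp.single (fun _ => w) 1, ⟨fun v hv => ?_, fun σ v => ?_⟩, ?_⟩
  · have hv' : v = fun _ => w := by
      by_contra h
      exact hv (Finsupp.single_eq_of_ne h)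
    subst hv'
    exact ⟨fun i j _ => Subsingleton.elim i j, {w}, X.singleton_mem w, by simp⟩
  · have : v ∘ σ = v := by
      funext i
      exact congrArg v (Subsingleton.elim _ _)
    simp [Subsingleton.elim σ 1]
  · rw [boundary_single]
    congr 1
    exact Subsingleton.elim _ _

/-- The simplicial boundary of `simplexFilling` is the alternating sum over the faces. -/
lemma boundary_simplexFilling [ConnectedSpace (Realization X)] [Nonempty W] {d : ℕ}
    (hX : ∀ (γ : Γ), ∀ s ∈ X.faces, translate γ s ∈ X.faces)
    (hpoly : ∀ i : ℕ, 2 ≤ i → i ≤ d → IsPolynomial (fillingFunction X i)) :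
    ∀ n ≤ d, ∀ γ : Fin (n + 1) → Γ,
      IsFillable X (translateChain (γ 0)⁻¹ (tupleCoboundary ℤ (simplexFilling Γ X n) γ)) ∧
      boundary (simplexFilling Γ X (n + 1) γ) = tupleCoboundary ℤ (simplexFilling Γ X n) γ := by
  have key : ∀ n (γ : Fin (n + 1) → Γ),
      IsFillable X (translateChain (γ 0)⁻¹ (tupleCoboundary ℤ (simplexFilling Γ X n) γ)) →
      boundary (simplexFilling Γ X (n + 1) γ) = tupleCoboundary ℤ (simplexFilling Γ X n) γ := by
    intro n γ h
    rw [simplexFilling, boundary_translateChain, h.boundary_minFilling, ← translateChain_mul]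
    simp
  intro n
  induction n with
  | zero =>
    intro _ γ
    have h : IsFillable X (translateChain (γ 0)⁻¹
        (tupleCoboundary ℤ (simplexFilling Γ X 0) γ)) := by
      have h0 : translateChain (γ 0)⁻¹ (tupleCoboundary ℤ (simplexFilling Γ X 0) γ) =
          Finsupp.single (fun i : Fin 0 => i.elim0) (1 : ℤ) := by
        simp only [tupleCoboundary, simplexFilling, translateChain]
        rw [Fin.sum_univ_succ]
        simp only [Finset.univ_eq_empty, Finset.sum_empty, Fin.val_zero, pow_zero, one_smul,
          add_zero, Finsupp.mapDomain_single]
        congr 1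
        exact Subsingleton.elim _ _
      rw [h0]
      exact isFillable_single_zero (Classical.arbitrary W)
    exact ⟨h, key 0 γ h⟩
  | succ n ih =>
    intro hn γ
    have h : IsFillable X (translateChain (γ 0)⁻¹
        (tupleCoboundary ℤ (simplexFilling Γ X (n + 1)) γ)) := by
      refine isFillable_of_boundary_eq_zero hpoly hn (translateChain_mem_chains hX _
        (tupleCoboundary_mem (fun γ => simplexFilling_mem_chains hX γ) γ)) ?_
      have h1 : (fun γ => boundary (simplexFilling Γ X (n + 1) γ)) =
          tupleCoboundary ℤ (simplexFilling Γ X n) := by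
        funext γ
        exact (ih (by omega) γ).2
      rw [boundary_translateChain, boundary_tupleCoboundary, h1, tupleCoboundary_tupleCoboundary]
      simp [translateChain]
    exact ⟨h, key _ γ h⟩

end SimplexFilling

/-! ### Growth of the fillings -/

section Growth

variable {Γ W : Type*} [Group Γ] [MulAction Γ W] {X : AbstractSimplicialComplex W}

/-- Translates `g • a` and `a` of a `0`-chain are joined by paths of length linear in `|g|`. -/
lemma exists_linear_filling [ConnectedSpace (Realization X)]
    (hX : ∀ (γ : Γ), ∀ s ∈ X.faces, translate γ s ∈ X.faces) {S : Finset Γ}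
    (hS : Subgroup.closure (S : Set Γ) = ⊤) (a : (Fin 1 → W) →₀ ℤ) :
    ∃ C : ℕ, ∀ g : Γ, ∃ b ∈ chains X 2, boundary b = translateChain g a - a ∧
      absSum b ≤ C * wordLength (S : Set Γ) g := by
  have hb0 : ∀ (g : Γ), boundary (translateChain g a) = boundary a := by
    intro g
    rw [boundary_translateChain]
    refine (Finsupp.mapDomain_congr fun v _ => ?_).trans Finsupp.mapDomain_id
    exact Subsingleton.elim _ _
  have hfill : ∀ g : Γ, IsFillable X (translateChain g a - a) := by
    intro g
    refine isFillable_of_boundary_eq_zero_one ?_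
    have h : boundary (translateChain g a - a + a) = boundary (translateChain g a - a) +
      boundary a := boundary_add _ _
    rw [sub_add_cancel, hb0] at h
    simpa using h.symm
  refine ⟨∑ s ∈ S, absSum (minFilling X (translateChain s a - a)), fun g => ?_⟩
  have hgen : ∀ s : Γ, s ∈ S ∨ s⁻¹ ∈ S → ∃ b ∈ chains X 2, boundary b = translateChain s a - a ∧
      absSum b ≤ ∑ s ∈ S, absSum (minFilling X (translateChain s a - a)) := by
    intro s hs
    rcases hs with hs | hs
    · exact ⟨_, minFilling_mem_chains X _, (hfill s).boundary_minFilling,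
        Finset.single_le_sum (f := fun s => absSum (minFilling X (translateChain s a - a)))
          (fun _ _ => Nat.zero_le _) hs⟩
    · refine ⟨(-1 : ℤ) • translateChain s (minFilling X (translateChain s⁻¹ a - a)),
        zsmul_mem (translateChain_mem_chains hX _ (minFilling_mem_chains X _)) _, ?_, ?_⟩
      · rw [boundary_smul, boundary_translateChain, (hfill s⁻¹).boundary_minFilling, sub_eq_add_neg,
          ← neg_one_smul ℤ a, translateChain, Finsupp.mapDomain_add]
        change (-1 : ℤ) • (translateChain s (translateChain s⁻¹ a) +
          translateChain s ((-1 : ℤ) • a)) = _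
        rw [← translateChain_mul, translateChain_smul, mul_inv_cancel, translateChain_one]
        simp only [neg_smul, one_smul]
        abel
      · rw [neg_one_smul, absSum_neg]
        exact (absSum_translateChain_le _ _).trans
          (Finset.single_le_sum (f := fun s => absSum (minFilling X (translateChain s a - a)))
          (fun _ _ => Nat.zero_le _) hs)
  obtain ⟨l, hl, hlS, rfl⟩ := exists_word hS g
  rw [← hl]
  clear hl
  induction l with
  | nil => exact ⟨0, zero_mem _, by simp [boundary], by simp⟩
  | cons s l ih =>
    obtain ⟨b, hb, hb', hbn⟩ := hgen s (hlS s (by simp))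
    obtain ⟨c, hc, hc', hcn⟩ := ih fun t ht => hlS t (by simp [ht])
    refine ⟨b + translateChain s c, add_mem hb (translateChain_mem_chains hX _ hc), ?_, ?_⟩
    · rw [boundary_add, hb', boundary_translateChain, hc', List.prod_cons, translateChain_mul,
        sub_eq_add_neg (translateChain l.prod a), ← neg_one_smul ℤ a]
      conv_lhs => rw [translateChain.eq_def s (_ + _), Finsupp.mapDomain_add]
      change _ + (translateChain s (translateChain l.prod a) +
        translateChain s ((-1 : ℤ) • a)) = _
      rw [translateChain_smul]
      simp only [neg_smul, one_smul]
      abel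
    · refine (absSum_add_le _ _).trans ?_
      rw [List.length_cons, mul_add, mul_one, add_comm]
      exact add_le_add ((absSum_translateChain_le _ _).trans hcn) hbn

/-- The size of a tuple of group elements: one plus the sum of the word lengths. -/
def tupleSize (S : Set Γ) {n : ℕ} (γ : Fin n → Γ) : ℝ := 1 + ∑ i, (wordLength S (γ i) : ℝ)

lemma one_le_tupleSize (S : Set Γ) {n : ℕ} (γ : Fin n → Γ) : 1 ≤ tupleSize S γ :=
  le_add_of_nonneg_right (Finset.sum_nonneg fun _ _ => Nat.cast_nonneg _)

lemma tupleSize_succAbove_le (S : Set Γ) {n : ℕ} (γ : Fin (n + 1) → Γ) (i : Fin (n + 1)) :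
    tupleSize S (fun j => γ (i.succAbove j)) ≤ tupleSize S γ := by
  rw [tupleSize, tupleSize, Fin.sum_univ_succAbove _ i]
  have : (0 : ℝ) ≤ wordLength S (γ i) := Nat.cast_nonneg _
  linarith

lemma fillingExponent_succ (X : AbstractSimplicialComplex W) (n : ℕ) :
    fillingExponent X (n + 2) = fillingExponent X (n + 1) * degree (fillingFunction X (n + 2)) :=
  Finset.prod_Icc_succ_top (by omega) _

lemma absSum_tupleCoboundary_le {n m : ℕ} (f : (Fin n → Γ) → ((Fin m → W) →₀ ℤ))
    (γ : Fin (n + 1) → Γ) :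
    absSum (tupleCoboundary ℤ f γ) ≤ ∑ i : Fin (n + 1), absSum (f fun j => γ (i.succAbove j)) := by
  refine (absSum_sum_le _ _).trans (Finset.sum_le_sum fun i _ => ?_)
  rcases neg_one_pow_eq_or ℤ (i : ℕ) with h | h <;> simp [h]

/-- The fillings of `(n + 1)`-tuples grow at most polynomially, with exponent the product of the
degrees of the filling functions of the dimensions up to `n`. -/
lemma exists_absSum_simplexFilling_le [ConnectedSpace (Realization X)] [Nonempty W] {d : ℕ}
    (hX : ∀ (γ : Γ), ∀ s ∈ X.faces, translate γ s ∈ X.faces)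
    (hpoly : ∀ i : ℕ, 2 ≤ i → i ≤ d → IsPolynomial (fillingFunction X i)) {S : Finset Γ}
    (hS : Subgroup.closure (S : Set Γ) = ⊤) :
    ∀ n ≤ d, ∃ K : ℝ, 0 ≤ K ∧ ∀ γ : Fin (n + 1) → Γ,
      (absSum (simplexFilling Γ X (n + 1) γ) : ℝ) ≤
        K * tupleSize (S : Set Γ) γ ^ fillingExponent X n := by
  have hbd := boundary_simplexFilling (Γ := Γ) hX hpoly
  -- The chain of a single group element is a translate of one fixed `0`-chain.
  obtain ⟨a, ha⟩ : ∃ a : (Fin 1 → W) →₀ ℤ, ∀ γ : Fin 1 → Γ,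
      simplexFilling Γ X 1 γ = translateChain (γ 0) a := by
    refine ⟨simplexFilling Γ X 1 fun _ => 1, fun γ => ?_⟩
    rw [← simplexFilling_mul]
    congr 1
    funext i
    rw [Subsingleton.elim i 0, mul_one]
  intro n
  induction n with
  | zero =>
    intro _
    refine ⟨absSum a, by positivity, fun γ => ?_⟩
    rw [ha]
    have h1 : (1 : ℝ) ≤ tupleSize (S : Set Γ) γ ^ fillingExponent X 0 := by
      simpa [fillingExponent] using one_le_tupleSize (S : Set Γ) γ
    have h2 : (absSum (translateChain (γ 0) a) : ℝ) ≤ absSum a := by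
      exact_mod_cast absSum_translateChain_le _ _
    nlinarith [(Nat.cast_nonneg (absSum a) : (0 : ℝ) ≤ absSum a)]
  | succ n ih =>
    intro hn
    cases n with
    | zero =>
      -- In degree one the fillings are paths of linear length; no filling function is involved.
      obtain ⟨C, hC⟩ := exists_linear_filling hX hS a
      refine ⟨C, by positivity, fun γ => ?_⟩
      obtain ⟨b, hb, hbc, hbn⟩ := hC ((γ 0)⁻¹ * γ 1)
      have h1 : translateChain (γ 0)⁻¹ (tupleCoboundary ℤ (simplexFilling Γ X 1) γ) =
          translateChain ((γ 0)⁻¹ * γ 1) a - a := by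
        rw [← translateChain_tupleCoboundary (γ 0)⁻¹ (simplexFilling_mul _ 1), tupleCoboundary]
        simp [ha, Fin.sum_univ_two, sub_eq_add_neg]
      have h2 : absSum (simplexFilling Γ X 2 γ) ≤ absSum b := by
        rw [simplexFilling]
        refine (absSum_translateChain_le _ _).trans (absSum_minFilling_le hb ?_)
        rw [hbc, h1]
      have h3 : wordLength (S : Set Γ) ((γ 0)⁻¹ * γ 1) ≤
          wordLength (S : Set Γ) (γ 0) + wordLength (S : Set Γ) (γ 1) :=
        (wordLength_mul_le hS _ _).trans (add_le_add (wordLength_inv_le hS _) le_rfl)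
      have h4 : (wordLength (S : Set Γ) ((γ 0)⁻¹ * γ 1) : ℝ) ≤ tupleSize (S : Set Γ) γ := by
        rw [tupleSize, Fin.sum_univ_two]
        have : (wordLength (S : Set Γ) ((γ 0)⁻¹ * γ 1) : ℝ) ≤
          wordLength (S : Set Γ) (γ 0) + wordLength (S : Set Γ) (γ 1) := by exact_mod_cast h3
        linarith
      have h5 : (absSum (simplexFilling Γ X 2 γ) : ℝ) ≤
          C * wordLength (S : Set Γ) ((γ 0)⁻¹ * γ 1) := by exact_mod_cast h2.trans hbn
      have h6 : tupleSize (S : Set Γ) γ ^ fillingExponent X (0 + 1) = tupleSize (S : Set Γ) γ := by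
        simp [fillingExponent]
      rw [h6]
      exact h5.trans (mul_le_mul_of_nonneg_left h4 (Nat.cast_nonneg C))
    | succ n =>
      obtain ⟨K, hK, hKb⟩ := ih (by omega)
      obtain ⟨hdeg, K', hK', hfill⟩ := (hpoly (n + 2) (by omega) hn).exists_le_degree
      set N := fillingExponent X (n + 1) with hN
      set r := degree (fillingFunction X (n + 2)) with hr
      have hN0 : 0 ≤ N := Finset.prod_nonneg fun i hi =>
        zero_le_one.trans (hpoly i (Finset.mem_Icc.mp hi).1
          ((Finset.mem_Icc.mp hi).2.trans (by omega))).exists_le_degree.1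
      let A : ℝ := (n + 3) * K + 1
      have hA : 0 ≤ A := by positivity
      refine ⟨(n + 3)! * (K' * A ^ r + 1), by positivity, fun γ => ?_⟩
      set L := tupleSize (S : Set Γ) γ with hL
      have hL1 : 1 ≤ L := one_le_tupleSize _ _
      have hLN : 1 ≤ L ^ N := Real.one_le_rpow hL1 hN0
      -- The cycle to be filled. Its mass is of order `L ^ N` by induction.
      set c := translateChain (γ 0)⁻¹ (tupleCoboundary ℤ (simplexFilling Γ X (n + 2)) γ) with hc
      have hcK : (absSum c : ℝ) ≤ (n + 3) * K * L ^ N := by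
        have h1 : absSum c ≤ ∑ i : Fin (n + 3),
            absSum (simplexFilling Γ X (n + 2) fun j => γ (i.succAbove j)) :=
          (absSum_translateChain_le _ _).trans (absSum_tupleCoboundary_le _ _)
        have h2 : (absSum c : ℝ) ≤ ∑ i : Fin (n + 3),
            (absSum (simplexFilling Γ X (n + 2) fun j => γ (i.succAbove j)) : ℝ) := by
          exact_mod_cast h1
        refine h2.trans ((Finset.sum_le_sum (g := fun _ => K * L ^ N) fun i _ => ?_).trans
          (le_of_eq ?_))
        · refine (hKb _).trans (mul_le_mul_of_nonneg_left ?_ hK)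
          exact Real.rpow_le_rpow (zero_le_one.trans (one_le_tupleSize _ _))
            (tupleSize_succAbove_le _ γ i) hN0
        · simp
          ring
      -- The filling function is estimated at positive arguments only, hence the mass plus one.
      have ht : ((absSum c + 1 : ℕ) : ℝ) ≤ A * L ^ N := by
        push_cast
        simp only [A, add_mul, one_mul]
        linarith
      have hcm : c ∈ chains X (n + 2) := translateChain_mem_chains hX _
        (tupleCoboundary_mem (fun γ => simplexFilling_mem_chains hX γ) γ)
      have hc0 : boundary c = 0 := by
        obtain ⟨b, -, hb⟩ := (hbd (n + 2) hn γ).1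
        have h1 : (fun γ => boundary (simplexFilling Γ X (n + 2) γ)) =
            tupleCoboundary ℤ (simplexFilling Γ X (n + 1)) := by
          funext γ
          exact (hbd (n + 1) (by omega) γ).2
        rw [hc, boundary_translateChain, boundary_tupleCoboundary, h1,
          tupleCoboundary_tupleCoboundary]
        simp [translateChain]
      obtain ⟨b, hb, hbc, hbn⟩ := exists_filling_of_fillingFunction_le (by positivity)
        (hfill (absSum c + 1) (by omega)) hcm hc0 (by omega)
      have h1 : (absSum (simplexFilling Γ X (n + 3) γ) : ℝ) ≤ absSum b := by
        rw [simplexFilling]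
        exact_mod_cast (absSum_translateChain_le _ _).trans (absSum_minFilling_le hb hbc)
      have h2 : ((absSum c + 1 : ℕ) : ℝ) ^ r ≤ A ^ r * (L ^ N) ^ r := by
        rw [← Real.mul_rpow hA (by positivity)]
        exact Real.rpow_le_rpow (by positivity) ht (by linarith)
      have hLNr : 1 ≤ (L ^ N) ^ r := Real.one_le_rpow hLN (by linarith)
      rw [fillingExponent_succ, ← hN, ← hr, Real.rpow_mul (by linarith)]
      refine (h1.trans hbn).trans ?_
      rw [mul_assoc]
      refine mul_le_mul_of_nonneg_left ?_ (by positivity)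
      have h3 := mul_le_mul_of_nonneg_left h2 hK'
      nlinarith

end Growth

/-! ### Cocycles of polynomial growth -/

section PolynomialCocycles

variable {𝕜 Γ W V : Type*} [RCLike 𝕜] [Group Γ] [MulAction Γ W] {X : AbstractSimplicialComplex W}
  [NormedAddCommGroup V] [NormedSpace 𝕜 V]

lemma orderedChain_tupleCoboundary {n m : ℕ} (f : (Fin n → Γ) → ((Fin m → W) →₀ ℤ))
    (γ : Fin (n + 1) → Γ) : orderedChain 𝕜 (tupleCoboundary ℤ f γ) =
      tupleCoboundary 𝕜 (fun γ => orderedChain 𝕜 (f γ)) γ := by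
  simp only [tupleCoboundary, orderedChain, map_sum, Finset.smul_sum, map_zsmul]
  refine Finset.sum_congr rfl fun i _ => ?_
  rcases neg_one_pow_eq_or ℤ (i : ℕ) with h | h <;>
    rcases neg_one_pow_eq_or 𝕜 (i : ℕ) with h' | h' <;>
    rcases Nat.even_or_odd (i : ℕ) with h'' | h'' <;> simp [h''.neg_one_pow]

lemma orderedChain_translateChain (γ : Γ) {m : ℕ} (c : (Fin m → W) →₀ ℤ) :
    orderedChain 𝕜 (translateChain γ c) = chainAct γ m (orderedChain 𝕜 c) := by
  have h : translateChain γ c = ∑ v ∈ c.support, Finsupp.single (fun i => γ • v i) (c v) := rfl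
  rw [orderedChain_eq_sum c, orderedChain, h, map_sum, map_smul, map_sum]
  simp

/-- The chain map from the ordered chains of `Γ` through the chains of `X` back to the ordered
chains of `Γ`. -/
def throughComplex (𝕜 : Type*) [RCLike 𝕜] (X : AbstractSimplicialComplex W) (F : W → Finset Γ)
    (n : ℕ) : TupleChain 𝕜 Γ n →ₗ[𝕜] TupleChain 𝕜 Γ n :=
  Finsupp.linearCombination 𝕜 fun γ =>
    spreadChain 𝕜 F n (orderedChain 𝕜 (simplexFilling Γ X n γ))

lemma throughComplex_single (F : W → Finset Γ) {n : ℕ} (γ : Fin n → Γ) :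
    throughComplex 𝕜 X F n (Finsupp.single γ 1) =
      spreadChain 𝕜 F n (orderedChain 𝕜 (simplexFilling Γ X n γ)) := by
  simp [throughComplex]

lemma throughComplex_zero (F : W → Finset Γ) : throughComplex 𝕜 X F 0 = LinearMap.id := by
  refine Finsupp.lhom_ext' fun γ => LinearMap.ext_ring ?_
  simp only [LinearMap.comp_apply, Finsupp.lsingle_apply, throughComplex_single, simplexFilling,
    LinearMap.id_apply, orderedChain]
  simp only [Nat.factorial_zero, Nat.cast_one, inv_one, one_smul,
    Finsupp.mapRange.addMonoidHom_apply, Finsupp.mapRange_single, spreadChain,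
    Finsupp.linearCombination_single]
  simp only [Int.coe_castAddHom, Int.cast_one, one_smul, spread]
  congr 1
  exact Subsingleton.elim _ _

lemma tupleBoundary_throughComplex [ConnectedSpace (Realization X)] [Nonempty W] {d : ℕ}
    (hX : ∀ (γ : Γ), ∀ s ∈ X.faces, translate γ s ∈ X.faces)
    (hpoly : ∀ i : ℕ, 2 ≤ i → i ≤ d → IsPolynomial (fillingFunction X i)) {F : W → Finset Γ}
    (hF : ∀ w, (F w).Nonempty) {n : ℕ} (hn : n ≤ d) (x : TupleChain 𝕜 Γ (n + 1)) :
    tupleBoundary n (throughComplex 𝕜 X F (n + 1) x) =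
      throughComplex 𝕜 X F n (tupleBoundary n x) := by
  suffices h : tupleBoundary n ∘ₗ throughComplex 𝕜 X F (n + 1) =
      throughComplex 𝕜 X F n ∘ₗ tupleBoundary n from LinearMap.congr_fun h x
  refine Finsupp.lhom_ext' fun γ => LinearMap.ext_ring ?_
  simp only [LinearMap.comp_apply, Finsupp.lsingle_apply]
  rw [throughComplex_single, tupleBoundary_spreadChain hF,
    tupleBoundary_orderedChain (simplexFilling_mem_chains hX γ).2,
    (boundary_simplexFilling hX hpoly n hn γ).2, orderedChain_tupleCoboundary, tupleBoundary_single,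
    tupleCoboundary, map_sum, map_sum]
  refine Finset.sum_congr rfl fun i _ => ?_
  rw [map_smul, map_smul, throughComplex_single]

lemma throughComplex_chainAct {F : W → Finset Γ}
    (hF : ∀ (γ : Γ) w, F (γ • w) = (F w).map (Equiv.mulLeft γ).toEmbedding) (g : Γ) (n : ℕ)
    (x : TupleChain 𝕜 Γ n) :
    throughComplex 𝕜 X F n (chainAct g n x) = chainAct g n (throughComplex 𝕜 X F n x) := by
  suffices h : throughComplex 𝕜 X F n ∘ₗ chainAct g n =
      chainAct g n ∘ₗ throughComplex 𝕜 X F n from LinearMap.congr_fun h x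
  have hs : ∀ y : TupleChain 𝕜 W n,
      spreadChain 𝕜 F n (chainAct g n y) = chainAct g n (spreadChain 𝕜 F n y) := by
    intro y
    suffices h : spreadChain 𝕜 F n ∘ₗ chainAct g n = chainAct g n ∘ₗ spreadChain 𝕜 F n from
      LinearMap.congr_fun h y
    refine Finsupp.lhom_ext' fun v => LinearMap.ext_ring ?_
    simp [spreadChain, chainAct_spread hF]
  refine Finsupp.lhom_ext' fun γ => LinearMap.ext_ring ?_
  simp only [LinearMap.comp_apply, Finsupp.lsingle_apply, chainAct_single, throughComplex_single,
    smul_eq_mul]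
  rw [simplexFilling_mul, orderedChain_translateChain, hs]

/-- An equivariant function is bounded on the chains `spread v` of the simplices `v` of a skeleton
with finitely many orbits. -/
lemma exists_norm_evalChain_spread_le {d : ℕ} (hX : IsFinitenessModel Γ X (d + 1))
    {F : W → Finset Γ} (hF : ∀ (γ : Γ) w, F (γ • w) = (F w).map (Equiv.mulLeft γ).toEmbedding)
    (ρ : Γ →* (V →ₗᵢ[𝕜] V)) {k : ℕ} (hk : k ≤ d) {b : (Fin (k + 1) → Γ) → V}
    (hb : ∀ (g : Γ) (γ : Fin (k + 1) → Γ), b (fun i => g * γ i) = ρ g (b γ)) :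
    ∃ B : ℝ, 0 ≤ B ∧ ∀ v : Fin (k + 1) → W,
      (∃ s ∈ X.faces, (s : Set W) = Set.range v) → ‖evalChain 𝕜 b (spread 𝕜 F (k + 1) v)‖ ≤ B := by
  classical
  obtain ⟨T, hT, hTs⟩ := hX.cofinite
  have hfin : (⋃ t ∈ T, Set.pi Set.univ fun _ : Fin (k + 1) => (t : Set W)).Finite :=
    hT.biUnion fun t _ => Set.Finite.pi fun _ => t.finite_toSet
  obtain ⟨B, hB⟩ := (hfin.image fun v => ‖evalChain 𝕜 b (spread 𝕜 F (k + 1) v)‖).bddAbove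
  refine ⟨max B 0, le_max_right _ _, fun v hv => ?_⟩
  obtain ⟨s, hs, hsv⟩ := hv
  have hcard : s.card ≤ d + 1 + 1 := by
    have h1 : s = Finset.univ.image v := by
      rw [← Finset.coe_inj, hsv]
      simp
    have h2 : s.card ≤ (Finset.univ : Finset (Fin (k + 1))).card := by
      rw [h1]; exact Finset.card_image_le
    simp at h2
    omega
  obtain ⟨t, ht, γ, rfl⟩ := hTs s hs hcard
  have hmem : ∀ i, γ⁻¹ • v i ∈ t := by
    intro i
    have h1 : v i ∈ ((translate γ t : Finset W) : Set W) := by rw [hsv]; exact ⟨i, rfl⟩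
    simp only [translate, Finset.coe_map, Set.mem_image] at h1
    obtain ⟨w, hw, hwv⟩ := h1
    rw [← hwv]
    simpa using hw
  have hv' : v = fun i => γ • (fun i => γ⁻¹ • v i) i := by simp
  rw [hv', ← chainAct_spread hF, evalChain_chainAct ρ hb, LinearIsometry.norm_map]
  exact (hB ⟨_, Set.mem_biUnion ht fun i _ => hmem i, rfl⟩).trans (le_max_left _ _)

/-- Every equivariant cocycle on `Γ` is cohomologous to a cocycle of polynomial growth: it is
pulled back along the chain map through the chains of the complex `X`, which is equivariantly
homotopic to the identity. -/
theorem exists_cocycle_polynomial_growth {d : ℕ} (hX : IsFinitenessModel Γ X (d + 1))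
    (hpoly : ∀ i : ℕ, 2 ≤ i → i ≤ d → IsPolynomial (fillingFunction X i)) {S : Finset Γ}
    (hS : Subgroup.closure (S : Set Γ) = ⊤) (ρ : Γ →* (V →ₗᵢ[𝕜] V)) {k : ℕ} (hk : k ≤ d)
    {b : (Fin (k + 1) → Γ) → V}
    (hb : ∀ (g : Γ) (γ : Fin (k + 1) → Γ), b (fun i => g * γ i) = ρ g (b γ))
    (hb0 : tupleCoboundary 𝕜 b = 0) :
    ∃ b' : (Fin (k + 1) → Γ) → V,
      (∀ (g : Γ) (γ : Fin (k + 1) → Γ), b' (fun i => g * γ i) = ρ g (b' γ)) ∧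
      tupleCoboundary 𝕜 b' = 0 ∧
      (∃ C : ℝ, 0 ≤ C ∧ ∀ γ, ‖b' γ‖ ≤ C * tupleSize (S : Set Γ) γ ^ fillingExponent X k) ∧
      ∃ q : (Fin k → Γ) → V, (∀ (g : Γ) (γ : Fin k → Γ), q (fun i => g * γ i) = ρ g (q γ)) ∧
        (k = 0 → q = 0) ∧ b' - b = tupleCoboundary 𝕜 q := by
  have := hX.contractible
  have : ConnectedSpace (Realization X) := inferInstance
  have : Nonempty W := by
    obtain ⟨x, s, hs, -⟩ := (inferInstance : Nonempty (Realization X))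
    exact ⟨(X.isRelLowerSet_faces hs).1.choose⟩
  -- `F w` is a left coset of a finite stabilizer; vertices of `X` are sent back to `Γ` by averaging
  -- over it, which makes the map equivariant although the action need not be free.
  let F : W → Finset Γ := fun w => (finite_orbitFiber hX.proper w).toFinset
  have hF : ∀ w, (F w).Nonempty := fun w => by simpa [F] using orbitFiber_nonempty w
  have hFe : ∀ (γ : Γ) w, F (γ • w) = (F w).map (Equiv.mulLeft γ).toEmbedding := by
    intro γ w
    ext γ'
    simp only [F, Set.Finite.mem_toFinset, Finset.mem_map_equiv, mem_orbitFiber_smul]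
    rfl
  -- The difference with the identity vanishes on the augmentation term, hence is null-homotopic.
  let δ : ∀ n, TupleChain 𝕜 Γ n →ₗ[𝕜] TupleChain 𝕜 Γ n :=
    fun n => throughComplex 𝕜 X F n - LinearMap.id
  have hδ0 : δ 0 = 0 := by
    refine LinearMap.ext fun x => ?_
    simp only [δ, LinearMap.sub_apply, throughComplex_zero, LinearMap.id_apply,
      LinearMap.zero_apply]
    exact sub_self x
  have hδ : ∀ m < k + 1, ∀ x, tupleBoundary m (δ (m + 1) x) = δ m (tupleBoundary m x) := by
    intro m hm x
    simp [δ, tupleBoundary_throughComplex hX.simplicial hpoly hF (show m ≤ d by omega)]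
  have hδe : ∀ (g : Γ) n x, δ n (chainAct g n x) = chainAct g n (δ n x) := by
    intro g n x
    simp [δ, throughComplex_chainAct hFe]
  let b' : (Fin (k + 1) → Γ) → V := fun γ =>
    evalChain 𝕜 b (throughComplex 𝕜 X F (k + 1) (Finsupp.single γ 1))
  let q : (Fin k → Γ) → V := fun γ =>
    evalChain 𝕜 b (coneHomotopy id δ k (Finsupp.single γ 1))
  have hbq : b' - b = tupleCoboundary 𝕜 q := by
    funext γ
    rw [← evalChain_eq_tupleCoboundary id δ hδ0 hδ hb0 γ]
    simp [δ, b']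
  refine ⟨b', fun g γ => ?_, ?_, ?_, q, fun g γ => ?_, ?_, hbq⟩
  · have h := chainAct_single (𝕜 := 𝕜) g γ 1
    simp only [smul_eq_mul] at h
    simp only [b']
    rw [← h, throughComplex_chainAct hFe, evalChain_chainAct ρ hb]
  · have h : b' = b + tupleCoboundary 𝕜 q := by rw [← hbq]; abel
    have hadd : ∀ f g : (Fin (k + 1) → Γ) → V,
        tupleCoboundary 𝕜 (f + g) = tupleCoboundary 𝕜 f + tupleCoboundary 𝕜 g := by
      intro f g
      funext y
      simp [tupleCoboundary, Finset.sum_add_distrib]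
    rw [h, hadd, hb0, tupleCoboundary_tupleCoboundary, add_zero]
  · obtain ⟨B, hB, hBv⟩ := exists_norm_evalChain_spread_le hX hFe ρ hk hb
    obtain ⟨K, hK, hKv⟩ := exists_absSum_simplexFilling_le hX.simplicial hpoly hS k hk
    refine ⟨B * K, by positivity, fun γ => ?_⟩
    have h1 : ‖b' γ‖ ≤ B * (absSum (simplexFilling Γ X (k + 1) γ) : ℝ) := by
      simp only [b']
      rw [throughComplex_single, orderedChain_eq_sum, map_smul, map_smul, norm_smul, map_sum,
        map_sum]
      have h2 : ‖(((k + 1)! : ℕ) : 𝕜)⁻¹‖ ≤ 1 := by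
        rw [norm_inv, RCLike.norm_natCast]
        exact inv_le_one_of_one_le₀ (by exact_mod_cast Nat.factorial_pos (k + 1))
      refine (mul_le_mul_of_nonneg_right h2 (norm_nonneg _)).trans ?_
      rw [one_mul, absSum, Nat.cast_sum, Finset.mul_sum]
      refine norm_sum_le_of_le _ fun v hv => ?_
      rw [map_smul, map_smul, norm_smul, mul_comm]
      have h3 := hBv v ((simplexFilling_mem_chains hX.simplicial γ).1 v
        (Finsupp.mem_support_iff.mp hv)).2
      have h4 : spreadChain 𝕜 F (k + 1) (Finsupp.single v 1) = spread 𝕜 F (k + 1) v := by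
        simp [spreadChain]
      have h5 : ‖((simplexFilling Γ X (k + 1) γ v : ℤ) : 𝕜)‖ =
          ((simplexFilling Γ X (k + 1) γ v).natAbs : ℝ) := by
        rw [← RCLike.ofReal_intCast, RCLike.norm_ofReal, Nat.cast_natAbs, Int.cast_abs]
      rw [h4, h5]
      exact mul_le_mul_of_nonneg_right h3 (Nat.cast_nonneg _)
    rw [mul_assoc]
    exact h1.trans (mul_le_mul_of_nonneg_left (hKv γ) hB)
  · have h := chainAct_single (𝕜 := 𝕜) g γ 1
    simp only [smul_eq_mul] at h
    simp only [q]
    rw [← h, coneHomotopy_chainAct g (fun y => by simp) (hδe g), evalChain_chainAct ρ hb]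
  · rintro rfl
    funext γ
    simp [q, coneHomotopy]

end PolynomialCocycles

/-! ### Fundamental domains and local integrability of the lattice cocycle -/

section FundamentalDomain

open scoped Pointwise

variable {G : Type*} [Group G] [MeasurableSpace G] [TopologicalSpace G] [IsTopologicalGroup G]
  [LocallyCompactSpace G] [SecondCountableTopology G] [T2Space G] [BorelSpace G]
  {Λ : Subgroup G} {D : Set G}

lemma IsLattice.smulInvariantMeasure_op (hΛ : IsLattice Λ) (hD : IsBorelFundamentalDomain Λ D)
    (μ : Measure G) [μ.IsHaarMeasure] : SMulInvariantMeasure Λ.op G μ := by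
  refine ⟨fun c A hA => ?_⟩
  have h := hΛ.map_mul_right_eq_self hD μ ⟨MulOpposite.unop c.1, c.2⟩
  conv_rhs => rw [← h]
  rw [Measure.map_apply (measurable_mul_const _) hA]
  rfl

lemma IsBorelFundamentalDomain.isFundamentalDomain (hD : IsBorelFundamentalDomain Λ D)
    (μ : Measure G) : IsFundamentalDomain Λ.op D μ := by
  refine IsFundamentalDomain.mk' hD.measurableSet.nullMeasurableSet fun x => ?_
  obtain ⟨l, hl, hu⟩ := hD.existsUnique x
  refine ⟨⟨MulOpposite.op (l : G), l.2⟩, hl, fun c hc => ?_⟩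
  have := hu ⟨MulOpposite.unop c.1, c.2⟩ hc
  rw [← this]
  rfl

lemma measure_fundamentalDomain_ne_zero (hΛ : IsLattice Λ) (hD : IsBorelFundamentalDomain Λ D)
    (μ : Measure G) [μ.IsHaarMeasure] : μ D ≠ 0 := by
  have := hΛ.countable
  have : Countable Λ.op := Countable.of_equiv Λ Λ.equivOp
  have := hΛ.smulInvariantMeasure_op hD μ
  exact (hD.isFundamentalDomain μ).measure_ne_zero (NeZero.ne μ)

/-- The integral of a right `Λ`-invariant function does not depend on the fundamental domain. -/
lemma setLIntegral_fundamentalDomain_eq (hΛ : IsLattice Λ) (hD : IsBorelFundamentalDomain Λ D)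
    {D' : Set G} (hD' : IsBorelFundamentalDomain Λ D') (μ : Measure G) [μ.IsHaarMeasure]
    {f : G → ℝ≥0∞} (hf : ∀ (x : G) (l : Λ), f (x * l) = f x) :
    ∫⁻ x in D, f x ∂μ = ∫⁻ x in D', f x ∂μ := by
  have := hΛ.countable
  have : Countable Λ.op := Countable.of_equiv Λ Λ.equivOp
  have := hΛ.smulInvariantMeasure_op hD μ
  exact (hD.isFundamentalDomain μ).setLIntegral_eq (hD'.isFundamentalDomain μ) f
    fun c x => hf x ⟨MulOpposite.unop c.1, c.2⟩

/-- A fundamental domain of a lattice has finite Haar measure: the finite invariant measure on the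
quotient, transported to the fundamental domain and spread out by `Λ`, is a left-invariant measure
giving the fundamental domain finite mass, and such measures are unique up to scaling. -/
lemma measure_fundamentalDomain_lt_top (hΛ : IsLattice Λ) (hD : IsBorelFundamentalDomain Λ D)
    (μ : Measure G) [μ.IsHaarMeasure] : μ D < ⊤ := by
  have := hΛ.countable
  have := hΛ.discrete
  obtain ⟨m, hm0, hmf, hmi⟩ := hΛ.finite_covolume
  -- `s` is the section of `G → G ⧸ Λ` with values in `D`.
  have hr : ∀ a b : G, QuotientGroup.leftRel Λ a b →
      a * (toDomain hD a : G) = b * (toDomain hD b : G) := by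
    intro a b hab
    rw [QuotientGroup.leftRel_apply] at hab
    have hb : b = a * ((⟨a⁻¹ * b, hab⟩ : Λ) : G) := by simp
    generalize (⟨a⁻¹ * b, hab⟩ : Λ) = l at hb
    rw [hb, toDomain_mul]
    simp [mul_assoc]
  let s : G ⧸ Λ → G := Quotient.lift (fun x => x * (toDomain hD x : G)) hr
  have hsm : Measurable s := by
    refine measurable_from_quotient.mpr ?_
    exact measurable_id.mul (measurable_subtype_coe.comp (measurable_toDomain hΛ hD))
  have hs : ∀ q : G ⧸ Λ, ((s q : G) : G ⧸ Λ) = q := by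
    intro q
    induction q using QuotientGroup.induction_on with
    | H x => exact (QuotientGroup.eq.mpr (by simp [s])).symm
  have hsD : ∀ q, s q ∈ D := by
    intro q
    induction q using QuotientGroup.induction_on with
    | H x => exact toDomain_mem hD x
  -- The measure `m`, spread out along the fibres of `G → G ⧸ Λ`.
  let ν : Measure G := Measure.sum fun l : Λ => (m.map s).map fun x => x * (l : G)
  have hν : ∀ f : G → ℝ≥0∞, Measurable f →
      ∫⁻ x, f x ∂ν = ∫⁻ q, ∑' l : Λ, f (s q * l) ∂m := by
    intro f hf
    rw [lintegral_sum_measure, lintegral_tsum]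
    · congr 1
      ext l
      rw [lintegral_map hf (measurable_mul_const _), lintegral_map _ hsm]
      exact hf.comp (measurable_mul_const _)
    · intro l
      exact (hf.comp ((measurable_mul_const _).comp hsm)).aemeasurable
  have hF : ∀ (f : G → ℝ≥0∞) (x : G), ∑' l : Λ, f (s (x : G ⧸ Λ) * l) = ∑' l : Λ, f (x * l) := by
    intro f x
    have : s (x : G ⧸ Λ) = x * (toDomain hD x : G) := rfl
    rw [this, ← (Equiv.mulLeft (toDomain hD x)).tsum_eq (fun l : Λ => f (x * l))]
    simp [mul_assoc]
  have hleft : ν.IsMulLeftInvariant := by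
    refine ⟨fun g => Measure.ext_of_lintegral _ fun f hf => ?_⟩
    rw [lintegral_map hf (measurable_const_mul _), hν _ hf,
      hν (fun x => f (g * x)) (hf.comp (measurable_const_mul g))]
    have h1 : ∀ q : G ⧸ Λ, ∑' l : Λ, f (g * (s q * l)) = ∑' l : Λ, f (s (g • q) * l) := by
      intro q
      have h2 : g • q = ((g * s q : G) : G ⧸ Λ) := by
        conv_lhs => rw [← hs q]
        rfl
      rw [h2, hF]
      simp [mul_assoc]
    simp only [h1]
    have hmp : MeasurePreserving (fun q : G ⧸ Λ => g • q) m m := by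
      have hgm : Measurable fun q : G ⧸ Λ => g • q :=
        measurable_from_quotient.mpr (measurable_quotient_mk''.comp (measurable_const_mul g))
      refine ⟨hgm, Measure.ext fun A hA => ?_⟩
      rw [Measure.map_apply hgm hA]
      exact hmi.measure_preimage_smul g hA
    rw [hmp.lintegral_comp (f := fun q => ∑' l : Λ, f (s q * l))]
    exact Measurable.tsum fun l => hf.comp ((measurable_mul_const _).comp hsm)
  have hνD : ∀ l₀ : Λ, ν ((fun x => x * (l₀ : G)) ⁻¹' D) = m Set.univ := by
    intro l₀
    have hmeas : MeasurableSet ((fun x => x * (l₀ : G)) ⁻¹' D) :=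
      (measurable_mul_const _) hD.measurableSet
    rw [← lintegral_indicator_one hmeas, hν _ (measurable_one.indicator hmeas), ← lintegral_one]
    congr 1
    ext q
    rw [tsum_eq_single l₀⁻¹]
    · rw [Set.indicator_of_mem]
      · rfl
      · simpa using hsD q
    · intro l hl
      refine Set.indicator_of_notMem (fun hmem => hl ?_) _
      have h2 : s q * ((l * l₀ : Λ) : G) ∈ D := by simpa [mul_assoc] using hmem
      have h3 := (toDomain_eq hD h2).symm.trans (toDomain_of_mem hD (hsD q))
      exact eq_inv_of_mul_eq_one_left h3
  have hνD1 : ν D = m Set.univ := by simpa using hνD 1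
  have hσ : SigmaFinite ν := by
    let e : Set (Set G) := Set.range fun l₀ : Λ => (fun x => x * (l₀ : G)) ⁻¹' D
    refine Measure.sigmaFinite_of_countable (S := e) (Set.countable_range _) ?_ ?_
    · rintro _ ⟨l, rfl⟩
      rw [hνD]
      exact measure_lt_top m _
    · refine Set.eq_univ_of_forall fun x => ?_
      exact ⟨_, ⟨toDomain hD x, rfl⟩, toDomain_mem hD x⟩
  have hm1 : m Set.univ ≠ 0 := fun h => hm0 (Measure.measure_univ_eq_zero.mp h)
  have huniq := measure_eq_div_smul μ ν (s := D) (by rwa [hνD1])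
    (by rw [hνD1]; exact measure_ne_top m _)
  -- If `μ D` were infinite, `μ` would be an infinite multiple of `ν`, so that a compact set of positive
  -- measure would have infinite measure.
  by_contra htop
  rw [not_lt, top_le_iff] at htop
  rw [htop, hνD1, ENNReal.top_div_of_ne_top (measure_ne_top m _)] at huniq
  obtain ⟨K, hK, hK1⟩ := exists_compact_mem_nhds (1 : G)
  have hKpos : μ K ≠ 0 := (Measure.measure_pos_of_mem_nhds μ hK1).ne'
  have hKfin : μ K ≠ ⊤ := hK.measure_lt_top.ne
  rw [huniq, Measure.smul_apply, smul_eq_mul] at hKpos hKfin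
  exact hKfin (ENNReal.top_mul (right_ne_zero_of_mul hKpos))

/-- A fundamental domain contains a relatively compact piece of positive measure. -/
lemma exists_relativelyCompact_subset (hΛ : IsLattice Λ) (hD : IsBorelFundamentalDomain Λ D)
    (μ : Measure G) [μ.IsHaarMeasure] :
    ∃ E K : Set G, MeasurableSet E ∧ E ⊆ D ∧ E ⊆ K ∧ IsCompact K ∧ μ E ≠ 0 := by
  by_contra! h
  refine measure_fundamentalDomain_ne_zero hΛ hD μ ?_
  have hcov : D = ⋃ n, D ∩ compactCovering G n := by
    rw [← Set.inter_iUnion, iUnion_compactCovering, Set.inter_univ]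
  rw [hcov, measure_iUnion_null_iff]
  intro n
  exact h _ _ (hD.measurableSet.inter (isCompact_compactCovering G n).isClosed.measurableSet)
    Set.inter_subset_left Set.inter_subset_right (isCompact_compactCovering G n)

variable {w : Λ → ℝ≥0∞}

lemma measurable_weight_cocycle (hΛ : IsLattice Λ) (hD : IsBorelFundamentalDomain Λ D)
    (w : Λ → ℝ≥0∞) : Measurable fun z : G × G => w (cocycle hD z.1 z.2) := by
  have := hΛ.countable
  have h1 : Measurable fun z : G × G => cocycle hD z.1 z.2 :=
    (measurable_toDomain hΛ hD).comp (measurable_fst.inv.mul measurable_snd)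
  exact (measurable_of_countable w).comp h1

/-- If the integral over the fundamental domain of a quasi-subadditive weight of the lattice cocycle
is finite for every group element, then it is bounded on compact sets. By Steinhaus' theorem it is
bounded near the identity. -/
lemma exists_lintegral_cocycle_le (hΛ : IsLattice Λ) (hD : IsBorelFundamentalDomain Λ D)
    (μ : Measure G) [μ.IsHaarMeasure] {c : ℝ≥0∞} (hc : c ≠ ⊤)
    (hw : ∀ a b, w (a * b) ≤ c * (w a + w b))
    (hfin : ∀ g : G, ∫⁻ x in D, w (cocycle hD g x) ∂μ < ⊤) {K : Set G} (hK : IsCompact K) :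
    ∃ B : ℝ≥0∞, B ≠ ⊤ ∧ ∀ g ∈ K, ∫⁻ x in D, w (cocycle hD g x) ∂μ ≤ B := by
  let L : G → ℝ≥0∞ := fun g => ∫⁻ x in D, w (cocycle hD g x) ∂μ
  have hLm : Measurable L := (measurable_weight_cocycle hΛ hD w).lintegral_prod_right'
  have hmeas : ∀ g, Measurable fun x => w (cocycle hD g x) := fun g =>
    (measurable_weight_cocycle hΛ hD w).comp measurable_prodMk_left
  -- The cocycle identity makes `L` quasi-subadditive.
  have hLmul : ∀ g h, L (g * h) ≤ c * (L g + L h) := by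
    intro g h
    have hmp := measurePreserving_domainAction hΛ hD μ g
    calc L (g * h) ≤ ∫⁻ x in D, c * (w (cocycle hD g x) + w (cocycle hD h (domainAction hD g x))) ∂μ :=
          lintegral_mono fun x => by rw [cocycle_mul]; exact hw _ _
      _ = c * (L g + ∫⁻ x in D, w (cocycle hD h (domainAction hD g x)) ∂μ) := by
          rw [lintegral_const_mul' _ _ hc, lintegral_add_left (hmeas g)]
      _ = c * (L g + L h) := by
          rw [hmp.lintegral_comp (hmeas h)]
  -- Some sublevel set of `L(g) + L(g⁻¹)` has positive measure.
  obtain ⟨n, hn⟩ : ∃ n : ℕ, μ {g | L g + L g⁻¹ ≤ n} ≠ 0 := by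
    by_contra! h
    have hcov : (Set.univ : Set G) = ⋃ n : ℕ, {g | L g + L g⁻¹ ≤ n} := by
      refine (Set.eq_univ_of_forall fun g => ?_).symm
      obtain ⟨n, hn⟩ := ENNReal.exists_nat_gt (ENNReal.add_lt_top.mpr ⟨hfin g, hfin g⁻¹⟩).ne
      exact Set.mem_iUnion.mpr ⟨n, hn.le⟩
    refine NeZero.ne μ (Measure.measure_univ_eq_zero.mp ?_)
    rw [hcov, measure_iUnion_null_iff]
    exact h
  have hAm : MeasurableSet {g | L g + L g⁻¹ ≤ n} :=
    measurableSet_le (hLm.add (hLm.comp measurable_inv)) measurable_const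
  have hnhds := Measure.div_mem_nhds_one_of_haar_pos μ _ hAm (pos_iff_ne_zero.mpr hn)
  have hbd : ∀ v ∈ ({g | L g + L g⁻¹ ≤ n} / {g | L g + L g⁻¹ ≤ n} : Set G),
      L v ≤ c * (n + n) := by
    rintro _ ⟨a, ha, b, hb, rfl⟩
    simp only [div_eq_mul_inv]
    exact (hLmul a b⁻¹).trans (mul_le_mul' le_rfl
      (add_le_add (le_self_add.trans ha) (le_add_self.trans hb)))
  refine hK.induction_on (p := fun K => ∃ B : ℝ≥0∞, B ≠ ⊤ ∧ ∀ g ∈ K, L g ≤ B)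
    ⟨0, by simp, by simp⟩ ?_ ?_ ?_
  · rintro s t hst ⟨B, hB, h⟩
    exact ⟨B, hB, fun g hg => h g (hst hg)⟩
  · rintro s t ⟨B, hB, h⟩ ⟨B', hB', h'⟩
    refine ⟨max B B', by simp [hB, hB'], ?_⟩
    rintro g (hg | hg)
    · exact (h g hg).trans (le_max_left _ _)
    · exact (h' g hg).trans (le_max_right _ _)
  · intro g _
    refine ⟨_, mem_nhdsWithin_of_mem_nhds ((continuous_const_mul g⁻¹).continuousAt.preimage_mem_nhds
      (by simpa using hnhds)),
      c * (L g + c * (n + n)), ?_, ?_⟩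
    · exact ENNReal.mul_ne_top hc (ENNReal.add_ne_top.mpr
        ⟨(hfin g).ne, ENNReal.mul_ne_top hc (by simp)⟩)
    · intro h hh
      have h1 : h = g * (g⁻¹ * h) := by simp
      rw [h1]
      exact (hLmul _ _).trans (mul_le_mul' le_rfl (add_le_add le_rfl (hbd _ hh)))

/-- The left `Λ`-equivariant measurable retraction `G → Λ` attached to a fundamental domain. -/
def retraction (hD : IsBorelFundamentalDomain Λ D) (g : G) : Λ := toDomain hD g⁻¹

lemma retraction_mul (hD : IsBorelFundamentalDomain Λ D) (l : Λ) (g : G) :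
    retraction hD (l * g) = l * retraction hD g := by
  have := toDomain_mul hD g⁻¹ l⁻¹
  simpa [retraction, mul_inv_rev] using this

lemma retraction_inv_mul (hD : IsBorelFundamentalDomain Λ D) (x g : G) :
    retraction hD (x⁻¹ * g) = cocycle hD g x := by
  simp [retraction, cocycle]

lemma measurable_retraction (hΛ : IsLattice Λ) (hD : IsBorelFundamentalDomain Λ D) :
    Measurable (retraction hD) :=
  (measurable_toDomain hΛ hD).comp measurable_inv

/-- Weights of the retraction are locally integrable: by Tonelli, they are integrable on a suitable
left translate of any compact set. -/
lemma setLIntegral_retraction_lt_top (hΛ : IsLattice Λ) (hD : IsBorelFundamentalDomain Λ D)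
    (μ : Measure G) [μ.IsHaarMeasure]
    (hloc : ∀ K : Set G, IsCompact K →
      ∃ B : ℝ≥0∞, B ≠ ⊤ ∧ ∀ g ∈ K, ∫⁻ x in D, w (cocycle hD g x) ∂μ ≤ B)
    {K : Set G} (hK : IsCompact K) : ∫⁻ g in K, w (retraction hD g) ∂μ < ⊤ := by
  have := hΛ.countable
  obtain ⟨E, C, hE, hED, hEC, hC, hE0⟩ := exists_relativelyCompact_subset hΛ hD μ
  have hCK : IsCompact (C * K) := hC.mul hK
  obtain ⟨B, hB, hBL⟩ := hloc _ hCK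
  have h1 : ∫⁻ x in E, ∫⁻ h in C * K, w (cocycle hD h x) ∂μ ∂μ ≤ B * μ (C * K) := by
    rw [lintegral_lintegral_swap]
    · rw [← setLIntegral_const]
      refine setLIntegral_mono' hCK.measurableSet fun h hh => ?_
      exact (lintegral_mono_set hED).trans (hBL h hh)
    · exact ((measurable_weight_cocycle hΛ hD w).comp measurable_swap).aemeasurable
  have h2 : ∀ᵐ x ∂μ.restrict E, ∫⁻ h in C * K, w (cocycle hD h x) ∂μ < ⊤ := by
    refine ae_lt_top ?_ (h1.trans_lt (ENNReal.mul_lt_top hB.lt_top hCK.measure_lt_top)).ne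
    exact ((measurable_weight_cocycle hΛ hD w).comp measurable_swap).lintegral_prod_right'
  have : (ae (μ.restrict E)).NeBot := by
    rw [ae_neBot, Ne, Measure.restrict_eq_zero]
    exact hE0
  obtain ⟨x, hx, hxE⟩ := (h2.and (ae_restrict_mem hE)).exists
  refine lt_of_le_of_lt ?_ hx
  have hmp := measurePreserving_mul_left μ x
  have hwx : Measurable fun h => w (cocycle hD h x) :=
    (measurable_weight_cocycle hΛ hD w).comp measurable_prodMk_right
  rw [← hmp.setLIntegral_comp_preimage hCK.measurableSet hwx]
  have h3 : ∀ g, w (cocycle hD (x * g) x) = w (retraction hD g) := by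
    intro g
    rw [← retraction_inv_mul, inv_mul_cancel_left]
  simp only [h3]
  exact lintegral_mono_set fun g hg => Set.mul_mem_mul (hEC hxE) hg

end FundamentalDomain

/-! ### Kernels of equivariant cochains -/

section JointlyMeasurable

open Filter

/-- A continuous family of elements of `L^p` has a jointly measurable version: on a countable
measurable partition of the parameter space the family is approximated by locally constant ones, and
the approximations converge almost everywhere if they converge fast enough in `L^p`. -/
lemma exists_jointly_measurable {G V H : Type*} [MeasurableSpace G] [NormedAddCommGroup V]
    [CompleteSpace V] [TopologicalSpace.SeparableSpace V]
    [TopologicalSpace H] [SecondCountableTopology H] [Nonempty H]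
    [MeasurableSpace H] [OpensMeasurableSpace H] {ν : Measure G} {p : ℝ≥0∞}
    [Fact (1 ≤ p)] (c : C(H, Lp V p ν)) :
    ∃ F : H → G → V, StronglyMeasurable (Function.uncurry F) ∧ ∀ g, c g =ᵐ[ν] F g := by
  classical
  borelize V
  have : SecondCountableTopology V := UniformSpace.secondCountable_of_separable V
  let h := TopologicalSpace.denseSeq H
  have hex : ∀ (N : ℕ) (g : H), ∃ j, edist (c (h j)) (c g) < (2⁻¹ : ℝ≥0∞) ^ N := by
    intro N g
    have hop : IsOpen {g' : H | edist (c g') (c g) < (2⁻¹ : ℝ≥0∞) ^ N} :=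
      isOpen_lt (by fun_prop) continuous_const
    obtain ⟨j, hg'⟩ := (TopologicalSpace.denseRange_denseSeq H).exists_mem_open hop
      ⟨g, by
        change edist (c g) (c g) < _
        rw [edist_self]
        exact ENNReal.pow_pos (by simp) N⟩
    exact ⟨j, hg'⟩
  -- `j N g` is the first index in a dense sequence at which `c` is close to `c g`.
  let j : ℕ → H → ℕ := fun N g => Nat.find (hex N g)
  have hj : ∀ N, Measurable (j N) := fun N => measurable_find _ fun i =>
    (isOpen_lt (by fun_prop) continuous_const : IsOpen
      {g : H | edist (c (h i)) (c g) < (2⁻¹ : ℝ≥0∞) ^ N}).measurableSet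
  let s : ℕ → H × G → V := fun N z => c (h (j N z.1)) z.2
  have hs : ∀ N, StronglyMeasurable (s N) := by
    intro N
    refine Measurable.stronglyMeasurable ?_
    have h1 : Measurable fun z : ℕ × G => (c (h z.1) : G → V) z.2 :=
      measurable_from_prod_countable_right fun i => (Lp.stronglyMeasurable (c (h i))).measurable
    exact h1.comp (((hj N).comp measurable_fst).prodMk measurable_snd)
  have hclose : ∀ N g, edist (c (h (j N g))) (c g) < (2⁻¹ : ℝ≥0∞) ^ N := fun N g =>
    Nat.find_spec (hex N g)
  refine ⟨fun g x => limUnder atTop fun N => s N (g, x),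
    (StronglyMeasurable.limUnder (l := atTop) hs :), fun g => ?_⟩
  have h0 : Tendsto (fun N : ℕ => (2⁻¹ : ℝ≥0∞) ^ N) atTop (𝓝 0) :=
    ENNReal.tendsto_pow_atTop_nhds_zero_of_lt_one (by simp)
  have hlim : Tendsto (fun N => c (h (j N g))) atTop (𝓝 (c g)) :=
    tendsto_iff_edist_tendsto_0.2 <| tendsto_of_tendsto_of_tendsto_of_le_of_le
      tendsto_const_nhds h0 (fun _ => zero_le) fun N => (hclose N g).le
  -- The approximations converge almost everywhere since they are summably Cauchy in `L^p`; the limit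
  -- is identified along a subsequence.
  have hae : ∀ᵐ x ∂ν, ∃ l : V, Tendsto (fun N => (c (h (j N g)) : G → V) x) atTop (𝓝 l) := by
    refine Lp.ae_tendsto_of_cauchy_eLpNorm (p := p)
      (B := fun N => 2 * (2⁻¹ : ℝ≥0∞) ^ N) (fun N => Lp.aestronglyMeasurable _) Fact.out ?_ ?_
    · rw [ENNReal.tsum_mul_left, ENNReal.tsum_geometric]
      refine ENNReal.mul_ne_top (by simp) (ENNReal.inv_ne_top.2 ?_)
      simp
    · intro N n m hn hm
      have hpow : ∀ n, N ≤ n → edist (c (h (j n g))) (c g) < (2⁻¹ : ℝ≥0∞) ^ N := fun n hn =>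
        (hclose n g).trans_le (pow_le_pow_of_le_one zero_le (by simp) hn)
      have := edist_triangle_right (c (h (j n g))) (c (h (j m g))) (c g)
      rw [← Lp.edist_def, two_mul]
      exact this.trans_lt (ENNReal.add_lt_add (hpow n hn) (hpow m hm))
  obtain ⟨ns, hns, hsub⟩ := (tendstoInMeasure_of_tendsto_Lp hlim).exists_seq_tendsto_ae
  filter_upwards [hae, hsub] with x ⟨l, hl⟩ hx
  have h1 := tendsto_nhds_unique (hl.comp hns.tendsto_atTop) hx
  rw [← h1]
  exact hl.limUnder_eq.symm

end JointlyMeasurable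

section Kernels

set_option linter.unusedSectionVars false

variable {𝕜 G V : Type*} [RCLike 𝕜] [Group G] [MeasurableSpace G] [TopologicalSpace G]
  [IsTopologicalGroup G] [LocallyCompactSpace G] [SecondCountableTopology G] [T2Space G]
  [BorelSpace G] {Λ : Subgroup G} {D : Set G} [NormedAddCommGroup V] [NormedSpace 𝕜 V]
  {μ : Measure G} [μ.IsHaarMeasure] {p : ℝ≥0∞} [Fact (1 ≤ p)] {n : ℕ}

/-- A kernel of a cochain `c` with values in the induced representation: a function `Φ` on tuples
such that `c(g)(x) = Φ(x⁻¹ g)` for almost all `g` and almost all `x ∈ D`, and which is equivariant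
almost everywhere under the lattice. -/
structure IsKernel (μ : Measure G) (ρ : Λ →* (V →ₗᵢ[𝕜] V))
    (c : C(Fin n → G, Lp V p (μ.restrict D))) (Φ : (Fin n → G) → V) : Prop where
  stronglyMeasurable : StronglyMeasurable Φ
  coeFn_eq : ∀ᵐ g ∂(Measure.pi fun _ => μ), c g =ᵐ[μ.restrict D] fun x => Φ fun i => x⁻¹ * g i
  equivariant : ∀ l : Λ, ∀ᵐ g ∂(Measure.pi fun _ => μ), (Φ fun i => l * g i) = ρ l (Φ g)

lemma measurePreserving_mul_pi (μ : Measure G) [μ.IsHaarMeasure] (x : G) :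
    MeasurePreserving (fun (g : Fin n → G) i => x * g i) (Measure.pi fun _ => μ)
      (Measure.pi fun _ => μ) :=
  measurePreserving_mul_left (Measure.pi fun _ => μ) fun _ => x

lemma quasiMeasurePreserving_comp_succAbove (μ : Measure G) [μ.IsHaarMeasure] (i : Fin (n + 1)) :
    Measure.QuasiMeasurePreserving (fun (g : Fin (n + 1) → G) j => g (i.succAbove j))
      (Measure.pi fun _ => μ) (Measure.pi fun _ => μ) :=
  Measure.quasiMeasurePreserving_snd.comp
    (measurePreserving_piFinSuccAbove (fun _ => μ) i).quasiMeasurePreserving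

/-- Two functions representing the same cochain agree almost everywhere. -/
lemma ae_eq_of_coeFn_eq (hΛ : IsLattice Λ) (hD : IsBorelFundamentalDomain Λ D)
    {c : C(Fin n → G, Lp V p (μ.restrict D))}
    {Φ Φ' : (Fin n → G) → V} (hΦ : StronglyMeasurable Φ) (hΦ' : StronglyMeasurable Φ')
    (h : ∀ᵐ g ∂(Measure.pi fun _ => μ), c g =ᵐ[μ.restrict D] fun x => Φ fun i => x⁻¹ * g i)
    (h' : ∀ᵐ g ∂(Measure.pi fun _ => μ), c g =ᵐ[μ.restrict D] fun x => Φ' fun i => x⁻¹ * g i) :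
    Φ =ᵐ[Measure.pi fun _ => μ] Φ' := by
  have h1 : ∀ᵐ g ∂(Measure.pi fun _ : Fin n => μ), ∀ᵐ x ∂μ.restrict D,
      (Φ fun i => x⁻¹ * g i) = Φ' fun i => x⁻¹ * g i := by
    filter_upwards [h, h'] with g hg hg'
    exact hg.symm.trans hg'
  have hm : Measurable fun z : (Fin n → G) × G => fun i => z.2⁻¹ * z.1 i := by fun_prop
  rw [Measure.ae_ae_comm ((hΦ.comp_measurable hm).measurableSet_eq_fun
    (hΦ'.comp_measurable hm))] at h1
  have : (ae (μ.restrict D)).NeBot := by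
    rw [ae_neBot, Ne, Measure.restrict_eq_zero]
    exact measure_fundamentalDomain_ne_zero hΛ hD μ
  obtain ⟨x, hx⟩ := h1.exists
  have h2 := (measurePreserving_mul_pi μ x).quasiMeasurePreserving.ae hx
  simp only [inv_mul_cancel_left] at h2
  exact h2

variable {ρ : Λ →* (V →ₗᵢ[𝕜] V)} {c c' : C(Fin n → G, Lp V p (μ.restrict D))}
  {Φ Φ' : (Fin n → G) → V}

lemma IsKernel.ae_eq (hΛ : IsLattice Λ) (hD : IsBorelFundamentalDomain Λ D)
    (h : IsKernel μ ρ c Φ) (h' : IsKernel μ ρ c Φ') : Φ =ᵐ[Measure.pi fun _ => μ] Φ' :=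
  ae_eq_of_coeFn_eq hΛ hD h.stronglyMeasurable h'.stronglyMeasurable h.coeFn_eq h'.coeFn_eq

lemma IsKernel.add (h : IsKernel μ ρ c Φ) (h' : IsKernel μ ρ c' Φ') :
    IsKernel μ ρ (c + c') (Φ + Φ') where
  stronglyMeasurable := h.stronglyMeasurable.add h'.stronglyMeasurable
  coeFn_eq := by
    filter_upwards [h.coeFn_eq, h'.coeFn_eq] with g hg hg'
    exact (Lp.coeFn_add _ _).trans (hg.add hg')
  equivariant l := by
    filter_upwards [h.equivariant l, h'.equivariant l] with g hg hg'
    simp [hg, hg']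

lemma IsKernel.smul (r : 𝕜) (h : IsKernel μ ρ c Φ) :
    IsKernel μ ρ (r • c) (r • Φ) where
  stronglyMeasurable := h.stronglyMeasurable.const_smul r
  coeFn_eq := by
    filter_upwards [h.coeFn_eq] with g hg
    refine (Lp.coeFn_smul r _).trans ?_
    filter_upwards [hg] with x hx
    simp [hx]
  equivariant l := by
    filter_upwards [h.equivariant l] with g hg
    simp [hg]

lemma IsKernel.map_coboundary {c : C(Fin (n + 1) → G, Lp V p (μ.restrict D))}
    {Φ : (Fin (n + 1) → G) → V}
    (h : IsKernel μ ρ c Φ) :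
    IsKernel μ ρ (coboundary 𝕜 G (Lp V p (μ.restrict D)) n c) (tupleCoboundary 𝕜 Φ) where
  stronglyMeasurable := by
    refine Finset.stronglyMeasurable_fun_sum _ fun i _ => StronglyMeasurable.const_smul ?_ _
    exact h.stronglyMeasurable.comp_measurable (by fun_prop)
  coeFn_eq := by
    have h1 := ae_all_iff.2 fun i => (quasiMeasurePreserving_comp_succAbove μ i).ae h.coeFn_eq
    filter_upwards [h1] with g hg
    have h2 : coboundary 𝕜 G (Lp V p (μ.restrict D)) n c g =
      ∑ i : Fin (n + 2), (-1 : 𝕜) ^ (i : ℕ) • c (fun j => g (i.succAbove j)) := rfl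
    rw [h2]
    refine (Lp.coeFn_finsetSum _ _).trans ?_
    have h3 := ae_all_iff.2 fun i : Fin (n + 2) =>
      Lp.coeFn_smul ((-1 : 𝕜) ^ (i : ℕ)) (c (fun j => g (i.succAbove j)))
    filter_upwards [h3, ae_all_iff.2 hg] with x hx hx'
    simp only [Finset.sum_apply, tupleCoboundary]
    refine Finset.sum_congr rfl fun i _ => ?_
    rw [hx i, Pi.smul_apply, hx' i]
  equivariant l := by
    have h1 := ae_all_iff.2 fun i =>
      (quasiMeasurePreserving_comp_succAbove μ i).ae (h.equivariant l)
    filter_upwards [h1] with g hg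
    simp only [tupleCoboundary, map_sum, map_smul]
    exact Finset.sum_congr rfl fun i _ => by rw [hg i]

/-- Every continuous equivariant cochain with values in the induced representation has a kernel.
By equivariance, the value `c(g)(x)` depends on `x⁻¹ g` only, up to null sets; the kernel is read off
at a generic point. -/
lemma exists_isKernel [CompleteSpace V] [TopologicalSpace.SeparableSpace V]
    (hΛ : IsLattice Λ) (hD : IsBorelFundamentalDomain Λ D) (ρ : Λ →* (V →ₗᵢ[𝕜] V))
    (c : C(Fin n → G, Lp V p (μ.restrict D)))
    (hc : ∀ (h : G) (g : Fin n → G), (c fun i => h * g i) = inducedRep hΛ hD μ ρ p h (c g)) :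
    ∃ Φ : (Fin n → G) → V, IsKernel μ ρ c Φ := by
  have := hΛ.countable
  have := hΛ.discrete
  obtain ⟨F, hF, hcF⟩ := exists_jointly_measurable c
  let τ : G → Λ := toDomain hD
  have hτ : Measurable τ := measurable_toDomain hΛ hD
  -- The equivariant extension of `F` from `D` to `G`.
  let E : (Fin n → G) → G → V := fun g y => ρ (τ y) (F g (y * τ y))
  have hE : StronglyMeasurable (Function.uncurry E) := by
    have h3 : Continuous fun z : Λ × V => ρ z.1 z.2 :=
      continuous_prod_of_discrete_left.mpr fun l => (ρ l).continuous
    have h4 : Measurable fun z : (Fin n → G) × G => (z.1, z.2 * (τ z.2 : G)) :=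
      measurable_fst.prodMk (measurable_snd.mul (measurable_subtype_coe.comp (hτ.comp measurable_snd)))
    exact h3.comp_stronglyMeasurable ((hτ.comp measurable_snd).stronglyMeasurable.prodMk
      (hF.comp_measurable h4))
  have hEl : ∀ g y (l : Λ), ρ l (E g (y * l)) = E g y := by
    intro g y l
    have hρ : ∀ (a b : Λ) (v : V), ρ a (ρ b v) = ρ (a * b) v := fun a b v => by
      rw [map_mul]; rfl
    simp only [E, τ, toDomain_mul, hρ]
    simp [mul_assoc]
  -- The equivariance of `c` in terms of the extension.
  have h1 : ∀ (h : G) (g : Fin n → G), ∀ᵐ x ∂μ.restrict D,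
      F g x = E (fun i => h⁻¹ * g i) (h⁻¹ * x) := by
    intro h g
    have h2 := hc h fun i => h⁻¹ * g i
    simp only [mul_inv_cancel_left] at h2
    have h3 : c g =ᵐ[μ.restrict D] fun x =>
        ρ (cocycle hD h x) (c (fun i => h⁻¹ * g i) (domainAction hD h x)) := by
      rw [h2]
      exact MemLp.coeFn_toLp (memLp_twist hΛ hD μ ρ p h (Lp.memLp _))
    have hq := (measurePreserving_domainAction hΛ hD μ h).quasiMeasurePreserving
    filter_upwards [h3, hcF g, hq.ae (hcF fun i => h⁻¹ * g i)] with x hx hx' hx''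
    rw [← hx', hx, hx'']
    rfl
  have hm1 : MeasurableSet {z : G × (Fin n → G) × G |
      F z.2.1 z.2.2 = E (fun i => z.1⁻¹ * z.2.1 i) (z.1⁻¹ * z.2.2)} := by
    refine StronglyMeasurable.measurableSet_eq_fun
      (hF.comp_measurable measurable_snd) (hE.comp_measurable (g := fun z : G × (Fin n → G) × G =>
        (fun i => z.1⁻¹ * z.2.1 i, z.1⁻¹ * z.2.2)) (by fun_prop))
  have h2 : ∀ᵐ g ∂(Measure.pi fun _ : Fin n => μ), ∀ᵐ x ∂μ.restrict D, ∀ᵐ h ∂μ,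
      F g x = E (fun i => h⁻¹ * g i) (h⁻¹ * x) := by
    have h3 : ∀ᵐ h ∂μ, ∀ᵐ z ∂(Measure.pi fun _ : Fin n => μ).prod (μ.restrict D),
        F z.1 z.2 = E (fun i => h⁻¹ * z.1 i) (h⁻¹ * z.2) := by
      refine Filter.Eventually.of_forall fun h => ?_
      rw [Measure.ae_prod_iff_ae_ae]
      · exact Filter.Eventually.of_forall (h1 h)
      · exact hm1.preimage (f := fun z => (h, z)) (by fun_prop)
    rw [Measure.ae_ae_comm hm1] at h3
    exact Measure.ae_ae_of_ae_prod h3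
  -- Substitute `y = h⁻¹ * x`.
  have h4 : ∀ᵐ g ∂(Measure.pi fun _ : Fin n => μ), ∀ᵐ x ∂μ.restrict D, ∀ᵐ y ∂μ,
      F g x = E (fun i => y * x⁻¹ * g i) y := by
    filter_upwards [h2] with g hg
    filter_upwards [hg] with x hx
    simpa [div_eq_mul_inv, mul_assoc] using (quasiMeasurePreserving_div_left μ x).ae hx
  have hm2 : MeasurableSet {z : ((Fin n → G) × G) × G |
      F z.1.1 z.1.2 = E (fun i => z.2 * z.1.2⁻¹ * z.1.1 i) z.2} := by
    refine StronglyMeasurable.measurableSet_eq_fun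
      (hF.comp_measurable measurable_fst) (hE.comp_measurable (g := fun z : ((Fin n → G) × G) × G =>
        (fun i => z.2 * z.1.2⁻¹ * z.1.1 i, z.2)) (by fun_prop))
  have h5 : ∀ᵐ y ∂μ, ∀ᵐ g ∂(Measure.pi fun _ : Fin n => μ), ∀ᵐ x ∂μ.restrict D,
      F g x = E (fun i => y * x⁻¹ * g i) y := by
    have h6 : ∀ᵐ z ∂((Measure.pi fun _ : Fin n => μ).prod (μ.restrict D)).prod μ,
        F z.1.1 z.1.2 = E (fun i => z.2 * z.1.2⁻¹ * z.1.1 i) z.2 := by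
      rw [Measure.ae_prod_iff_ae_ae hm2, Measure.ae_prod_iff_ae_ae]
      · exact h4
      · exact measurable_measure_prodMk_left hm2.compl (measurableSet_singleton 0)
    have h7 := (Measure.ae_ae_comm (p := fun (z : (Fin n → G) × G) y =>
      F z.1 z.2 = E (fun i => y * z.2⁻¹ * z.1 i) y) hm2).1 ((Measure.ae_prod_iff_ae_ae hm2).1 h6)
    filter_upwards [h7] with y hy
    exact Measure.ae_ae_of_ae_prod hy
  have h8 : ∀ᵐ y ∂μ, ∀ l : Λ, ∀ᵐ g ∂(Measure.pi fun _ : Fin n => μ), ∀ᵐ x ∂μ.restrict D,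
      F g x = E (fun i => y * l * x⁻¹ * g i) (y * l) :=
    ae_all_iff.2 fun l => (quasiMeasurePreserving_mul_right μ (l : G)).ae h5
  -- By Fubini a generic `y` is good for almost all `g` and `x`; all its translates `y * l` can be
  -- taken generic too, and comparing `y` with `y * l` gives the equivariance of the kernel.
  obtain ⟨y, hy⟩ := h8.exists
  have hmeas : ∀ l : Λ, StronglyMeasurable fun g : Fin n → G => E (fun i => y * l * g i) (y * l) :=
    fun l => hE.comp_measurable (g := fun g : Fin n → G => (fun i => y * l * g i, y * (l : G)))
      (by fun_prop)
  have heq : ∀ l : Λ, ∀ᵐ g ∂(Measure.pi fun _ => μ), c g =ᵐ[μ.restrict D] fun x =>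
      E (fun i => y * l * (x⁻¹ * g i)) (y * l) := by
    intro l
    filter_upwards [hy l] with g hg
    filter_upwards [hcF g, hg] with x hx hx'
    rw [hx, hx']
    simp only [mul_assoc]
  refine ⟨fun g => E (fun i => y * (1 : Λ) * g i) (y * (1 : Λ)), hmeas 1, heq 1, fun l => ?_⟩
  filter_upwards [ae_eq_of_coeFn_eq hΛ hD (hmeas 1) (hmeas l) (heq 1) (heq l)] with g hg
  rw [hg, hEl]
  simp [mul_assoc]

end Kernels

/-! ### Averaging over translates -/

section Averaging

set_option linter.unusedSectionVars false

/-- A product of finitely many measures with the same density has the product density. -/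
lemma pi_withDensity_ofReal {X : Type*} [MeasurableSpace X] {ν : Measure X} [SigmaFinite ν]
    {θ : X → ℝ} (hθ0 : ∀ x, 0 ≤ θ x) (hθi : Integrable θ ν) (n : ℕ) :
    (Measure.pi fun _ : Fin n => ν.withDensity fun x => ENNReal.ofReal (θ x)) =
      (Measure.pi fun _ => ν).withDensity fun x => ENNReal.ofReal (∏ i, θ (x i)) := by
  have : IsFiniteMeasure (ν.withDensity fun x => ENNReal.ofReal (θ x)) := by
    refine isFiniteMeasure_withDensity_ofReal ?_
    exact hθi.2
  refine Measure.pi_eq fun s hs => ?_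
  have hi : ∀ i, Integrable θ (ν.restrict (s i)) := fun i => hθi.restrict
  rw [withDensity_apply _ (MeasurableSet.univ_pi hs), Measure.restrict_pi_pi,
    ← ofReal_integral_eq_lintegral_ofReal (Integrable.fintype_prod hi)
      (Filter.Eventually.of_forall fun x => Finset.prod_nonneg fun i _ => hθ0 _),
    integral_fintype_prod_eq_prod, ENNReal.ofReal_prod_of_nonneg
      fun i _ => integral_nonneg fun x => hθ0 x]
  refine Finset.prod_congr rfl fun i _ => ?_
  rw [withDensity_apply _ (hs i), ofReal_integral_eq_lintegral_ofReal (hi i)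
    (Filter.Eventually.of_forall hθ0)]

lemma measurePreserving_comp_succAbove {X : Type*} [MeasurableSpace X] (m : Measure X)
    [IsProbabilityMeasure m] {n : ℕ} (i : Fin (n + 1)) :
    MeasurePreserving (fun (x : Fin (n + 1) → X) j => x (i.succAbove j))
      (Measure.pi fun _ => m) (Measure.pi fun _ => m) :=
  (measurePreserving_snd (μ := m)).comp (measurePreserving_piFinSuccAbove (fun _ => m) i)

/-- Integration in independent variables attached to the vertices commutes with the homogeneous
coboundary, because the omitted variable integrates to `1`. -/
lemma integral_sum_comp_succAbove {𝕜 X Y V : Type*} [RCLike 𝕜] [NormedAddCommGroup V]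
    [NormedSpace 𝕜 V] [NormedSpace ℝ V] [SMulCommClass ℝ 𝕜 V] [MeasurableSpace X] (m : Measure X)
    [IsProbabilityMeasure m] {n : ℕ} {F : (Fin n → Y) → (Fin n → X) → V}
    (hF : ∀ y, Integrable (F y) (Measure.pi fun _ => m)) (y : Fin (n + 1) → Y) :
    ∫ x, ∑ i : Fin (n + 1), (-1 : 𝕜) ^ (i : ℕ) •
        F (fun j => y (i.succAbove j)) (fun j => x (i.succAbove j)) ∂(Measure.pi fun _ => m) =
      tupleCoboundary 𝕜 (fun y => ∫ x, F y x ∂(Measure.pi fun _ => m)) y := by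
  have hmp := measurePreserving_comp_succAbove m (n := n)
  have hs : ∀ i : Fin (n + 1), Integrable (fun x : Fin (n + 1) → X => (-1 : 𝕜) ^ (i : ℕ) •
      F (fun j => y (i.succAbove j)) fun j => x (i.succAbove j)) (Measure.pi fun _ => m) :=
    fun i => ((hmp i).integrable_comp_of_integrable (hF fun j => y (i.succAbove j))).smul _
  rw [integral_finsetSum _ fun i _ => hs i]
  refine Finset.sum_congr rfl fun i _ => ?_
  rw [integral_smul]
  congr 1
  have h1 := integral_map (hmp i).measurable.aemeasurable
    (f := F fun j => y (i.succAbove j)) (by rw [(hmp i).map_eq]; exact (hF _).1)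
  rw [(hmp i).map_eq] at h1
  exact h1.symm

/-- A continuous compactly supported probability density. -/
structure IsBump {G : Type*} [TopologicalSpace G] [MeasurableSpace G] (μ : Measure G)
    (θ : G → ℝ) : Prop where
  continuous : Continuous θ
  hasCompactSupport : HasCompactSupport θ
  nonneg : ∀ x, 0 ≤ θ x
  integral_eq_one : ∫ x, θ x ∂μ = 1

/-- The probability measure with density `θ`. -/
def bumpMeasure {G : Type*} [MeasurableSpace G] (μ : Measure G) (θ : G → ℝ) : Measure G :=
  μ.withDensity fun x => ENNReal.ofReal (θ x)

/-- The average `∫ Φ(g₀u₀, …, gₙuₙ) dm(u₀) ⋯ dm(uₙ)` of a function on tuples. -/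
def average {G V : Type*} [Group G] [MeasurableSpace G] [NormedAddCommGroup V] [NormedSpace ℝ V]
    (m : Measure G) {n : ℕ} (Φ : (Fin n → G) → V) (g : Fin n → G) : V :=
  ∫ u, Φ (fun i => g i * u i) ∂(Measure.pi fun _ => m)

variable {𝕜 G V : Type*} [RCLike 𝕜] [Group G] [MeasurableSpace G] [TopologicalSpace G]
  [IsTopologicalGroup G] [LocallyCompactSpace G] [SecondCountableTopology G] [T2Space G]
  [BorelSpace G] {Λ : Subgroup G} {D : Set G} [NormedAddCommGroup V] [NormedSpace 𝕜 V]
  [NormedSpace ℝ V] {μ : Measure G} [μ.IsHaarMeasure] {p : ℝ≥0∞} [Fact (1 ≤ p)] {n : ℕ}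
  {θ : G → ℝ}

lemma exists_isBump (μ : Measure G) [μ.IsHaarMeasure] : ∃ θ : G → ℝ, IsBump μ θ := by
  obtain ⟨f, hf, hf0, hf1⟩ := exists_continuous_nonneg_pos (1 : G)
  have hpos : 0 < ∫ x, f x ∂μ :=
    f.continuous.integral_pos_of_hasCompactSupport_nonneg_nonzero hf hf0 hf1
  refine ⟨fun x => (∫ x, f x ∂μ)⁻¹ * f x, by fun_prop, hf.mul_left,
    fun x => mul_nonneg (inv_nonneg.2 hpos.le) (hf0 x), ?_⟩
  rw [integral_const_mul, inv_mul_cancel₀ hpos.ne']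

lemma IsBump.integrable (hθ : IsBump μ θ) : Integrable θ μ :=
  hθ.continuous.integrable_of_hasCompactSupport hθ.hasCompactSupport

lemma IsBump.isProbabilityMeasure (hθ : IsBump μ θ) : IsProbabilityMeasure (bumpMeasure μ θ) := by
  refine ⟨?_⟩
  rw [bumpMeasure, withDensity_apply _ MeasurableSet.univ, Measure.restrict_univ,
    ← ofReal_integral_eq_lintegral_ofReal hθ.integrable (Filter.Eventually.of_forall hθ.nonneg),
    hθ.integral_eq_one, ENNReal.ofReal_one]

lemma IsBump.pi_bumpMeasure (hθ : IsBump μ θ) (n : ℕ) :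
    (Measure.pi fun _ : Fin n => bumpMeasure μ θ) =
      (Measure.pi fun _ => μ).withDensity fun x => ENNReal.ofReal (∏ i, θ (x i)) :=
  pi_withDensity_ofReal hθ.nonneg hθ.integrable n

lemma IsBump.pi_absolutelyContinuous (hθ : IsBump μ θ) (n : ℕ) :
    (Measure.pi fun _ : Fin n => bumpMeasure μ θ) ≪ Measure.pi fun _ => μ := by
  rw [hθ.pi_bumpMeasure]
  exact withDensity_absolutelyContinuous _ _

lemma IsBump.continuous_prod (hθ : IsBump μ θ) (n : ℕ) :
    Continuous fun x : Fin n → G => ∏ i, θ (x i) :=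
  continuous_finsetProd _ fun i _ => hθ.continuous.comp (continuous_apply i)

lemma IsBump.lintegral_average (hθ : IsBump μ θ) {f : (Fin n → G) → ℝ≥0∞} (hf : Measurable f)
    (g : Fin n → G) : ∫⁻ u, f (fun i => g i * u i) ∂(Measure.pi fun _ => bumpMeasure μ θ) =
      ∫⁻ u, ENNReal.ofReal (∏ i, θ ((g i)⁻¹ * u i)) * f u ∂(Measure.pi fun _ => μ) := by
  have hm : Measurable fun u : Fin n → G => ENNReal.ofReal (∏ i, θ (u i)) :=
    (hθ.continuous_prod n).measurable.ennreal_ofReal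
  have hf' : Measurable fun u : Fin n → G => f fun i => g i * u i :=
    hf.comp (f := fun u : Fin n → G => fun i => g i * u i) (by fun_prop)
  rw [hθ.pi_bumpMeasure, lintegral_withDensity_eq_lintegral_mul _ hm hf',
    ← lintegral_mul_left_eq_self (μ := Measure.pi fun _ => μ)
      (fun u => ENNReal.ofReal (∏ i, θ ((g i)⁻¹ * u i)) * f u) g]
  simp [Pi.mul_def]

lemma IsBump.average_eq (hθ : IsBump μ θ) (Φ : (Fin n → G) → V) (g : Fin n → G) :
    average (bumpMeasure μ θ) Φ g =
      ∫ u, (∏ i, θ ((g i)⁻¹ * u i)) • Φ u ∂(Measure.pi fun _ => μ) := by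
  have hm : Measurable fun u : Fin n → G => ENNReal.ofReal (∏ i, θ (u i)) :=
    (hθ.continuous_prod n).measurable.ennreal_ofReal
  rw [average, hθ.pi_bumpMeasure, integral_withDensity_eq_integral_toReal_smul hm (by simp),
    ← integral_mul_left_eq_self (μ := Measure.pi fun _ => μ)
      (fun u => (∏ i, θ ((g i)⁻¹ * u i)) • Φ u) g]
  refine integral_congr_ae (Filter.Eventually.of_forall fun u => ?_)
  simp [Finset.prod_nonneg fun i _ => hθ.nonneg _]
  rfl

lemma IsBump.quasiMeasurePreserving_mul (hθ : IsBump μ θ) (g : Fin n → G) :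
    Measure.QuasiMeasurePreserving (fun (u : Fin n → G) i => g i * u i)
      (Measure.pi fun _ => bumpMeasure μ θ) (Measure.pi fun _ => μ) :=
  (measurePreserving_mul_left (Measure.pi fun _ => μ) g).quasiMeasurePreserving.mono_left
    (hθ.pi_absolutelyContinuous n)

lemma IsBump.average_congr (hθ : IsBump μ θ) {Φ Φ' : (Fin n → G) → V}
    (h : Φ =ᵐ[Measure.pi fun _ => μ] Φ') (g : Fin n → G) :
    average (bumpMeasure μ θ) Φ g = average (bumpMeasure μ θ) Φ' g :=
  integral_congr_ae ((hθ.quasiMeasurePreserving_mul g).ae h)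

variable {ρ : Λ →* (V →ₗᵢ[𝕜] V)} {c : C(Fin n → G, Lp V p (μ.restrict D))}
  {Φ : (Fin n → G) → V}

lemma IsKernel.average_equivariant [CompleteSpace V] (h : IsKernel μ ρ c Φ) (hθ : IsBump μ θ)
    (l : Λ) (g : Fin n → G) :
    (average (bumpMeasure μ θ) Φ fun i => l * g i) = ρ l (average (bumpMeasure μ θ) Φ g) := by
  rw [average, average, ← (ρ l).integral_comp_comm]
  refine integral_congr_ae ?_
  filter_upwards [(hθ.quasiMeasurePreserving_mul g).ae (h.equivariant l)] with u hu
  simpa [mul_assoc] using hu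

lemma IsBump.average_tupleCoboundary [SMulCommClass ℝ 𝕜 V] (hθ : IsBump μ θ)
    {Φ : (Fin n → G) → V}
    (hi : ∀ g : Fin n → G, Integrable (fun u : Fin n → G => Φ fun i => g i * u i)
      (Measure.pi fun _ => bumpMeasure μ θ)) :
    average (bumpMeasure μ θ) (tupleCoboundary 𝕜 Φ) =
      tupleCoboundary 𝕜 (average (bumpMeasure μ θ) Φ) := by
  have := hθ.isProbabilityMeasure
  ext g
  exact integral_sum_comp_succAbove (𝕜 := 𝕜) (bumpMeasure μ θ)
    (F := fun g u => Φ fun i => g i * u i) hi g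

/-- The averages of a kernel are controlled by the cochain on a compact set: the average can be moved
to any base point `x ∈ D`, and is then bounded by the mean over `x` in a relatively compact piece of
the fundamental domain. -/
lemma IsBump.exists_lintegral_kernel_le (hθ : IsBump μ θ) (hΛ : IsLattice Λ)
    (hD : IsBorelFundamentalDomain Λ D) (ρ : Λ →* (V →ₗᵢ[𝕜] V)) (p : ℝ≥0∞) [Fact (1 ≤ p)]
    (g : Fin n → G) :
    ∃ (Q : Set (Fin n → G)) (A : ℝ≥0∞), IsCompact Q ∧ A ≠ ⊤ ∧
      ∀ (c : C(Fin n → G, Lp V p (μ.restrict D))) (Φ : (Fin n → G) → V), IsKernel μ ρ c Φ →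
      ∀ B : ℝ≥0∞, (∀ q ∈ Q, ‖c q‖ₑ ≤ B) →
        ∫⁻ u, ‖Φ fun i => g i * u i‖ₑ ∂(Measure.pi fun _ => bumpMeasure μ θ) ≤ A * B := by
  obtain ⟨E, K, hE, hED, hEK, hK, hE0⟩ := exists_relativelyCompact_subset hΛ hD μ
  have hEt : μ E ≠ ⊤ := ((measure_mono hEK).trans_lt hK.measure_lt_top).ne
  let K₀ := tsupport θ
  have hK₀ : IsCompact K₀ := hθ.hasCompactSupport
  let Q : Set (Fin n → G) :=
    (fun z : G × (Fin n → G) => fun i => z.1 * g i * z.2 i) '' (K ×ˢ Set.univ.pi fun _ => K₀)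
  have hQ : IsCompact Q := (hK.prod (isCompact_univ_pi fun _ => hK₀)).image (by fun_prop)
  obtain ⟨C, hC⟩ := hθ.continuous.bounded_above_of_compact_support hθ.hasCompactSupport
  have hCθ : ∀ u : Fin n → G, ENNReal.ofReal (∏ i, θ (u i)) ≤ ENNReal.ofReal (C ^ n) := by
    intro u
    refine ENNReal.ofReal_le_ofReal ?_
    calc ∏ i, θ (u i) ≤ ∏ _i : Fin n, C := Finset.prod_le_prod (fun i _ => hθ.nonneg _)
          fun i _ => (le_abs_self _).trans (hC (u i))
      _ = C ^ n := by simp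
  let a : ℝ≥0∞ := μ E ^ (1 / (1 : ℝ≥0∞).toReal - 1 / p.toReal)
  have ha : a ≠ ⊤ := by
    refine ENNReal.rpow_ne_top_of_ne_zero hE0 hEt
  refine ⟨Q, (μ E)⁻¹ * (ENNReal.ofReal (C ^ n) * ((Measure.pi fun _ => μ) Q * a)), hQ, ?_, ?_⟩
  · exact ENNReal.mul_ne_top (ENNReal.inv_ne_top.2 hE0) (ENNReal.mul_ne_top ENNReal.ofReal_ne_top
      (ENNReal.mul_ne_top hQ.measure_lt_top.ne ha))
  intro c Φ h B hB
  have hΦm : Measurable fun u => ‖Φ u‖ₑ := h.stronglyMeasurable.enorm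
  set I := ∫⁻ u, ‖Φ fun i => g i * u i‖ₑ ∂(Measure.pi fun _ => bumpMeasure μ θ) with hI
  have h1 : ∀ x ∈ E, I ≤ ENNReal.ofReal (C ^ n) *
      ∫⁻ q in Q, ‖Φ fun i => x⁻¹ * q i‖ₑ ∂(Measure.pi fun _ => μ) := by
    intro x hx
    have hm1 : Measurable fun u : Fin n → G => ‖Φ fun i => x⁻¹ * u i‖ₑ :=
      hΦm.comp (f := fun u : Fin n → G => fun i => x⁻¹ * u i) (by fun_prop)
    have h2 : I = ∫⁻ u, (fun v : Fin n → G => ‖Φ fun i => x⁻¹ * v i‖ₑ) (fun i => (x * g i) * u i)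
        ∂(Measure.pi fun _ => bumpMeasure μ θ) := by simp [hI, mul_assoc]
    rw [h2, hθ.lintegral_average hm1, ← lintegral_const_mul _ hm1, ← lintegral_indicator
      hQ.measurableSet]
    refine lintegral_mono fun u => ?_
    by_cases hu : u ∈ Q
    · rw [Set.indicator_of_mem hu]
      exact mul_le_mul' (hCθ fun i => (x * g i)⁻¹ * u i) le_rfl
    · rw [Set.indicator_of_notMem hu]
      obtain ⟨i, hi⟩ : ∃ i, θ ((x * g i)⁻¹ * u i) = 0 := by
        by_contra! hne
        refine hu ⟨(x, fun i => (x * g i)⁻¹ * u i), ⟨hEK hx, fun i _ => ?_⟩, ?_⟩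
        · exact subset_tsupport _ (hne i)
        · ext i
          simp [mul_assoc]
      rw [Finset.prod_eq_zero (Finset.mem_univ i) hi]
      simp
  have hm2 : Measurable fun z : (Fin n → G) × G => ‖Φ fun i => z.2⁻¹ * z.1 i‖ₑ :=
    hΦm.comp (f := fun z : (Fin n → G) × G => fun i => z.2⁻¹ * z.1 i) (by fun_prop)
  have h2 : I * μ E ≤ ENNReal.ofReal (C ^ n) * ((Measure.pi fun _ => μ) Q * a) * B := by
    calc I * μ E = ∫⁻ _ in E, I ∂μ := (setLIntegral_const _ _).symm
      _ ≤ ∫⁻ x in E, ENNReal.ofReal (C ^ n) *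
          ∫⁻ q in Q, ‖Φ fun i => x⁻¹ * q i‖ₑ ∂(Measure.pi fun _ => μ) ∂μ :=
        setLIntegral_mono' hE h1
      _ = ENNReal.ofReal (C ^ n) *
          ∫⁻ q in Q, ∫⁻ x in E, ‖Φ fun i => x⁻¹ * q i‖ₑ ∂μ ∂(Measure.pi fun _ => μ) := by
        rw [lintegral_const_mul' _ _ ENNReal.ofReal_ne_top, lintegral_lintegral_swap]
        exact (hm2.comp measurable_swap).aemeasurable
      _ ≤ ENNReal.ofReal (C ^ n) * ∫⁻ _ in Q, B * a ∂(Measure.pi fun _ => μ) := by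
        refine mul_le_mul' le_rfl (lintegral_mono_ae ?_)
        filter_upwards [ae_restrict_mem hQ.measurableSet, ae_restrict_of_ae h.coeFn_eq]
          with q hq hcq
        have hr : μ.restrict E ≤ μ.restrict D := Measure.restrict_mono hED le_rfl
        calc ∫⁻ x in E, ‖Φ fun i => x⁻¹ * q i‖ₑ ∂μ = ∫⁻ x in E, ‖c q x‖ₑ ∂μ := by
              refine lintegral_congr_ae ?_
              filter_upwards [Measure.absolutelyContinuous_of_le hr hcq] with x hx
              rw [hx]
          _ = eLpNorm (c q) 1 (μ.restrict E) := eLpNorm_one_eq_lintegral_enorm.symm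
          _ ≤ eLpNorm (c q) p (μ.restrict E) * a := by
              have := eLpNorm_le_eLpNorm_mul_rpow_measure_univ (p := 1) (q := p)
                (μ := μ.restrict E) Fact.out ((Lp.aestronglyMeasurable (c q)).mono_measure hr)
              rwa [Measure.restrict_apply_univ] at this
          _ ≤ eLpNorm (c q) p (μ.restrict D) * a := by
              gcongr
          _ ≤ B * a := by
              gcongr
              rw [← Lp.enorm_def]
              exact hB q hq
      _ = _ := by
        rw [setLIntegral_const]
        ring
  rw [mul_assoc, ← ENNReal.mul_inv_cancel_right (a := I) hE0 hEt, mul_comm]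
  gcongr

end Averaging

section Transfer

set_option linter.unusedSectionVars false

variable {𝕜 G V : Type*} [RCLike 𝕜] [Group G] [MeasurableSpace G] [TopologicalSpace G]
  [IsTopologicalGroup G] [LocallyCompactSpace G] [SecondCountableTopology G] [T2Space G]
  [BorelSpace G] {Λ : Subgroup G} {D : Set G} [NormedAddCommGroup V] [NormedSpace 𝕜 V]
  [NormedSpace ℝ V] {μ : Measure G} [μ.IsHaarMeasure] {p : ℝ≥0∞} [Fact (1 ≤ p)] {n : ℕ}
  {θ : G → ℝ} {ρ : Λ →* (V →ₗᵢ[𝕜] V)} {c : C(Fin n → G, Lp V p (μ.restrict D))}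
  {Φ : (Fin n → G) → V}

lemma IsKernel.integrable_mul (h : IsKernel μ ρ c Φ) (hθ : IsBump μ θ) (hΛ : IsLattice Λ)
    (hD : IsBorelFundamentalDomain Λ D) (g : Fin n → G) :
    Integrable (fun u : Fin n → G => Φ fun i => g i * u i)
      (Measure.pi fun _ => bumpMeasure μ θ) := by
  obtain ⟨Q, A, hQ, hA, hQA⟩ := hθ.exists_lintegral_kernel_le hΛ hD ρ p g
  refine ⟨(h.stronglyMeasurable.comp_measurable
    (g := fun u : Fin n → G => fun i => g i * u i) (by fun_prop)).aestronglyMeasurable, ?_⟩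
  obtain ⟨B, hB⟩ := (hQ.image c.continuous).isBounded.exists_norm_le
  refine (hQA c Φ h (ENNReal.ofReal B) fun q hq => ?_).trans_lt
    (ENNReal.mul_lt_top hA.lt_top ENNReal.ofReal_lt_top)
  rw [← ofReal_norm]
  exact ENNReal.ofReal_le_ofReal (hB _ ⟨q, hq, rfl⟩)

variable [CompleteSpace V] [TopologicalSpace.SeparableSpace V] [SMulCommClass ℝ 𝕜 V]

/-- A kernel of an equivariant cochain with values in the induced representation. -/
def kernel (hΛ : IsLattice Λ) (hD : IsBorelFundamentalDomain Λ D)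
    (c : equivariantCochains (inducedRep hΛ hD μ ρ p) n) : (Fin (n + 1) → G) → V :=
  (exists_isKernel hΛ hD ρ c.1 c.2).choose

lemma isKernel_kernel (hΛ : IsLattice Λ) (hD : IsBorelFundamentalDomain Λ D)
    (c : equivariantCochains (inducedRep hΛ hD μ ρ p) n) : IsKernel μ ρ c.1 (kernel hΛ hD c) :=
  (exists_isKernel hΛ hD ρ c.1 c.2).choose_spec

/-- The transfer from cochains of `G` with values in the induced representation to cochains of the
lattice: the restriction to the lattice of the averages of a kernel. -/
def transfer (hΛ : IsLattice Λ) (hD : IsBorelFundamentalDomain Λ D) (hθ : IsBump μ θ)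
    (ρ : Λ →* (V →ₗᵢ[𝕜] V)) (p : ℝ≥0∞) [Fact (1 ≤ p)] (n : ℕ) :
    equivariantCochains (inducedRep hΛ hD μ ρ p) n →ₗ[𝕜] C(Fin (n + 1) → Λ, V) where
  toFun c :=
    { toFun := fun l => average (bumpMeasure μ θ) (kernel hΛ hD c) fun i => l i
      continuous_toFun := by
        have := hΛ.discrete
        exact continuous_of_discreteTopology }
  map_add' a b := by
    ext l
    have ha := isKernel_kernel hΛ hD a
    have hb := isKernel_kernel hΛ hD b
    change average (bumpMeasure μ θ) (kernel hΛ hD (a + b)) (fun i => (l i : G)) =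
      average _ _ _ + average _ _ _
    rw [hθ.average_congr ((isKernel_kernel hΛ hD (a + b)).ae_eq hΛ hD (ha.add hb))]
    exact integral_add (ha.integrable_mul hθ hΛ hD _) (hb.integrable_mul hθ hΛ hD _)
  map_smul' r a := by
    ext l
    have ha := isKernel_kernel hΛ hD a
    change average (bumpMeasure μ θ) (kernel hΛ hD (r • a)) (fun i => (l i : G)) =
      r • average _ _ _
    rw [hθ.average_congr ((isKernel_kernel hΛ hD (r • a)).ae_eq hΛ hD (ha.smul r))]
    exact integral_smul r _

variable (hΛ : IsLattice Λ) (hD : IsBorelFundamentalDomain Λ D) (hθ : IsBump μ θ)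

/-- The transfer can be computed from any kernel. -/
lemma transfer_apply (c : equivariantCochains (inducedRep hΛ hD μ ρ p) n)
    {Φ : (Fin (n + 1) → G) → V} (hΦ : IsKernel μ ρ c.1 Φ) (l : Fin (n + 1) → Λ) :
    transfer hΛ hD hθ ρ p n c l = average (bumpMeasure μ θ) Φ fun i => l i :=
  hθ.average_congr ((isKernel_kernel hΛ hD c).ae_eq hΛ hD hΦ) _

lemma transfer_mem (c : equivariantCochains (inducedRep hΛ hD μ ρ p) n) :
    transfer hΛ hD hθ ρ p n c ∈ equivariantCochains ρ n := fun l x =>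
  (isKernel_kernel hΛ hD c).average_equivariant hθ l fun i => (x i : G)

lemma transfer_coboundary (c : equivariantCochains (inducedRep hΛ hD μ ρ p) n)
    (c' : equivariantCochains (inducedRep hΛ hD μ ρ p) (n + 1))
    (hc : c'.1 = coboundary 𝕜 G (Lp V p (μ.restrict D)) n c.1) :
    transfer hΛ hD hθ ρ p (n + 1) c' = coboundary 𝕜 Λ V n (transfer hΛ hD hθ ρ p n c) := by
  ext l
  have h := isKernel_kernel hΛ hD c
  have h' := h.map_coboundary
  rw [← hc] at h'
  rw [transfer_apply hΛ hD hθ c' h',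
    hθ.average_tupleCoboundary fun g => h.integrable_mul hθ hΛ hD g]
  rfl

lemma continuous_transfer : Continuous (transfer hΛ hD hθ ρ p n) := by
  have := hΛ.discrete
  rw [← ContinuousMap.homeoFnOfDiscrete.comp_continuous_iff]
  refine continuous_pi fun l => ?_
  let T : equivariantCochains (inducedRep hΛ hD μ ρ p) n →+ V :=
    { toFun := fun c => transfer hΛ hD hθ ρ p n c l
      map_zero' := by rw [map_zero]; rfl
      map_add' := fun a b => by rw [map_add]; rfl }
  refine continuous_of_continuousAt_zero T ?_
  rw [ContinuousAt, map_zero, EMetric.tendsto_nhds]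
  intro ε hε
  obtain ⟨Q, A, hQ, hA, hQA⟩ := hθ.exists_lintegral_kernel_le hΛ hD ρ p fun i => (l i : G)
  obtain ⟨δ, hδ, hAδ⟩ : ∃ δ : ℝ≥0∞, 0 < δ ∧ A * δ < ε := by
    obtain ⟨δ, hδ, h⟩ := ENNReal.exists_nnreal_pos_mul_lt hA hε.ne'
    exact ⟨δ, by simpa using hδ, by rwa [mul_comm]⟩
  have hopen : IsOpen {c : C(Fin (n + 1) → G, Lp V p (μ.restrict D)) |
      Set.MapsTo c Q {F | ‖F‖ₑ < δ}} :=
    ContinuousMap.isOpen_setOfPred_mapsTo hQ (isOpen_lt (by fun_prop) continuous_const)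
  have hnhds : ∀ᶠ c : equivariantCochains (inducedRep hΛ hD μ ρ p) n in 𝓝 0,
      Set.MapsTo c.1 Q {F | ‖F‖ₑ < δ} :=
    continuous_subtype_val.continuousAt.eventually (hopen.mem_nhds fun q _ => by simpa using hδ)
  filter_upwards [hnhds] with c hc
  rw [edist_zero_right]
  refine lt_of_le_of_lt ?_ hAδ
  refine (enorm_integral_le_lintegral_enorm _).trans ?_
  exact hQA c.1 _ (isKernel_kernel hΛ hD c) δ fun q hq => (hc hq).le

end Transfer

/-! ### Induction of cochains of the lattice -/

section Pullback

set_option linter.unusedSectionVars false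

/-- The integral of the weight of the lattice cocycle over the fundamental domain is locally
bounded. -/
def IsIntegrableWeight {G : Type*} [Group G] [TopologicalSpace G] [MeasurableSpace G]
    {Λ : Subgroup G} {D : Set G} (μ : Measure G) (hD : IsBorelFundamentalDomain Λ D)
    (w : Λ → ℝ≥0∞) : Prop :=
  ∀ K : Set G, IsCompact K →
    ∃ B : ℝ≥0∞, B ≠ ⊤ ∧ ∀ g ∈ K, ∫⁻ x in D, w (cocycle hD g x) ∂μ ≤ B

/-- The `p`-th power of the norm of `b` is dominated by the weight `w`. -/
def IsDominated {Γ V : Type*} [NormedAddCommGroup V] (p : ℝ≥0∞) (w : Γ → ℝ≥0∞) {n : ℕ}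
    (b : (Fin n → Γ) → V) : Prop :=
  ∃ C : ℝ≥0∞, C ≠ ⊤ ∧ ∀ γ, ‖b γ‖ₑ ^ p.toReal ≤ C * (1 + ∑ i, w (γ i))

variable {𝕜 G V : Type*} [RCLike 𝕜] [Group G] [MeasurableSpace G] [TopologicalSpace G]
  [IsTopologicalGroup G] [LocallyCompactSpace G] [SecondCountableTopology G] [T2Space G]
  [BorelSpace G] {Λ : Subgroup G} {D D' : Set G} [NormedAddCommGroup V] [NormedSpace 𝕜 V]
  {μ : Measure G} [μ.IsHaarMeasure] {p : ℝ≥0∞} [Fact (1 ≤ p)] {n : ℕ}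
  {ρ : Λ →* (V →ₗᵢ[𝕜] V)} {b : (Fin n → Λ) → V} {w : Λ → ℝ≥0∞}

/-- The pullback of a function on tuples of the lattice under the retraction of `G`. -/
def pullback (hD' : IsBorelFundamentalDomain Λ D') (b : (Fin n → Λ) → V) (g : Fin n → G) : V :=
  b fun i => retraction hD' (g i)

lemma pullback_equivariant (hD' : IsBorelFundamentalDomain Λ D')
    (hb : ∀ (l : Λ) γ, (b fun i => l * γ i) = ρ l (b γ)) (l : Λ) (g : Fin n → G) :
    (pullback hD' b fun i => l * g i) = ρ l (pullback hD' b g) := by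
  simp only [pullback, retraction_mul, hb]

lemma stronglyMeasurable_pullback (hΛ : IsLattice Λ) (hD' : IsBorelFundamentalDomain Λ D')
    (b : (Fin n → Λ) → V) : StronglyMeasurable (pullback hD' b) := by
  have := hΛ.countable
  have := hΛ.discrete
  have hb : StronglyMeasurable b := continuous_of_discreteTopology.stronglyMeasurable
  refine hb.comp_measurable (g := fun (g : Fin n → G) i => retraction hD' (g i)) ?_
  exact measurable_pi_lambda _ fun i => (measurable_retraction hΛ hD').comp (measurable_pi_apply i)

/-- The `L^p`-norms over the fundamental domain of the translates of the pullback are bounded on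
compact sets. -/
lemma exists_lintegral_pullback_le (hΛ : IsLattice Λ) (hD : IsBorelFundamentalDomain Λ D)
    (hD' : IsBorelFundamentalDomain Λ D')
    (hb : ∀ (l : Λ) γ, (b fun i => l * γ i) = ρ l (b γ))
    (hw : IsIntegrableWeight μ hD' w) (hbw : IsDominated p w b)
    {Q : Set (Fin n → G)} (hQ : IsCompact Q) :
    ∃ B : ℝ≥0∞, B ≠ ⊤ ∧ ∀ u ∈ Q,
      ∫⁻ x in D, ‖pullback hD' b fun i => x⁻¹ * u i‖ₑ ^ p.toReal ∂μ ≤ B := by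
  obtain ⟨C, hC, hCb⟩ := hbw
  choose B hB hBw using fun i => hw _ (hQ.image (continuous_apply i))
  refine ⟨C * (μ D' + ∑ i, B i), ENNReal.mul_ne_top hC (ENNReal.add_ne_top.2
    ⟨(measure_fundamentalDomain_lt_top hΛ hD' μ).ne, ENNReal.sum_ne_top.2 fun i _ => hB i⟩),
    fun u hu => ?_⟩
  -- The integrand is right `Λ`-invariant, and over the other fundamental domain the retraction of
  -- `x⁻¹ * u i` is the lattice cocycle at `(u i, x)`.
  rw [setLIntegral_fundamentalDomain_eq hΛ hD hD' μ]
  · calc ∫⁻ x in D', ‖pullback hD' b fun i => x⁻¹ * u i‖ₑ ^ p.toReal ∂μ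
        ≤ ∫⁻ x in D', C * (1 + ∑ i, w (cocycle hD' (u i) x)) ∂μ := by
          refine lintegral_mono fun x => ?_
          simp only [← retraction_inv_mul]
          exact hCb _
      _ = C * (μ D' + ∑ i, ∫⁻ x in D', w (cocycle hD' (u i) x) ∂μ) := by
          rw [lintegral_const_mul' _ _ hC, lintegral_add_left measurable_const,
            lintegral_finsetSum, setLIntegral_const, one_mul]
          exact fun i _ => (measurable_weight_cocycle hΛ hD' w).comp measurable_prodMk_left
      _ ≤ _ := by
          gcongr with i
          exact hBw i _ ⟨u, hu, rfl⟩
  · intro x l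
    have h1 : ∀ i, (x * (l : G))⁻¹ * u i = (l⁻¹ : Λ) * (x⁻¹ * u i) := fun i => by
      simp [mul_assoc]
    simp only [h1]
    rw [pullback_equivariant hD' hb l⁻¹ fun i => x⁻¹ * u i]
    simp

/-- A bound for the mass of the translates of the pullback over a compact set, in the `L^p`-norm over
the fundamental domain. -/
lemma lintegral_lintegral_pullback_rpow_lt_top (hΛ : IsLattice Λ)
    (hD : IsBorelFundamentalDomain Λ D) (hD' : IsBorelFundamentalDomain Λ D') (hp : p ≠ ⊤)
    (hb : ∀ (l : Λ) γ, (b fun i => l * γ i) = ρ l (b γ))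
    (hw : IsIntegrableWeight μ hD' w) (hbw : IsDominated p w b)
    {Q : Set (Fin n → G)} (hQ : IsCompact Q) :
    ∫⁻ x in D, (∫⁻ u in Q, ‖pullback hD' b fun i => x⁻¹ * u i‖ₑ ∂(Measure.pi fun _ => μ))
      ^ p.toReal ∂μ < ⊤ := by
  have hp1 : 1 ≤ p := Fact.out
  have hp0 : p ≠ 0 := (zero_lt_one.trans_le hp1).ne'
  have hpr : 0 < p.toReal := ENNReal.toReal_pos hp0 hp
  have hpr1 : 1 ≤ p.toReal := by
    have := ENNReal.toReal_mono hp hp1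
    simpa using this
  obtain ⟨B, hB, hBQ⟩ := exists_lintegral_pullback_le hΛ hD hD' hb hw hbw hQ
  have hΦ := stronglyMeasurable_pullback hΛ hD' b
  have hj : StronglyMeasurable fun z : G × (Fin n → G) => pullback hD' b fun i => z.1⁻¹ * z.2 i :=
    hΦ.comp_measurable (g := fun z : G × (Fin n → G) => fun i => z.1⁻¹ * z.2 i) (by fun_prop)
  set ν : Measure (Fin n → G) := (Measure.pi fun _ => μ).restrict Q with hν
  have hνQ : ν Set.univ ≠ ⊤ := by
    rw [hν, Measure.restrict_apply_univ]
    exact hQ.measure_lt_top.ne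
  set a : ℝ≥0∞ := ν Set.univ ^ (1 / (1 : ℝ≥0∞).toReal - 1 / p.toReal) with ha
  have hat : a ≠ ⊤ := by
    refine ENNReal.rpow_ne_top_of_nonneg ?_ hνQ
    simp only [ENNReal.toReal_one, div_one, one_div, sub_nonneg]
    exact inv_le_one_of_one_le₀ hpr1
  have h1 : ∀ x : G, (∫⁻ u, ‖pullback hD' b fun i => x⁻¹ * u i‖ₑ ∂ν) ^ p.toReal ≤
      a ^ p.toReal * ∫⁻ u, ‖pullback hD' b fun i => x⁻¹ * u i‖ₑ ^ p.toReal ∂ν := by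
    intro x
    have hm : StronglyMeasurable fun u : Fin n → G => pullback hD' b fun i => x⁻¹ * u i :=
      hj.comp_measurable measurable_prodMk_left
    have h2 := eLpNorm_le_eLpNorm_mul_rpow_measure_univ (p := 1) (q := p) hp1
      hm.aestronglyMeasurable (μ := ν)
    rw [eLpNorm_one_eq_lintegral_enorm, eLpNorm_eq_lintegral_rpow_enorm_toReal hp0 hp, ← ha] at h2
    calc _ ≤ _ := ENNReal.rpow_le_rpow h2 hpr.le
      _ = _ := by
        rw [ENNReal.mul_rpow_of_nonneg _ _ hpr.le, ← ENNReal.rpow_mul, one_div,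
          inv_mul_cancel₀ hpr.ne', ENNReal.rpow_one, mul_comm]
  calc _ ≤ ∫⁻ x in D, a ^ p.toReal *
        ∫⁻ u, ‖pullback hD' b fun i => x⁻¹ * u i‖ₑ ^ p.toReal ∂ν ∂μ := lintegral_mono h1
    _ = a ^ p.toReal *
        ∫⁻ u, ∫⁻ x in D, ‖pullback hD' b fun i => x⁻¹ * u i‖ₑ ^ p.toReal ∂μ ∂ν := by
      rw [lintegral_const_mul' _ _ (ENNReal.rpow_ne_top_of_nonneg hpr.le hat),
        lintegral_lintegral_swap]
      exact (hj.enorm.pow_const _).aemeasurable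
    _ ≤ a ^ p.toReal * ∫⁻ _, B ∂ν := by
      refine mul_le_mul' le_rfl (setLIntegral_mono' hQ.measurableSet fun u hu => hBQ u hu)
    _ < ⊤ := by
      rw [lintegral_const]
      exact ENNReal.mul_lt_top (ENNReal.rpow_ne_top_of_nonneg hpr.le hat).lt_top
        (ENNReal.mul_lt_top hB.lt_top hνQ.lt_top)

/-- The pullback is locally integrable. -/
lemma setLIntegral_pullback_lt_top (hΛ : IsLattice Λ)
    (hD' : IsBorelFundamentalDomain Λ D') (hp : p ≠ ⊤)
    (hb : ∀ (l : Λ) γ, (b fun i => l * γ i) = ρ l (b γ))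
    (hw : IsIntegrableWeight μ hD' w) (hbw : IsDominated p w b)
    {Q : Set (Fin n → G)} (hQ : IsCompact Q) :
    ∫⁻ u in Q, ‖pullback hD' b u‖ₑ ∂(Measure.pi fun _ => μ) < ⊤ := by
  have hp0 : p ≠ 0 := (zero_lt_one.trans_le (Fact.out : 1 ≤ p)).ne'
  have hpr : 0 < p.toReal := ENNReal.toReal_pos hp0 hp
  obtain ⟨E, K, hE, hED, hEK, hK, hE0⟩ := exists_relativelyCompact_subset hΛ hD' μ
  let R : Set (Fin n → G) := (fun z : G × (Fin n → G) => fun i => z.1 * z.2 i) '' (K ×ˢ Q)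
  have hR : IsCompact R := (hK.prod hQ).image (by fun_prop)
  have hΦ := stronglyMeasurable_pullback hΛ hD' b
  have h1 := lintegral_lintegral_pullback_rpow_lt_top hΛ hD' hD' hp hb hw hbw hR
  have hm : Measurable fun z : G × (Fin n → G) => ‖pullback hD' b fun i => z.1⁻¹ * z.2 i‖ₑ :=
    hΦ.enorm.comp (f := fun z : G × (Fin n → G) => fun i => z.1⁻¹ * z.2 i) (by fun_prop)
  have hN : Measurable fun x : G => ∫⁻ u in R, ‖pullback hD' b fun i => x⁻¹ * u i‖ₑ
      ∂(Measure.pi fun _ => μ) := hm.lintegral_prod_right'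
  have h2 : ∀ᵐ x ∂μ.restrict D', ∫⁻ u in R, ‖pullback hD' b fun i => x⁻¹ * u i‖ₑ
      ∂(Measure.pi fun _ => μ) < ⊤ := by
    refine (ae_lt_top (hN.pow_const p.toReal) h1.ne).mono fun x hx => ?_
    exact (ENNReal.rpow_lt_top_iff_of_pos hpr).1 hx
  have : (ae (μ.restrict E)).NeBot := by
    rw [ae_neBot, Ne, Measure.restrict_eq_zero]
    exact hE0
  obtain ⟨x, hx, hxE⟩ := ((ae_restrict_of_ae_restrict_of_subset hED h2).and
    (ae_restrict_mem hE)).exists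
  have hmp := measurePreserving_mul_pi (n := n) μ x
  have hmx : Measurable fun u : Fin n → G => ‖pullback hD' b fun i => x⁻¹ * u i‖ₑ :=
    hΦ.enorm.comp (f := fun u : Fin n → G => fun i => x⁻¹ * u i) (by fun_prop)
  rw [← hmp.setLIntegral_comp_preimage hR.measurableSet hmx] at hx
  simp only [inv_mul_cancel_left] at hx
  refine lt_of_le_of_lt (lintegral_mono_set ?_) hx
  exact fun u hu => ⟨(x, u), ⟨hEK hxE, hu⟩, rfl⟩

end Pullback

section InducedCochain

set_option linter.unusedSectionVars false

variable {𝕜 G V : Type*} [RCLike 𝕜] [Group G] [MeasurableSpace G] [TopologicalSpace G]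
  [IsTopologicalGroup G] [LocallyCompactSpace G] [SecondCountableTopology G] [T2Space G]
  [BorelSpace G] {Λ : Subgroup G} {D D' : Set G} [NormedAddCommGroup V] [NormedSpace 𝕜 V]
  [NormedSpace ℝ V]
  {μ : Measure G} [μ.IsHaarMeasure] {p : ℝ≥0∞} [Fact (1 ≤ p)] {n : ℕ} {θ : G → ℝ}
  {ρ : Λ →* (V →ₗᵢ[𝕜] V)} {b : (Fin n → Λ) → V} {w : Λ → ℝ≥0∞}

lemma IsBump.continuous_prod_inv_mul (hθ : IsBump μ θ) (n : ℕ) :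
    Continuous fun z : (Fin n → G) × (Fin n → G) => ∏ i, θ ((z.1 i)⁻¹ * z.2 i) :=
  (hθ.continuous_prod n).comp (f := fun z : (Fin n → G) × (Fin n → G) =>
    fun i => (z.1 i)⁻¹ * z.2 i) (by fun_prop)

lemma IsBump.exists_compact_support (hθ : IsBump μ θ) {P : Set (Fin n → G)} (hP : IsCompact P) :
    ∃ Q : Set (Fin n → G), IsCompact Q ∧ ∀ g ∈ P, ∀ u ∉ Q, ∏ i, θ ((g i)⁻¹ * u i) = 0 := by
  refine ⟨(fun z : (Fin n → G) × (Fin n → G) => fun i => z.1 i * z.2 i) ''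
    (P ×ˢ Set.univ.pi fun _ => tsupport θ),
    (hP.prod (isCompact_univ_pi fun _ => hθ.hasCompactSupport)).image (by fun_prop),
    fun g hg u hu => ?_⟩
  obtain ⟨i, hi⟩ : ∃ i, θ ((g i)⁻¹ * u i) = 0 := by
    by_contra! hne
    refine hu ⟨(g, fun i => (g i)⁻¹ * u i), ⟨hg, fun i _ => subset_tsupport _ (hne i)⟩, ?_⟩
    ext i
    simp
  exact Finset.prod_eq_zero (Finset.mem_univ i) hi

/-- The integral of a translate of the pullback against a function supported in a compact set depends
continuously, in the `L^p`-norm over the fundamental domain, on that function in the supremum norm. -/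
lemma exists_eLpNorm_integral_smul_pullback_le (hΛ : IsLattice Λ)
    (hD : IsBorelFundamentalDomain Λ D) (hD' : IsBorelFundamentalDomain Λ D') (hp : p ≠ ⊤)
    (hb : ∀ (l : Λ) γ, (b fun i => l * γ i) = ρ l (b γ))
    (hw : IsIntegrableWeight μ hD' w) (hbw : IsDominated p w b)
    {Q : Set (Fin n → G)} (hQ : IsCompact Q) :
    ∃ R : ℝ≥0∞, R ≠ ⊤ ∧ ∀ (f : (Fin n → G) → ℝ) (δ : ℝ≥0∞), (∀ u ∉ Q, f u = 0) →
      (∀ u ∈ Q, ‖f u‖ₑ ≤ δ) →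
      eLpNorm (fun x => ∫ u, f u • (pullback hD' b fun i => x⁻¹ * u i) ∂(Measure.pi fun _ => μ)) p
        (μ.restrict D) ≤ δ * R := by
  have hp0 : p ≠ 0 := (zero_lt_one.trans_le (Fact.out : 1 ≤ p)).ne'
  have hpr : 0 < p.toReal := ENNReal.toReal_pos hp0 hp
  have h1 := lintegral_lintegral_pullback_rpow_lt_top hΛ hD hD' hp hb hw hbw hQ
  have hm : Measurable fun z : G × (Fin n → G) => ‖pullback hD' b fun i => z.1⁻¹ * z.2 i‖ₑ :=
    (stronglyMeasurable_pullback hΛ hD' b).enorm.comp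
      (f := fun z : G × (Fin n → G) => fun i => z.1⁻¹ * z.2 i) (by fun_prop)
  have hN : Measurable fun x : G => ∫⁻ u in Q, ‖pullback hD' b fun i => x⁻¹ * u i‖ₑ
      ∂(Measure.pi fun _ => μ) := hm.lintegral_prod_right'
  refine ⟨_, (ENNReal.rpow_lt_top_of_nonneg (inv_nonneg.2 hpr.le) h1.ne).ne, fun f δ hf hδ => ?_⟩
  have h2 : ∀ x : G, ‖∫ u, f u • (pullback hD' b fun i => x⁻¹ * u i) ∂(Measure.pi fun _ => μ)‖ₑ ≤
      δ * ∫⁻ u in Q, ‖pullback hD' b fun i => x⁻¹ * u i‖ₑ ∂(Measure.pi fun _ => μ) := by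
    intro x
    have hmx : Measurable fun u : Fin n → G => ‖pullback hD' b fun i => x⁻¹ * u i‖ₑ :=
      (stronglyMeasurable_pullback hΛ hD' b).enorm.comp
        (f := fun u : Fin n → G => fun i => x⁻¹ * u i) (by fun_prop)
    refine (enorm_integral_le_lintegral_enorm _).trans ?_
    rw [← lintegral_const_mul _ hmx, ← lintegral_indicator hQ.measurableSet]
    refine lintegral_mono fun u => ?_
    by_cases hu : u ∈ Q
    · rw [Set.indicator_of_mem hu, enorm_smul]
      exact mul_le_mul' (hδ u hu) le_rfl
    · simp [hf u hu]
  rw [eLpNorm_eq_lintegral_rpow_enorm_toReal hp0 hp, one_div]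
  calc _ ≤ (∫⁻ x in D, δ ^ p.toReal * (∫⁻ u in Q, ‖pullback hD' b fun i => x⁻¹ * u i‖ₑ
        ∂(Measure.pi fun _ => μ)) ^ p.toReal ∂μ) ^ p.toReal⁻¹ := by
        refine ENNReal.rpow_le_rpow (lintegral_mono fun x => ?_) (inv_nonneg.2 hpr.le)
        rw [← ENNReal.mul_rpow_of_nonneg _ _ hpr.le]
        exact ENNReal.rpow_le_rpow (h2 x) hpr.le
    _ = _ := by
        rw [lintegral_const_mul _ (hN.pow_const _), ENNReal.mul_rpow_of_nonneg _ _
          (inv_nonneg.2 hpr.le), ← ENNReal.rpow_mul, mul_inv_cancel₀ hpr.ne', ENNReal.rpow_one]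

lemma integrable_smul_pullback (hΛ : IsLattice Λ) (hD' : IsBorelFundamentalDomain Λ D')
    (hp : p ≠ ⊤) (hθ : IsBump μ θ)
    (hb : ∀ (l : Λ) γ, (b fun i => l * γ i) = ρ l (b γ))
    (hw : IsIntegrableWeight μ hD' w) (hbw : IsDominated p w b) (x : G) (g : Fin n → G) :
    Integrable (fun u => (∏ i, θ ((g i)⁻¹ * u i)) • pullback hD' b fun i => x⁻¹ * u i)
      (Measure.pi fun _ => μ) := by
  have hmp := measurePreserving_mul_pi (n := n) μ x⁻¹
  obtain ⟨Q, hQ, hQg⟩ := hθ.exists_compact_support (isCompact_singleton (x := g))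
  have hc : Continuous fun u : Fin n → G => ∏ i, θ ((g i)⁻¹ * u i) :=
    (hθ.continuous_prod_inv_mul n).comp (Continuous.prodMk_right g)
  have hsm : StronglyMeasurable fun u : Fin n → G => pullback hD' b fun i => x⁻¹ * u i :=
    (stronglyMeasurable_pullback hΛ hD' b).comp_measurable hmp.measurable
  refine ⟨(hc.stronglyMeasurable.smul hsm).aestronglyMeasurable, ?_⟩
  obtain ⟨C, hC⟩ := (hQ.image hc).isBounded.exists_norm_le
  have hR : IsCompact ((fun (u : Fin n → G) i => x⁻¹ * u i) '' Q) := hQ.image (by fun_prop)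
  have h1 : ∫⁻ u in Q, ‖pullback hD' b fun i => x⁻¹ * u i‖ₑ ∂(Measure.pi fun _ => μ) < ⊤ := by
    refine lt_of_le_of_lt ?_ (setLIntegral_pullback_lt_top hΛ hD' hp hb hw hbw hR)
    rw [← hmp.setLIntegral_comp_preimage hR.measurableSet
      (stronglyMeasurable_pullback hΛ hD' b).enorm]
    exact lintegral_mono_set (Set.subset_preimage_image _ _)
  refine lt_of_le_of_lt ?_ (ENNReal.mul_lt_top (ENNReal.ofReal_lt_top (r := C)) h1)
  rw [← lintegral_const_mul _ hsm.enorm, ← lintegral_indicator hQ.measurableSet]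
  refine lintegral_mono fun u => ?_
  by_cases hu : u ∈ Q
  · rw [Set.indicator_of_mem hu, enorm_smul, ← ofReal_norm (∏ i, θ ((g i)⁻¹ * u i))]
    exact mul_le_mul' (ENNReal.ofReal_le_ofReal (hC _ ⟨u, hu, rfl⟩)) le_rfl
  · simp [hQg g rfl u hu]

lemma IsBump.average_inv_mul (hθ : IsBump μ θ) (Φ : (Fin n → G) → V) (x : G) (g : Fin n → G) :
    (average (bumpMeasure μ θ) Φ fun i => x⁻¹ * g i) =
      ∫ u, (∏ i, θ ((g i)⁻¹ * u i)) • Φ (fun i => x⁻¹ * u i) ∂(Measure.pi fun _ => μ) := by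
  rw [hθ.average_eq, ← integral_mul_left_eq_self (μ := Measure.pi fun _ => μ)
    (fun u => (∏ i, θ ((g i)⁻¹ * u i)) • Φ fun i => x⁻¹ * u i) fun _ => x]
  simp [mul_assoc]

lemma stronglyMeasurable_average_pullback (hΛ : IsLattice Λ) (hD' : IsBorelFundamentalDomain Λ D')
    (hθ : IsBump μ θ) (b : (Fin n → Λ) → V) :
    StronglyMeasurable (average (bumpMeasure μ θ) (pullback hD' b)) := by
  have h1 : average (bumpMeasure μ θ) (pullback hD' b) = fun g =>
      ∫ u, (∏ i, θ ((g i)⁻¹ * u i)) • pullback hD' b u ∂(Measure.pi fun _ => μ) :=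
    funext fun g => hθ.average_eq _ g
  rw [h1]
  refine StronglyMeasurable.integral_prod_right (f := fun (g u : Fin n → G) =>
    (∏ i, θ ((g i)⁻¹ * u i)) • pullback hD' b u) ?_
  exact (hθ.continuous_prod_inv_mul n).stronglyMeasurable.smul
    ((stronglyMeasurable_pullback hΛ hD' b).comp_measurable measurable_snd)

/-- Averages of the pullback are integrable. -/
lemma integrable_pullback_mul (hΛ : IsLattice Λ) (hD' : IsBorelFundamentalDomain Λ D')
    (hp : p ≠ ⊤) (hθ : IsBump μ θ)
    (hb : ∀ (l : Λ) γ, (b fun i => l * γ i) = ρ l (b γ))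
    (hw : IsIntegrableWeight μ hD' w) (hbw : IsDominated p w b) (g : Fin n → G) :
    Integrable (fun u : Fin n → G => pullback hD' b fun i => g i * u i)
      (Measure.pi fun _ => bumpMeasure μ θ) := by
  have hΦ := stronglyMeasurable_pullback hΛ hD' b
  refine ⟨(hΦ.comp_measurable (g := fun u : Fin n → G => fun i => g i * u i)
    (by fun_prop)).aestronglyMeasurable, ?_⟩
  have h1 := (integrable_smul_pullback hΛ hD' hp hθ hb hw hbw 1 g).2
  rw [HasFiniteIntegral, hθ.lintegral_average hΦ.enorm]
  refine lt_of_le_of_lt (le_of_eq ?_) h1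
  refine lintegral_congr fun u => ?_
  rw [enorm_smul, Real.enorm_of_nonneg (Finset.prod_nonneg fun i _ => hθ.nonneg _)]
  simp

lemma memLp_average_pullback (hΛ : IsLattice Λ)
    (hD : IsBorelFundamentalDomain Λ D) (hD' : IsBorelFundamentalDomain Λ D') (hp : p ≠ ⊤)
    (hθ : IsBump μ θ) (hb : ∀ (l : Λ) γ, (b fun i => l * γ i) = ρ l (b γ))
    (hw : IsIntegrableWeight μ hD' w) (hbw : IsDominated p w b) (g : Fin n → G) :
    MemLp (fun x : G => average (bumpMeasure μ θ) (pullback hD' b) fun i => x⁻¹ * g i) p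
      (μ.restrict D) := by
  refine ⟨((stronglyMeasurable_average_pullback hΛ hD' hθ b).comp_measurable
    (g := fun (x : G) i => x⁻¹ * g i) (by fun_prop)).aestronglyMeasurable, ?_⟩
  obtain ⟨Q, hQ, hQg⟩ := hθ.exists_compact_support (isCompact_singleton (x := g))
  obtain ⟨R, hR, hRQ⟩ := exists_eLpNorm_integral_smul_pullback_le hΛ hD hD' hp hb hw hbw hQ
  have hc : Continuous fun u : Fin n → G => ∏ i, θ ((g i)⁻¹ * u i) :=
    (hθ.continuous_prod_inv_mul n).comp (Continuous.prodMk_right g)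
  obtain ⟨C, hC⟩ := (hQ.image hc).isBounded.exists_norm_le
  simp only [hθ.average_inv_mul]
  refine (hRQ _ (ENNReal.ofReal C) (hQg g rfl) fun u hu => ?_).trans_lt
    (ENNReal.mul_lt_top ENNReal.ofReal_lt_top hR.lt_top)
  rw [← ofReal_norm]
  exact ENNReal.ofReal_le_ofReal (hC _ ⟨u, hu, rfl⟩)

/-- The continuous cochain on `G` with values in the induced representation that a cochain on the
lattice of controlled growth induces: `g ↦ [x ↦ Φ(x⁻¹g)]`, where `Φ` averages the pullback. -/
def inducedCochain (hΛ : IsLattice Λ)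
    (hD : IsBorelFundamentalDomain Λ D) (hD' : IsBorelFundamentalDomain Λ D') (hp : p ≠ ⊤)
    (hθ : IsBump μ θ) (hb : ∀ (l : Λ) γ, (b fun i => l * γ i) = ρ l (b γ))
    (hw : IsIntegrableWeight μ hD' w) (hbw : IsDominated p w b) :
    C(Fin n → G, Lp V p (μ.restrict D)) where
  toFun g := (memLp_average_pullback hΛ hD hD' hp hθ hb hw hbw g).toLp
  continuous_toFun := by
    refine continuous_iff_continuousAt.2 fun g₀ => ?_
    obtain ⟨P, hP, hPg⟩ := exists_compact_mem_nhds g₀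
    obtain ⟨Q, hQ, hQP⟩ := hθ.exists_compact_support hP
    obtain ⟨R, hR, hRQ⟩ := exists_eLpNorm_integral_smul_pullback_le hΛ hD hD' hp hb hw hbw hQ
    rw [ContinuousAt, EMetric.tendsto_nhds]
    intro ε hε
    obtain ⟨δ, hδ, hRδ⟩ := ENNReal.exists_nnreal_pos_mul_lt hR hε.ne'
    let F : C((Fin n → G) × (Fin n → G), ℝ) := ⟨_, hθ.continuous_prod_inv_mul n⟩
    have h1 := ContinuousMap.tendsto_iff_forall_isCompact_tendstoUniformlyOn.1
      (F.curry.continuous.tendsto g₀) Q hQ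
    have h2 := Metric.tendstoUniformlyOn_iff.1 h1 δ (by exact_mod_cast hδ)
    filter_upwards [h2, hPg] with g hg hgP
    rw [Lp.edist_toLp_toLp]
    refine lt_of_le_of_lt ?_ hRδ
    have h3 : ((fun x : G => average (bumpMeasure μ θ) (pullback hD' b) fun i => x⁻¹ * g i) -
        fun x : G => average (bumpMeasure μ θ) (pullback hD' b) fun i => x⁻¹ * g₀ i) = fun x =>
        ∫ u, (∏ i, θ ((g i)⁻¹ * u i) - ∏ i, θ ((g₀ i)⁻¹ * u i)) •
          (pullback hD' b fun i => x⁻¹ * u i) ∂(Measure.pi fun _ => μ) := by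
      ext x
      simp only [Pi.sub_apply, hθ.average_inv_mul, sub_smul]
      exact (integral_sub (integrable_smul_pullback hΛ hD' hp hθ hb hw hbw x g)
        (integrable_smul_pullback hΛ hD' hp hθ hb hw hbw x g₀)).symm
    rw [h3]
    refine hRQ _ δ (fun u hu => ?_) fun u hu => ?_
    · rw [hQP g hgP u hu, hQP g₀ (mem_of_mem_nhds hPg) u hu, sub_zero]
    · have h4 := hg u hu
      rw [dist_comm, dist_eq_norm] at h4
      rw [← ofReal_norm]
      exact (ENNReal.ofReal_le_ofReal h4.le).trans (by simp)

variable (hΛ : IsLattice Λ)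
    (hD : IsBorelFundamentalDomain Λ D) (hD' : IsBorelFundamentalDomain Λ D') (hp : p ≠ ⊤)
    (hθ : IsBump μ θ) (hb : ∀ (l : Λ) γ, (b fun i => l * γ i) = ρ l (b γ))
    (hw : IsIntegrableWeight μ hD' w) (hbw : IsDominated p w b)

lemma coeFn_inducedCochain (g : Fin n → G) :
    inducedCochain hΛ hD hD' hp hθ hb hw hbw g =ᵐ[μ.restrict D]
      fun x => average (bumpMeasure μ θ) (pullback hD' b) fun i => x⁻¹ * g i :=
  MemLp.coeFn_toLp (memLp_average_pullback hΛ hD hD' hp hθ hb hw hbw g)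

lemma average_pullback_equivariant [CompleteSpace V] (hD' : IsBorelFundamentalDomain Λ D')
    (hb : ∀ (l : Λ) γ, (b fun i => l * γ i) = ρ l (b γ)) (l : Λ) (g : Fin n → G) :
    (average (bumpMeasure μ θ) (pullback hD' b) fun i => l * g i) =
      ρ l (average (bumpMeasure μ θ) (pullback hD' b) g) := by
  rw [average, average, ← (ρ l).integral_comp_comm]
  refine integral_congr_ae (Filter.Eventually.of_forall fun u => ?_)
  simpa [mul_assoc] using pullback_equivariant hD' hb l fun i => g i * u i

lemma isKernel_inducedCochain [CompleteSpace V] :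
    IsKernel μ ρ (inducedCochain hΛ hD hD' hp hθ hb hw hbw)
      (average (bumpMeasure μ θ) (pullback hD' b)) where
  stronglyMeasurable := stronglyMeasurable_average_pullback hΛ hD' hθ b
  coeFn_eq := Filter.Eventually.of_forall (coeFn_inducedCochain hΛ hD hD' hp hθ hb hw hbw)
  equivariant l := Filter.Eventually.of_forall (average_pullback_equivariant hD' hb l)

lemma inducedCochain_equivariant [CompleteSpace V] (h : G) (g : Fin n → G) :
    (inducedCochain hΛ hD hD' hp hθ hb hw hbw fun i => h * g i) =
      inducedRep hΛ hD μ ρ p h (inducedCochain hΛ hD hD' hp hθ hb hw hbw g) := by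
  refine Lp.ext ?_
  have hq := (measurePreserving_domainAction hΛ hD μ h).quasiMeasurePreserving
  have h1 : inducedRep hΛ hD μ ρ p h (inducedCochain hΛ hD hD' hp hθ hb hw hbw g)
      =ᵐ[μ.restrict D] fun x => ρ (cocycle hD h x)
        (inducedCochain hΛ hD hD' hp hθ hb hw hbw g (domainAction hD h x)) :=
    MemLp.coeFn_toLp (memLp_twist hΛ hD μ ρ p h (Lp.memLp _))
  filter_upwards [h1, hq.ae (coeFn_inducedCochain hΛ hD hD' hp hθ hb hw hbw g),
    coeFn_inducedCochain hΛ hD hD' hp hθ hb hw hbw fun i => h * g i] with x hx hx' hx''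
  rw [hx, hx', hx'', ← average_pullback_equivariant hD' hb]
  simp [domainAction, mul_assoc]

lemma coboundary_inducedCochain {b : (Fin (n + 1) → Λ) → V} [SMulCommClass ℝ 𝕜 V]
    (hb : ∀ (l : Λ) γ, (b fun i => l * γ i) = ρ l (b γ)) (hbw : IsDominated p w b)
    (hb0 : tupleCoboundary 𝕜 b = 0) :
    coboundary 𝕜 G (Lp V p (μ.restrict D)) n (inducedCochain hΛ hD hD' hp hθ hb hw hbw) = 0 := by
  ext1 g
  refine Lp.ext ?_
  have h2 : coboundary 𝕜 G (Lp V p (μ.restrict D)) n (inducedCochain hΛ hD hD' hp hθ hb hw hbw) g =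
    ∑ i : Fin (n + 2), (-1 : 𝕜) ^ (i : ℕ) •
      inducedCochain hΛ hD hD' hp hθ hb hw hbw (fun j => g (i.succAbove j)) := rfl
  have h0 : tupleCoboundary 𝕜 (average (bumpMeasure μ θ) (pullback hD' b)) = 0 := by
    rw [← hθ.average_tupleCoboundary (𝕜 := 𝕜)
      (integrable_pullback_mul hΛ hD' hp hθ hb hw hbw)]
    have h1 : tupleCoboundary 𝕜 (pullback hD' b) = 0 :=
      funext fun g => congrFun hb0 fun i => retraction hD' (g i)
    ext g
    simp [average, h1]
  rw [h2]
  refine (Lp.coeFn_finsetSum _ _).trans ?_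
  have h3 := ae_all_iff.2 fun i : Fin (n + 2) => Lp.coeFn_smul ((-1 : 𝕜) ^ (i : ℕ))
    (inducedCochain hΛ hD hD' hp hθ hb hw hbw fun j => g (i.succAbove j))
  have h4 := ae_all_iff.2 fun i : Fin (n + 2) =>
    coeFn_inducedCochain hΛ hD hD' hp hθ hb hw hbw fun j => g (i.succAbove j)
  filter_upwards [h3, h4, Lp.coeFn_zero V p (μ.restrict D)] with x hx hx' hx0
  rw [ContinuousMap.zero_apply, hx0, Finset.sum_apply]
  refine Eq.trans ?_ (congrFun h0 fun i => x⁻¹ * g i)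
  exact Finset.sum_congr rfl fun i _ => by rw [hx i, Pi.smul_apply, hx' i]

end InducedCochain

/-! ### Random translations of cocycles of the lattice -/

section RandomTranslation

set_option linter.unusedSectionVars false

/-- A finite weight with `w(ab) ≤ c (w(a) + w(b))`. -/
structure IsQuasiSubadditive {Γ : Type*} [Group Γ] (w : Γ → ℝ≥0∞) : Prop where
  ne_top : ∀ γ, w γ ≠ ⊤
  exists_mul_le : ∃ c : ℝ≥0∞, c ≠ ⊤ ∧ ∀ a b, w (a * b) ≤ c * (w a + w b)

variable {𝕜 Γ V Ω : Type*} [RCLike 𝕜] [Group Γ] [NormedAddCommGroup V] [NormedSpace 𝕜 V]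
  {p : ℝ≥0∞} [Fact (1 ≤ p)] {n : ℕ} {ρ : Γ →* (V →ₗᵢ[𝕜] V)} {w : Γ → ℝ≥0∞}

lemma IsDominated.enorm_le {b : (Fin n → Γ) → V} (hbw : IsDominated p w b) (hp : p ≠ ⊤) :
    ∃ C : ℝ≥0∞, C ≠ ⊤ ∧ ∀ γ, ‖b γ‖ₑ ≤ C * (1 + ∑ i, w (γ i)) := by
  obtain ⟨C, hC, h⟩ := hbw
  refine ⟨1 + C, by simp [hC], fun γ => ?_⟩
  have hpr1 : 1 ≤ p.toReal := by simpa using ENNReal.toReal_mono hp (Fact.out : 1 ≤ p)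
  have h1 : ‖b γ‖ₑ ≤ 1 + ‖b γ‖ₑ ^ p.toReal := by
    rcases le_total ‖b γ‖ₑ 1 with h1 | h1
    · exact h1.trans le_self_add
    · exact (ENNReal.le_rpow_self_of_one_le h1 hpr1).trans le_add_self
  rw [add_mul, one_mul]
  exact h1.trans (add_le_add le_self_add (h γ))

variable (𝕜) in
/-- The homotopy between the identity and the translation `γ ↦ γ ξ` of the vertices, evaluated on a
cochain. Its variables are the pairs `(γ, ξ)`. -/
def translationHomotopy (b : (Fin (n + 1) → Γ) → V) (z : Fin n → Γ × Γ) : V :=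
  evalChain 𝕜 b (coneHomotopy Prod.fst
    (fun n => vertexMap (fun z : Γ × Γ => z.1 * z.2) n - vertexMap Prod.fst n) n
    (Finsupp.single z 1))

lemma tupleCoboundary_translationHomotopy {b : (Fin (n + 1) → Γ) → V}
    (hb0 : tupleCoboundary 𝕜 b = 0) (z : Fin (n + 1) → Γ × Γ) :
    tupleCoboundary 𝕜 (translationHomotopy 𝕜 b) z =
      (b fun i => (z i).1 * (z i).2) - b fun i => (z i).1 := by
  have h := evalChain_eq_tupleCoboundary (𝕜 := 𝕜) (Prod.fst : Γ × Γ → Γ)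
    (fun n => vertexMap (fun z : Γ × Γ => z.1 * z.2) n - vertexMap Prod.fst n) ?_ (n := n)
    (fun m _ x => by simp [tupleBoundary_vertexMap]) hb0 z
  · refine Eq.trans (b := _) h.symm ?_
    simp
  · refine Finsupp.lhom_ext' fun y => LinearMap.ext_ring ?_
    simp [Subsingleton.elim (fun i => (y i).1 * (y i).2) fun i => (y i).1]

lemma translationHomotopy_equivariant {b : (Fin (n + 1) → Γ) → V}
    (hb : ∀ (l : Γ) γ, (b fun i => l * γ i) = ρ l (b γ)) (l : Γ) (z : Fin n → Γ × Γ) :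
    (translationHomotopy 𝕜 b fun i => (l * (z i).1, (z i).2)) =
      ρ l (translationHomotopy 𝕜 b z) := by
  -- The group acts on the first coordinate of the pairs only.
  let A : SMul Γ (Γ × Γ) := ⟨fun l z => (l * z.1, z.2)⟩
  have h1 : (Finsupp.single (fun i => (l * (z i).1, (z i).2)) 1 : TupleChain 𝕜 (Γ × Γ) n) =
      @chainAct 𝕜 (Γ × Γ) _ Γ A l n (Finsupp.single z 1) :=
    (@chainAct_single 𝕜 (Γ × Γ) _ Γ A l n z 1).symm
  rw [translationHomotopy, h1]
  have h2 := @coneHomotopy_chainAct 𝕜 (Γ × Γ) Γ _ Γ A _ Prod.fst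
    (fun n => vertexMap (fun z : Γ × Γ => z.1 * z.2) n - vertexMap Prod.fst n) l (fun _ => rfl)
    (fun n x => ?_) n (Finsupp.single z 1)
  · rw [h2, evalChain_chainAct ρ hb]
    rfl
  · induction x using Finsupp.induction_linear with
    | zero => simp
    | add x y hx hy => rw [map_add, map_add, map_add, hx, hy, map_add]
    | single y r =>
      rw [@chainAct_single 𝕜 (Γ × Γ) _ Γ A]
      simp only [LinearMap.sub_apply, vertexMap_single, map_sub, chainAct_single]
      simp only [A, HSMul.hSMul, SMul.smul, mul_assoc]
      rfl

lemma exists_enorm_translationHomotopy_le (hp : p ≠ ⊤) (hw : IsQuasiSubadditive w)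
    {b : (Fin (n + 1) → Γ) → V} (hbw : IsDominated p w b) (γ : Fin n → Γ) :
    ∃ C : ℝ≥0∞, C ≠ ⊤ ∧ ∀ ξ : Fin n → Γ,
      ‖translationHomotopy 𝕜 b fun i => (γ i, ξ i)‖ₑ ≤ C * (1 + ∑ i, w (ξ i)) := by
  obtain ⟨C, hC, hCb⟩ := hbw.enorm_le hp
  obtain ⟨c, hc, hcw⟩ := hw.exists_mul_le
  set s : ℝ≥0∞ := ∑ i, w (γ i) with hs
  have hst : s ≠ ⊤ := ENNReal.sum_ne_top.2 fun i _ => hw.ne_top _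
  set A : ℝ≥0∞ := 1 + (n + 1) * ((1 + c) * s + c) with hA
  have hAt : A ≠ ⊤ := by
    simp only [hA]
    finiteness
  refine ⟨ENNReal.ofReal (homotopyCount n) * (C * A), by finiteness, fun ξ => ?_⟩
  set t : ℝ≥0∞ := ∑ i, w (ξ i) with ht
  have htt : t ≠ ⊤ := ENNReal.sum_ne_top.2 fun i _ => hw.ne_top _
  have hbd : ∀ z : Fin (n + 1) → Γ, (∀ i, ∃ j, z i = γ j ∨ z i = γ j * ξ j) →
      ‖b z‖ₑ ≤ C * A * (1 + t) := by
    intro z hz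
    refine (hCb z).trans ?_
    rw [mul_assoc]
    refine mul_le_mul' le_rfl ?_
    have h1 : ∀ i, w (z i) ≤ (1 + c) * s + c * t := by
      intro i
      obtain ⟨j, hj | hj⟩ := hz i
      · rw [hj]
        have : w (γ j) ≤ s := Finset.single_le_sum (f := fun i => w (γ i)) (fun _ _ => zero_le)
          (Finset.mem_univ j)
        calc w (γ j) ≤ 1 * s := by rwa [one_mul]
          _ ≤ (1 + c) * s := mul_le_mul' le_self_add le_rfl
          _ ≤ _ := le_self_add
      · rw [hj]
        have h2 : w (γ j) ≤ s := Finset.single_le_sum (f := fun i => w (γ i)) (fun _ _ => zero_le)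
          (Finset.mem_univ j)
        have h3 : w (ξ j) ≤ t := Finset.single_le_sum (f := fun i => w (ξ i)) (fun _ _ => zero_le)
          (Finset.mem_univ j)
        calc w (γ j * ξ j) ≤ c * (w (γ j) + w (ξ j)) := hcw _ _
          _ ≤ c * (s + t) := by gcongr
          _ = c * s + c * t := mul_add _ _ _
          _ ≤ (1 + c) * s + c * t := by gcongr; exact le_add_self
    calc 1 + ∑ i, w (z i) ≤ 1 + ∑ _i : Fin (n + 1), ((1 + c) * s + c * t) := by
          gcongr with i
          exact h1 i
      _ = 1 + (n + 1) * ((1 + c) * s + c * t) := by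
          rw [Finset.sum_const, Finset.card_univ, Fintype.card_fin, nsmul_eq_mul]
          push_cast
          rfl
      _ ≤ 1 + (n + 1) * ((1 + c) * s + c) * (1 + t) + t := by
          rw [mul_assoc]
          refine le_add_right (add_le_add le_rfl (mul_le_mul' le_rfl ?_))
          rw [mul_add ((1 + c) * s + c), mul_one]
          exact add_le_add le_self_add (mul_le_mul' le_add_self le_rfl)
      _ = A * (1 + t) := by rw [hA]; ring
  have hfin : C * A * (1 + t) ≠ ⊤ := by finiteness
  have h1 := norm_evalChain_coneHomotopy_le (𝕜 := 𝕜) (Prod.fst : Γ × Γ → Γ) (fun z => z.1 * z.2)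
    n b (fun i => (γ i, ξ i)) (C * A * (1 + t)).toReal fun z hz => by
      have := hbd z hz
      rw [← ofReal_norm, ENNReal.ofReal_le_iff_le_toReal hfin] at this
      exact this
  rw [← ofReal_norm, mul_assoc, ← ENNReal.ofReal_toReal hfin,
    ← ENNReal.ofReal_mul (homotopyCount_nonneg n)]
  exact ENNReal.ofReal_le_ofReal h1

variable [TopologicalSpace Γ] [DiscreteTopology Γ] [Countable Γ] [MeasurableSpace Γ] [BorelSpace Γ]
  [MeasurableSpace Ω] {P : Measure Ω} [IsProbabilityMeasure P] {ξ : Ω → Γ}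

lemma integrable_of_enorm_le (hξ : Measurable ξ) (hwξ : ∫⁻ ω, w (ξ ω) ∂P ≠ ⊤)
    {f : (Fin n → Γ) → V} {C : ℝ≥0∞} (hC : C ≠ ⊤) (hf : ∀ x, ‖f x‖ₑ ≤ C * (1 + ∑ i, w (x i))) :
    Integrable (fun ω : Fin n → Ω => f fun i => ξ (ω i)) (Measure.pi fun _ => P) := by
  have hfm : StronglyMeasurable f := continuous_of_discreteTopology.stronglyMeasurable
  have hξm : Measurable fun (ω : Fin n → Ω) i => ξ (ω i) := by fun_prop
  have hwm : Measurable fun ω => w (ξ ω) := (measurable_of_countable w).comp hξ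
  have hwi : ∀ i : Fin n, Measurable fun ω : Fin n → Ω => w (ξ (ω i)) := fun i =>
    hwm.comp (measurable_pi_apply i)
  refine ⟨(hfm.comp_measurable hξm).aestronglyMeasurable, ?_⟩
  refine (lintegral_mono fun (ω : Fin n → Ω) => hf fun i => ξ (ω i)).trans_lt ?_
  rw [lintegral_const_mul' _ _ hC, lintegral_add_left measurable_const, lintegral_finsetSum _
    fun i _ => hwi i]
  have h1 : ∀ i : Fin n, ∫⁻ ω : Fin n → Ω, w (ξ (ω i)) ∂(Measure.pi fun _ => P) = ∫⁻ ω, w (ξ ω) ∂P :=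
    fun i => (measurePreserving_eval (fun _ => P) i).lintegral_comp hwm
  simp only [h1]
  exact ENNReal.mul_lt_top hC.lt_top (ENNReal.add_lt_top.2
    ⟨by simp, ENNReal.sum_lt_top.2 fun _ _ => hwξ.lt_top⟩)

variable [NormedSpace ℝ V] [SMulCommClass ℝ 𝕜 V] [CompleteSpace V]

/-- Integrable independent random translations of the vertices do not change the class of a cocycle.
-/
lemma exists_integral_translation_sub_eq (hp : p ≠ ⊤) (hw : IsQuasiSubadditive w)
    {b : (Fin (n + 1) → Γ) → V} (hb : ∀ (l : Γ) γ, (b fun i => l * γ i) = ρ l (b γ))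
    (hb0 : tupleCoboundary 𝕜 b = 0) (hbw : IsDominated p w b)
    (hξ : Measurable ξ) (hwξ : ∫⁻ ω, w (ξ ω) ∂P ≠ ⊤) :
    ∃ q : (Fin n → Γ) → V, (∀ (l : Γ) γ, (q fun i => l * γ i) = ρ l (q γ)) ∧
      (n = 0 → q = 0) ∧
      ∀ γ : Fin (n + 1) → Γ, Integrable (fun ω : Fin (n + 1) → Ω => b fun i => γ i * ξ (ω i))
          (Measure.pi fun _ => P) ∧
        ∫ ω, b (fun i => γ i * ξ (ω i)) ∂(Measure.pi fun _ => P) - b γ =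
          tupleCoboundary 𝕜 q γ := by
  refine ⟨fun γ => ∫ ω, translationHomotopy 𝕜 b (fun i => (γ i, ξ (ω i))) ∂(Measure.pi fun _ => P),
    fun l γ => ?_, ?_, fun γ => ?_⟩
  · rw [← (ρ l).integral_comp_comm]
    refine integral_congr_ae (Filter.Eventually.of_forall fun ω => ?_)
    exact translationHomotopy_equivariant hb l fun i => (γ i, ξ (ω i))
  · rintro rfl
    ext γ
    simp [translationHomotopy, coneHomotopy]
  have hint : Integrable (fun ω : Fin (n + 1) → Ω => b fun i => γ i * ξ (ω i))
      (Measure.pi fun _ => P) := by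
    obtain ⟨C, hC, hCb⟩ := hbw.enorm_le hp
    obtain ⟨c, hc, hcw⟩ := hw.exists_mul_le
    have hs : ∑ i, w (γ i) ≠ ⊤ := ENNReal.sum_ne_top.2 fun i _ => hw.ne_top _
    refine integrable_of_enorm_le (f := fun x => b fun i => γ i * x i) hξ hwξ
      (C := C * (1 + c * (∑ i, w (γ i)) + c)) (by finiteness) fun x => (hCb _).trans ?_
    rw [mul_assoc]
    refine mul_le_mul' le_rfl ?_
    calc 1 + ∑ i, w (γ i * x i) ≤ 1 + ∑ i, c * (w (γ i) + w (x i)) := by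
          gcongr with i
          exact hcw _ _
      _ = 1 + c * ∑ i, w (γ i) + c * ∑ i, w (x i) := by
          rw [← Finset.mul_sum, Finset.sum_add_distrib, mul_add, add_assoc]
      _ ≤ (1 + c * ∑ i, w (γ i) + c) * 1 + (1 + c * ∑ i, w (γ i) + c) * ∑ i, w (x i) := by
          rw [mul_one]
          exact add_le_add le_self_add (mul_le_mul' le_add_self le_rfl)
      _ = _ := by rw [mul_add]
  refine ⟨hint, ?_⟩
  have hH : ∀ γ : Fin n → Γ, Integrable (fun ω : Fin n → Ω =>
      translationHomotopy 𝕜 b fun i => (γ i, ξ (ω i))) (Measure.pi fun _ => P) := by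
    intro γ
    obtain ⟨C, hC, hCb⟩ := exists_enorm_translationHomotopy_le (𝕜 := 𝕜) hp hw hbw γ
    exact integrable_of_enorm_le (f := fun x => translationHomotopy 𝕜 b fun i => (γ i, x i))
      hξ hwξ hC hCb
  -- Integrate the pointwise homotopy formula: the variables of a face are independent again.
  have h1 := integral_sum_comp_succAbove (𝕜 := 𝕜) P
    (F := fun (γ : Fin n → Γ) ω => translationHomotopy 𝕜 b fun i => (γ i, ξ (ω i))) hH γ
  rw [← h1]
  have h2 : ∀ ω : Fin (n + 1) → Ω, ∑ i : Fin (n + 1), (-1 : 𝕜) ^ (i : ℕ) •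
      translationHomotopy 𝕜 b (fun j => (γ (i.succAbove j), ξ (ω (i.succAbove j)))) =
      b (fun i => γ i * ξ (ω i)) - b γ := fun ω =>
    tupleCoboundary_translationHomotopy hb0 fun i => (γ i, ξ (ω i))
  simp only [h2]
  rw [integral_sub hint (integrable_const _)]
  simp

end RandomTranslation

/-! ### Powers of the word length as weights -/

section WordLengthWeight

variable {Γ V : Type*} [Group Γ] [NormedAddCommGroup V] {S : Set Γ}

lemma isQuasiSubadditive_wordLength (hS : Subgroup.closure S = ⊤) {q : ℝ} (hq : 1 ≤ q) :
    IsQuasiSubadditive fun γ => (wordLength S γ : ℝ≥0∞) ^ q where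
  ne_top γ := ENNReal.rpow_ne_top_of_nonneg (zero_le_one.trans hq) (ENNReal.natCast_ne_top _)
  exists_mul_le := by
    refine ⟨2 ^ (q - 1), ENNReal.rpow_ne_top_of_nonneg (by linarith) (by simp), fun a b => ?_⟩
    refine le_trans ?_ (ENNReal.rpow_add_le_mul_rpow_add_rpow _ _ hq)
    refine ENNReal.rpow_le_rpow ?_ (zero_le_one.trans hq)
    exact_mod_cast wordLength_mul_le hS a b

/-- A function of polynomial growth of exponent `N` is dominated by the `pN`-th power of the word
length. -/
lemma isDominated_of_polynomial_growth {p : ℝ≥0∞} {N : ℝ} (hN : 0 ≤ N) (hpN : 1 ≤ p.toReal * N)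
    {n : ℕ} {b : (Fin n → Γ) → V} {C : ℝ} (hC : 0 ≤ C)
    (hb : ∀ γ, ‖b γ‖ ≤ C * tupleSize S γ ^ N) :
    IsDominated p (fun γ => (wordLength S γ : ℝ≥0∞) ^ (p.toReal * N)) b := by
  set q := p.toReal * N with hq
  have hq0 : 0 ≤ q - 1 := by linarith
  have hp0 : 0 ≤ p.toReal := ENNReal.toReal_nonneg
  refine ⟨ENNReal.ofReal C ^ p.toReal * (2 ^ (q - 1) * (1 + (n : ℝ≥0∞) ^ (q - 1))), ?_,
    fun γ => ?_⟩
  · refine ENNReal.mul_ne_top (ENNReal.rpow_ne_top_of_nonneg hp0 ENNReal.ofReal_ne_top)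
      (ENNReal.mul_ne_top (ENNReal.rpow_ne_top_of_nonneg hq0 (by simp)) ?_)
    exact ENNReal.add_ne_top.2 ⟨by simp, ENNReal.rpow_ne_top_of_nonneg hq0 (by simp)⟩
  have hts : 0 ≤ tupleSize S γ := zero_le_one.trans (one_le_tupleSize S γ)
  set s : ℝ≥0∞ := ∑ i, (wordLength S (γ i) : ℝ≥0∞) with hs
  have h1 : ENNReal.ofReal (tupleSize S γ) = 1 + s := by
    rw [tupleSize, ENNReal.ofReal_add zero_le_one (by positivity), ENNReal.ofReal_one,
      ENNReal.ofReal_sum_of_nonneg fun i _ => Nat.cast_nonneg _]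
    simp [hs]
  have h2 : s ^ q ≤ (n : ℝ≥0∞) ^ (q - 1) * ∑ i, (wordLength S (γ i) : ℝ≥0∞) ^ q := by
    simpa using ENNReal.rpow_sum_le_const_mul_sum_rpow Finset.univ
      (fun i => (wordLength S (γ i) : ℝ≥0∞)) hpN
  set t : ℝ≥0∞ := ∑ i, (wordLength S (γ i) : ℝ≥0∞) ^ q with ht
  calc ‖b γ‖ₑ ^ p.toReal ≤ ENNReal.ofReal (C * tupleSize S γ ^ N) ^ p.toReal := by
        rw [← ofReal_norm]
        exact ENNReal.rpow_le_rpow (ENNReal.ofReal_le_ofReal (hb γ)) hp0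
    _ = ENNReal.ofReal C ^ p.toReal * (1 + s) ^ q := by
        rw [ENNReal.ofReal_mul hC, ENNReal.mul_rpow_of_nonneg _ _ hp0,
          ← ENNReal.ofReal_rpow_of_nonneg hts hN, h1, ← ENNReal.rpow_mul, mul_comm N]
    _ ≤ ENNReal.ofReal C ^ p.toReal * (2 ^ (q - 1) * (1 + s ^ q)) := by
        gcongr
        simpa using ENNReal.rpow_add_le_mul_rpow_add_rpow 1 s hpN
    _ ≤ ENNReal.ofReal C ^ p.toReal * (2 ^ (q - 1) * (1 + (n : ℝ≥0∞) ^ (q - 1) * t)) := by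
        gcongr
    _ ≤ ENNReal.ofReal C ^ p.toReal *
        (2 ^ (q - 1) * ((1 + (n : ℝ≥0∞) ^ (q - 1)) * (1 + t))) := by
        gcongr
        rw [mul_add, mul_one]
        exact add_le_add le_self_add (mul_le_mul' le_add_self le_rfl)
    _ = _ := by ring

end WordLengthWeight

lemma one_le_fillingExponent {W : Type*} {X : AbstractSimplicialComplex W} {k : ℕ}
    (hpoly : ∀ i : ℕ, 2 ≤ i → i ≤ k → IsPolynomial (fillingFunction X i)) :
    1 ≤ fillingExponent X k := by
  refine Finset.one_le_prod fun i hi => ?_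
  obtain ⟨h1, h2⟩ := Finset.mem_Icc.1 hi
  exact (hpoly i h1 h2).exists_le_degree.1

/-! ### The transfer of an induced cocycle -/

section TransferInduced

set_option linter.unusedSectionVars false

variable {𝕜 G V : Type*} [RCLike 𝕜] [Group G] [MeasurableSpace G] [TopologicalSpace G]
  [IsTopologicalGroup G] [LocallyCompactSpace G] [SecondCountableTopology G] [T2Space G]
  [BorelSpace G] {Λ : Subgroup G} {D D' : Set G} [NormedAddCommGroup V] [NormedSpace 𝕜 V]
  [NormedSpace ℝ V] [SMulCommClass ℝ 𝕜 V] [CompleteSpace V] [TopologicalSpace.SeparableSpace V]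
  {μ : Measure G} [μ.IsHaarMeasure] {p : ℝ≥0∞} [Fact (1 ≤ p)] {n : ℕ} {θ : G → ℝ}
  {ρ : Λ →* (V →ₗᵢ[𝕜] V)} {w : Λ → ℝ≥0∞}

/-- The weight of the retraction of a product of two independent random elements is integrable. -/
lemma lintegral_weight_retraction_mul_ne_top (hΛ : IsLattice Λ)
    (hD' : IsBorelFundamentalDomain Λ D') (hθ : IsBump μ θ) (hw : IsIntegrableWeight μ hD' w) :
    ∫⁻ z, w (retraction hD' (z.1 * z.2)) ∂((bumpMeasure μ θ).prod (bumpMeasure μ θ)) ≠ ⊤ := by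
  have := hΛ.countable
  have := hθ.isProbabilityMeasure
  have hwm : Measurable fun g => w (retraction hD' g) :=
    (measurable_of_countable w).comp (measurable_retraction hΛ hD')
  have hθm : Measurable fun u => ENNReal.ofReal (θ u) := hθ.continuous.measurable.ennreal_ofReal
  obtain ⟨C, hC⟩ := hθ.continuous.bounded_above_of_compact_support hθ.hasCompactSupport
  set K := tsupport θ with hKdef
  have hK : IsCompact K := hθ.hasCompactSupport
  set K₂ : Set G := (fun z : G × G => z.1 * z.2) '' (K ×ˢ K) with hK₂def
  have hK₂ : IsCompact K₂ := (hK.prod hK).image (by fun_prop)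
  have hfin := setLIntegral_retraction_lt_top hΛ hD' μ hw hK₂
  set A : ℝ≥0∞ := ENNReal.ofReal C * ∫⁻ g in K₂, w (retraction hD' g) ∂μ with hA
  have hAt : A ≠ ⊤ := ENNReal.mul_ne_top ENNReal.ofReal_ne_top hfin.ne
  have h1 : ∀ u ∈ K, ∫⁻ h, w (retraction hD' (u * h)) ∂(bumpMeasure μ θ) ≤ A := by
    intro u hu
    have hwu : Measurable fun h => w (retraction hD' (u * h)) :=
      hwm.comp (measurable_const_mul u)
    rw [bumpMeasure, lintegral_withDensity_eq_lintegral_mul _ hθm hwu, ← lintegral_mul_left_eq_self _ u⁻¹, hA,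
      ← lintegral_const_mul _ hwm, ← lintegral_indicator hK₂.measurableSet]
    refine lintegral_mono fun g => ?_
    simp only [Pi.mul_apply, mul_inv_cancel_left]
    by_cases hg : g ∈ K₂
    · rw [Set.indicator_of_mem hg]
      exact mul_le_mul' (ENNReal.ofReal_le_ofReal ((le_abs_self _).trans (hC _))) le_rfl
    · have h0 : θ (u⁻¹ * g) = 0 := by
        by_contra hne
        exact hg ⟨(u, u⁻¹ * g), ⟨hu, subset_tsupport _ hne⟩, by simp⟩
      simp [h0]
  have hm2 : Measurable fun z : G × G => w (retraction hD' (z.1 * z.2)) :=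
    hwm.comp measurable_mul
  rw [lintegral_prod _ hm2.aemeasurable]
  refine ne_top_of_le_ne_top hAt ?_
  calc ∫⁻ u, ∫⁻ h, w (retraction hD' (u * h)) ∂(bumpMeasure μ θ) ∂(bumpMeasure μ θ)
      = ∫⁻ u, ENNReal.ofReal (θ u) *
        ∫⁻ h, w (retraction hD' (u * h)) ∂(bumpMeasure μ θ) ∂μ := by
        conv_lhs => rw [bumpMeasure]
        exact lintegral_withDensity_eq_lintegral_mul _ hθm hm2.lintegral_prod_right'
    _ ≤ ∫⁻ u, ENNReal.ofReal (θ u) * A ∂μ := by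
        refine lintegral_mono fun u => ?_
        by_cases hu : u ∈ K
        · exact mul_le_mul' le_rfl (h1 u hu)
        · simp [image_eq_zero_of_notMem_tsupport hu]
    _ = A := by
        rw [lintegral_mul_const _ hθm, ← ofReal_integral_eq_lintegral_ofReal hθ.integrable
          (Filter.Eventually.of_forall hθ.nonneg), hθ.integral_eq_one, ENNReal.ofReal_one, one_mul]

/-- The transfer of an induced cochain is the average of its random translations. -/
lemma average_average_pullback (hD' : IsBorelFundamentalDomain Λ D') (hθ : IsBump μ θ)
    {b : (Fin n → Λ) → V} (γ : Fin n → Λ)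
    (hint : Integrable (fun z : Fin n → G × G => b fun i =>
        γ i * retraction hD' ((z i).1 * (z i).2))
      (Measure.pi fun _ => (bumpMeasure μ θ).prod (bumpMeasure μ θ))) :
    average (bumpMeasure μ θ) (average (bumpMeasure μ θ) (pullback hD' b)) (fun i => γ i) =
      ∫ z, b (fun i => γ i * retraction hD' ((z i).1 * (z i).2))
        ∂(Measure.pi fun _ => (bumpMeasure μ θ).prod (bumpMeasure μ θ)) := by
  have := hθ.isProbabilityMeasure
  have hmp := measurePreserving_arrowProdEquivProdArrow G G (Fin n)
    (fun _ => bumpMeasure μ θ) fun _ => bumpMeasure μ θ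
  let F : (Fin n → G) × (Fin n → G) → V := fun z =>
    b fun i => γ i * retraction hD' (z.1 i * z.2 i)
  have h1 : ∀ z : Fin n → G × G, F (MeasurableEquiv.arrowProdEquivProdArrow G G (Fin n) z) =
      b fun i => γ i * retraction hD' ((z i).1 * (z i).2) := fun z => rfl
  have hF : Integrable F ((Measure.pi fun _ => bumpMeasure μ θ).prod
      (Measure.pi fun _ => bumpMeasure μ θ)) := by
    rw [← hmp.integrable_comp_emb (MeasurableEquiv.measurableEmbedding _)]
    exact hint
  have h2 := hmp.integral_comp' F
  simp only [h1] at h2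
  rw [h2, integral_prod _ hF]
  simp only [average, pullback, F, mul_assoc, retraction_mul]

end TransferInduced

/-! ### Maps between quotients -/

section Quotients

/-- A continuous linear map that preserves subspaces and is surjective modulo the second one induces
surjections of the quotients by the subspaces and by their closures. -/
lemma exists_surjective_quotient_maps {𝕜 E F : Type*} [RCLike 𝕜] [AddCommGroup E] [Module 𝕜 E]
    [TopologicalSpace E] [ContinuousAdd E] [ContinuousConstSMul 𝕜 E] [AddCommGroup F] [Module 𝕜 F]
    [TopologicalSpace F] [ContinuousAdd F] [ContinuousConstSMul 𝕜 F] (T : E →L[𝕜] F)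
    (A : Submodule 𝕜 E) (B : Submodule 𝕜 F) (hT : ∀ a ∈ A, T a ∈ B)
    (hsurj : ∀ y, ∃ x, T x - y ∈ B) :
    (∃ T' : (E ⧸ A) →L[𝕜] (F ⧸ B), Function.Surjective T') ∧
      ∃ T' : (E ⧸ A.topologicalClosure) →L[𝕜] (F ⧸ B.topologicalClosure),
        Function.Surjective T' := by
  have key : ∀ (A' : Submodule 𝕜 E) (B' : Submodule 𝕜 F), (∀ a ∈ A', T a ∈ B') → B ≤ B' →
      ∃ T' : (E ⧸ A') →L[𝕜] (F ⧸ B'), Function.Surjective T' := by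
    intro A' B' hT' hB
    refine ⟨A'.liftQL (B'.mkQL.comp T) fun a ha => ?_, fun y => ?_⟩
    · simpa using hT' a ha
    · obtain ⟨y, rfl⟩ := B'.mkQ_surjective y
      obtain ⟨x, hx⟩ := hsurj y
      refine ⟨A'.mkQ x, ?_⟩
      rw [Submodule.coe_liftQL, Submodule.mkQ_apply, Submodule.liftQ_apply]
      exact (Submodule.Quotient.eq B').2 (hB hx)
  refine ⟨key A B hT le_rfl, key _ _ ?_ B.le_topologicalClosure⟩
  have h1 : A.topologicalClosure ≤ B.topologicalClosure.comap T.toLinearMap :=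
    A.topologicalClosure_minimal (fun a ha => B.le_topologicalClosure (hT a ha))
      (B.isClosed_topologicalClosure.preimage T.continuous)
  exact fun a ha => h1 ha

end Quotients

lemma mem_coboundaries_of_eq_tupleCoboundary {𝕜 Γ V : Type*} [RCLike 𝕜] [Group Γ]
    [TopologicalSpace Γ] [DiscreteTopology Γ] [NormedAddCommGroup V] [NormedSpace 𝕜 V]
    {ρ : Γ →* (V →ₗᵢ[𝕜] V)} {k : ℕ} {q : (Fin k → Γ) → V}
    (hq : ∀ (l : Γ) γ, (q fun i => l * γ i) = ρ l (q γ)) (hq0 : k = 0 → q = 0)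
    {c : C(Fin (k + 1) → Γ, V)} (hc : ∀ γ, c γ = tupleCoboundary 𝕜 q γ) :
    c ∈ coboundaries ρ k := by
  cases k with
  | zero =>
    rw [coboundaries, Submodule.mem_bot]
    ext γ
    rw [hc, hq0 rfl]
    simp [tupleCoboundary]
  | succ k =>
    refine ⟨⟨q, continuous_of_discreteTopology⟩, hq, ?_⟩
    ext γ
    exact (hc γ).symm

/-! ### The transfer on cohomology -/

section TransferCohomology

set_option linter.unusedSectionVars false

variable {𝕜 G V : Type*} [RCLike 𝕜] [Group G] [MeasurableSpace G] [TopologicalSpace G]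
  [IsTopologicalGroup G] [LocallyCompactSpace G] [SecondCountableTopology G] [T2Space G]
  [BorelSpace G] {Λ : Subgroup G} {D D' : Set G} [NormedAddCommGroup V] [NormedSpace 𝕜 V]
  [NormedSpace ℝ V] [SMulCommClass ℝ 𝕜 V] [CompleteSpace V] [TopologicalSpace.SeparableSpace V]
  {μ : Measure G} [μ.IsHaarMeasure] {p : ℝ≥0∞} [Fact (1 ≤ p)] {θ : G → ℝ}
  {ρ : Λ →* (V →ₗᵢ[𝕜] V)} {w : Λ → ℝ≥0∞}
  (hΛ : IsLattice Λ) (hD : IsBorelFundamentalDomain Λ D) (hθ : IsBump μ θ)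

variable (ρ p) in
/-- The transfer on cocycles. -/
def transferCocycles (k : ℕ) : cocycles (inducedRep hΛ hD μ ρ p) k →L[𝕜] cocycles ρ k where
  toFun c := ⟨transfer hΛ hD hθ ρ p k ⟨c.1, c.2.1⟩, transfer_mem hΛ hD hθ _, by
    have h := transfer_coboundary hΛ hD hθ (ρ := ρ) (p := p) ⟨c.1, c.2.1⟩ 0 c.2.2.symm
    rw [map_zero] at h
    exact h.symm⟩
  map_add' a b := Subtype.ext (map_add (transfer hΛ hD hθ ρ p k) ⟨a.1, a.2.1⟩ ⟨b.1, b.2.1⟩)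
  map_smul' r a := Subtype.ext (map_smul (transfer hΛ hD hθ ρ p k) r ⟨a.1, a.2.1⟩)
  cont := Continuous.subtype_mk ((continuous_transfer hΛ hD hθ).comp
    (Continuous.subtype_mk continuous_subtype_val _)) _

lemma transferCocycles_mem_coboundaries (k : ℕ) (c : cocycles (inducedRep hΛ hD μ ρ p) k)
    (hc : c.1 ∈ coboundaries (inducedRep hΛ hD μ ρ p) k) :
    (transferCocycles p ρ hΛ hD hθ k c).1 ∈ coboundaries ρ k := by
  cases k with
  | zero =>
    have h0 : c = 0 := Subtype.ext ((Submodule.mem_bot 𝕜).1 hc)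
    rw [h0, map_zero]
    exact Submodule.zero_mem _
  | succ k =>
    obtain ⟨e, he, hec⟩ := hc
    exact ⟨transfer hΛ hD hθ ρ p k ⟨e, he⟩, transfer_mem hΛ hD hθ _,
      (transfer_coboundary hΛ hD hθ ⟨e, he⟩ ⟨c.1, c.2.1⟩ hec.symm).symm⟩

/-- The class of a lattice cocycle with values dominated by an integrable weight is the transfer of
the class of the induced cocycle. -/
lemma exists_transferCocycles_sub_mem_coboundaries (hD' : IsBorelFundamentalDomain Λ D')
    (hp : p ≠ ⊤) (hw : IsQuasiSubadditive w) (hwi : IsIntegrableWeight μ hD' w) {k : ℕ}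
    {b : (Fin (k + 1) → Λ) → V} (hb : ∀ (l : Λ) γ, (b fun i => l * γ i) = ρ l (b γ))
    (hb0 : tupleCoboundary 𝕜 b = 0) (hbw : IsDominated p w b) :
    ∃ (c : cocycles (inducedRep hΛ hD μ ρ p) k) (q : (Fin k → Λ) → V),
      (∀ (l : Λ) γ, (q fun i => l * γ i) = ρ l (q γ)) ∧ (k = 0 → q = 0) ∧
      ∀ γ, (transferCocycles p ρ hΛ hD hθ k c).1 γ - b γ = tupleCoboundary 𝕜 q γ := by
  have := hΛ.countable
  have := hΛ.discrete
  have := hθ.isProbabilityMeasure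
  have hξ : Measurable fun z : G × G => retraction hD' (z.1 * z.2) :=
    (measurable_retraction hΛ hD').comp measurable_mul
  obtain ⟨q, hq, hq0, hbq⟩ := exists_integral_translation_sub_eq (𝕜 := 𝕜) (ρ := ρ) hp hw hb hb0 hbw
    hξ (lintegral_weight_retraction_mul_ne_top hΛ hD' hθ hwi)
  refine ⟨⟨inducedCochain hΛ hD hD' hp hθ hb hwi hbw,
    inducedCochain_equivariant hΛ hD hD' hp hθ hb hwi hbw,
    coboundary_inducedCochain hΛ hD hD' hp hθ hwi hb hbw hb0⟩, q, hq, hq0, fun γ => ?_⟩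
  obtain ⟨hint, h⟩ := hbq γ
  rw [← h, ← average_average_pullback hD' hθ γ hint]
  congr 1
  exact transfer_apply hΛ hD hθ _ (isKernel_inducedCochain hΛ hD hD' hp hθ hb hwi hbw) γ

end TransferCohomology

end LatticeInduction

end

theorem mainTheorem5 {𝕜 : Type*} [RCLike 𝕜]
    {G : Type*} [Group G] [TopologicalSpace G] [IsTopologicalGroup G] [LocallyCompactSpace G]
    [SecondCountableTopology G] [T2Space G] [MeasurableSpace G] [BorelSpace G]
    (μ : Measure G) [μ.IsHaarMeasure]
    (Λ : Subgroup G) (hΛ : IsLattice Λ)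
    {V : Type*} [NormedAddCommGroup V] [NormedSpace 𝕜 V] [CompleteSpace V]
    [TopologicalSpace.SeparableSpace V]
    (ρ : Λ →* (V →ₗᵢ[𝕜] V))
    (d : ℕ) {W : Type*} [MulAction Λ W] (X : AbstractSimplicialComplex W)
    (hX : IsFinitenessModel Λ X (d + 1))
    (hpoly : ∀ i : ℕ, 2 ≤ i → i ≤ d → IsPolynomial (fillingFunction X i))
    (p : ℝ≥0∞) [Fact (1 ≤ p)] (hp : p ≠ ⊤)
    (k : ℕ) (hk : k ≤ d)
    (hint : IsLpIntegrable Λ μ (p.toReal * fillingExponent X k))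
    {D : Set G} (hD : IsBorelFundamentalDomain Λ D) :
    (∃ T : ContCohomology (inducedRep hΛ hD μ ρ p) k →L[𝕜] ContCohomology ρ k,
      Function.Surjective T) ∧
    (∃ T : ReducedContCohomology (inducedRep hΛ hD μ ρ p) k →L[𝕜] ReducedContCohomology ρ k,
      Function.Surjective T) := by
  let instV : NormedSpace ℝ V := NormedSpace.restrictScalars ℝ 𝕜 V
  have hcomm : SMulCommClass ℝ 𝕜 V := ⟨fun r a v => smul_comm (algebraMap ℝ 𝕜 r) a v⟩
  have := hΛ.discrete
  obtain ⟨S, hS, D', hD', hfin⟩ := hint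
  obtain ⟨θ, hθ⟩ := exists_isBump μ
  have hN : 1 ≤ fillingExponent X k :=
    one_le_fillingExponent fun i h2 hi => hpoly i h2 (hi.trans hk)
  have hp1 : 1 ≤ p.toReal := by simpa using ENNReal.toReal_mono hp (Fact.out : 1 ≤ p)
  have hpN : 1 ≤ p.toReal * fillingExponent X k := one_le_mul_of_one_le_of_one_le hp1 hN
  have hw := isQuasiSubadditive_wordLength hS hpN
  have hwi : IsIntegrableWeight μ hD' fun γ : Λ =>
      (wordLength (S : Set Λ) γ : ℝ≥0∞) ^ (p.toReal * fillingExponent X k) := by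
    -- Finiteness for each group element implies local boundedness.
    obtain ⟨c, hc, hcw⟩ := hw.exists_mul_le
    exact fun K hK => exists_lintegral_cocycle_le hΛ hD' μ hc hcw hfin hK
  refine exists_surjective_quotient_maps (transferCocycles p ρ hΛ hD hθ k) _ _
    (fun c hc => transferCocycles_mem_coboundaries hΛ hD hθ k c hc) fun z => ?_
  -- Replace the given cocycle by a cohomologous one of polynomial growth.
  obtain ⟨b, hb, hb0, ⟨C, hC, hCb⟩, q, hq, hq0, hbq⟩ := exists_cocycle_polynomial_growth hX hpoly hS
    ρ hk z.2.1 (funext fun γ => DFunLike.congr_fun z.2.2 γ)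
  obtain ⟨c, q', hq', hq0', hcq⟩ := exists_transferCocycles_sub_mem_coboundaries (ρ := ρ)
    hΛ hD hθ hD' hp hw hwi hb hb0
    (isDominated_of_polynomial_growth (zero_le_one.trans hN) hpN hC hCb)
  refine ⟨c, ?_⟩
  refine mem_coboundaries_of_eq_tupleCoboundary (ρ := ρ) (q := q' + q) (fun l γ => ?_)
    (fun h0 => by rw [hq0' h0, hq0 h0, add_zero]) fun γ => ?_
  · simp [hq', hq]
  · have h1 := congrFun hbq γ
    have h2 := hcq γ
    rw [Pi.sub_apply] at h1
    have h3 : tupleCoboundary 𝕜 (q' + q) γ = tupleCoboundary 𝕜 q' γ + tupleCoboundary 𝕜 q γ := by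
      simp [tupleCoboundary, smul_add, Finset.sum_add_distrib]
    rw [h3, ← h1, ← h2, sub_add_sub_cancel]
    rfl
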